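/- Let $\mathbb{K}$ be a field and let $$T=\langle\zeta\rangle\times\langle\chi_1,\chi_2,\chi_3,\chi_4\mid \chi_i\chi_j=\chi_{i\triangleright j}\chi_i,\ 1\le i,j\le 4\rangle ,$$ where $\langle\zeta\rangle$ is infinite cyclic and $\triangleright$ is the operation of the tetrahedron quandle: the rows $(i\triangleright 1,\dots,i\triangleright 4)$ for $i=1,2,3,4$ are $(1,4,2,3)$, $(3,2,4,1)$, $(4,1,3,2)$, $(2,3,1,4)$. Let $G$ be a non-abelian group and let $T\to G$ be a surjective group homomorphism; let $z$ and $x_1,\dots,x_4$ be the images of $\zeta$ and $\chi_1,\dots,\chi_4$. Then $z$ is central, and the centralizer $G^{x_1}$ of $x_1$ contains $x_1$, $x_2x_3$ and $z$. For $x\in G$ and a representation $\tau$ of $G^{x}$ over $\mathbb{K}$, let $M(x,\tau)=\mathbb{K}G\otimes_{\mathbb{K}G^x}\tau$ be the Yetter–Drinfeld module over $G$ in which $h\otimes a$ has degree $hxh^{-1}$. For Yetter–Drinfeld modules $V,W$ over $G$ let $\mathfrak{B}(V\oplus W)$ be the Nichols algebra of $V\oplus W$, and let $(\mathrm{ad}\,V)^m(W)\subseteq\mathfrak{B}(V\oplus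 W)$ be the Yetter–Drinfeld submodule spanned by the elements $(\mathrm{ad}\,v_1)\cdots(\mathrm{ad}\,v_m)(w)$ with $v_i\in V$, $w\in W$, where $(\mathrm{ad}\,v)(y)=vy-(g\cdot y)v$ for $v\in V$ of degree $g\in G$; define $(\mathrm{ad}\,W)^m(V)$ likewise. A Yetter–Drinfeld module $X$ over $G$ is absolutely simple if $L\otimes_{\mathbb{K}}X$ is a simple Yetter–Drinfeld module over $LG$ for each field extension $L/\mathbb{K}$. Let $V=M(z,\rho)$ and $W=M(x_1,\sigma)$, where $\rho$ and $\sigma$ are representations of degree one (characters) of $G^z=G$ and of $G^{x_1}$, respectively. Assume that $$\rho(x_1)\sigma(z)\neq 1,\qquad \sigma(x_1)=-1,\qquad \rho(x_1z)\sigma(z)=1 .$$ Then the following hold. 1. $(\mathrm{ad}\,V)(W)$ is absolutely simple and $(\mathrm{ad}\,V)^2(W)=0$. 2. The Yetter–Drinfeld modules $(\mathrm{ad}\,W)^m(V)$ are absolutely simple or zero for all $m\in\mathbb{N}_0$ if and only if $(\rho(x_1)\sigma(z))^2-\rho(x_1)\sigma(z)+1=0$ and $\sigma(x_2x_3)=1$.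 In this case, $(\mathrm{ad}\,W)^3(V)\neq 0$ and $(\mathrm{ad}\,W)^4(V)=0$. -/

import Mathlib

universe u
open scoped TensorProduct

/-- A (left) Yetter-Drinfeld module structure over the group algebra `K G` on the vector space `V`:
a representation `act` of `G` and a `K G`-comodule structure `coact`. Since
`K G ⊗ V = ⨁ g, V` is `G →₀ V`, the coaction is a linear map `V → (G →₀ V)`, and `coact v g` is
the component of `v` in degree `g`. So `coact` is the same as a decomposition `V = ⨁ g, V_g`, and
`compat` says that `g V_h ⊆ V_{g h g⁻¹}`. -/
structure YDModule (K G V : Type*) [Field K] [Group G] [AddCommGroup V] [Module K V] where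
  act : Representation K G V
  coact : V →ₗ[K] (G →₀ V)
  counit : ∀ v, ((coact v).sum fun _ w => w) = v
  coassoc : ∀ v g, coact (coact v g) = Finsupp.single g (coact v g)
  compat : ∀ g h v, coact (act g v) (g * h * g⁻¹) = act g (coact v h)

namespace YDModule

section Basic

variable {K G V : Type*} [Field K] [Group G] [AddCommGroup V] [Module K V]

/-- `v` lies in the homogeneous component `V_g`, that is, `δ(v) = g ⊗ v`. -/
def IsHomogeneous (D : YDModule K G V) (g : G) (v : V) : Prop :=
  D.coact v = Finsupp.single g v

theorem coact_homogeneous (D : YDModule K G V) (v : V) (g : G) :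
    D.IsHomogeneous g (D.coact v g) := D.coassoc v g

theorem induction_homogeneous (D : YDModule K G V) {p : V → Prop}
    (zero : p 0) (add : ∀ v w, p v → p w → p (v + w))
    (hom : ∀ g v, D.IsHomogeneous g v → p v) (v : V) : p v := by
  rw [← D.counit v]
  exact Finset.sum_induction _ p add zero fun g _ => hom g _ (D.coassoc v g)

theorem IsHomogeneous.act {D : YDModule K G V} {h : G} {v : V} (hv : D.IsHomogeneous h v)
    (g : G) : D.IsHomogeneous (g * h * g⁻¹) (D.act g v) := by
  classical
  unfold IsHomogeneous at *
  ext k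
  have := D.compat g (g⁻¹ * k * g) v
  rw [show g * (g⁻¹ * k * g) * g⁻¹ = k by group] at this
  rw [this, hv, Finsupp.single_apply, Finsupp.single_apply]
  by_cases hk : g * h * g⁻¹ = k
  · rw [if_pos hk, if_pos (by rw [← hk]; group)]
  · rw [if_neg hk, if_neg (fun h' => hk (by rw [h']; group)), map_zero]

/-- A way to construct Yetter-Drinfeld modules: it is enough to check the axioms on a set of
homogeneous vectors that generates `V` additively (`P g v` says that `v` is in the generating set,
with degree `g`). -/
def ofGenerators (act : Representation K G V) (coact : V →ₗ[K] (G →₀ V)) (P : G → V → Prop)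
    (ind : ∀ p : V → Prop, p 0 → (∀ v w, p v → p w → p (v + w)) → (∀ g v, P g v → p v) → ∀ v, p v)
    (hcoact : ∀ g v, P g v → coact v = Finsupp.single g v)
    (hact : ∀ g h v, P h v → coact (act g v) = Finsupp.single (g * h * g⁻¹) (act g v)) :
    YDModule K G V where
  act := act
  coact := coact
  counit := by
    refine ind _ (by simp) (fun v w hv hw => ?_) (fun g v hv => ?_)
    · rw [map_add, Finsupp.sum_add_index' (fun _ => rfl) (fun _ _ _ => rfl), hv, hw]
    · rw [hcoact g v hv, Finsupp.sum_single_index rfl]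
  coassoc := by
    classical
    refine ind _ (by simp) (fun v w hv hw g => ?_) (fun g v hv h => ?_)
    · rw [map_add, Finsupp.add_apply, map_add, hv, hw, Finsupp.single_add]
    · rw [hcoact g v hv, Finsupp.single_apply]
      split_ifs with hg
      · rw [hcoact g v hv, hg]
      · simp
  compat := by
    classical
    intro g h
    refine ind _ (by simp) (fun v w hv hw => ?_) (fun k v hv => ?_)
    · simp only [map_add, Finsupp.add_apply, hv, hw]
    · rw [hact g k v hv, hcoact k v hv, Finsupp.single_apply, Finsupp.single_apply]
      by_cases hk : k = h
      · rw [if_pos (by rw [hk]), if_pos hk]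
      · rw [if_neg (fun h' => hk (by simpa using h')), if_neg hk, map_zero]

/-- `N` is a Yetter-Drinfeld submodule: stable under `G`, and a graded subspace. -/
def IsSub (D : YDModule K G V) (N : Submodule K V) : Prop :=
  (∀ g, ∀ v ∈ N, D.act g v ∈ N) ∧ ∀ g, ∀ v ∈ N, D.coact v g ∈ N

/-- Simple objects: non-zero, and without Yetter-Drinfeld submodules other than `0` and the whole
module. -/
def IsSimple (D : YDModule K G V) : Prop :=
  Nontrivial V ∧ ∀ N : Submodule K V, D.IsSub N → N = ⊥ ∨ N = ⊤

/-- The Yetter-Drinfeld module structure on a Yetter-Drinfeld submodule. -/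
noncomputable def restrict (D : YDModule K G V) (N : Submodule K V) (hN : D.IsSub N) : YDModule K G N where
  act :=
    { toFun := fun g => (D.act g).restrict (hN.1 g)
      map_one' := by ext; simp
      map_mul' := fun g h => by ext; simp }
  coact :=
    { toFun := fun v =>
        { support := (D.coact v).support
          toFun := fun g => ⟨D.coact v g, hN.2 g v v.2⟩
          mem_support_toFun := fun g => by simp }
      map_add' := fun v w => by ext g; simp
      map_smul' := fun c v => by ext g; simp }
  counit := fun v => by
    apply Subtype.ext
    simpa [Finsupp.sum] using D.counit v
  coassoc := fun v g => by
    classical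
    ext h
    have := DFunLike.congr_fun (D.coassoc v g) h
    simp only [Finsupp.single_apply, LinearMap.coe_mk, AddHom.coe_mk, Finsupp.coe_mk] at this ⊢
    rw [this]
    split_ifs <;> simp
  compat := fun g h v => by
    apply Subtype.ext
    simpa using D.compat g h v

open Classical in
/-- Extension of scalars: the Yetter-Drinfeld module `L ⊗ V` over `L G`, with `g (a ⊗ v) = a ⊗ g v`
and `(L ⊗ V)_g = L ⊗ V_g`. -/
noncomputable def baseChange (L : Type*) [Field L] [Algebra K L] (D : YDModule K G V) :
    YDModule L G (L ⊗[K] V) :=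
  ofGenerators
    { toFun := fun g => (D.act g).baseChange L
      map_one' := by ext; simp
      map_mul' := fun g h => by ext; simp }
    ((TensorProduct.finsuppRight K L L V G).toLinearMap ∘ₗ D.coact.baseChange L)
    (fun g u => ∃ (a : L) (v : V), D.IsHomogeneous g v ∧ u = a ⊗ₜ[K] v)
    (fun p h0 hadd hhom u => by
      induction u with
      | zero => exact h0
      | add x y hx hy => exact hadd x y hx hy
      | tmul a v =>
        induction v using D.induction_homogeneous with
        | zero => simpa using h0
        | add v w hv hw => rw [TensorProduct.tmul_add]; exact hadd _ _ hv hw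
        | hom g v hv => exact hhom g _ ⟨a, v, hv, rfl⟩)
    (by
      rintro g _ ⟨a, v, hv, rfl⟩
      unfold IsHomogeneous at hv
      simp [hv])
    (by
      rintro g h _ ⟨a, v, hv, rfl⟩
      have h2 := hv.act g
      unfold IsHomogeneous at h2
      simp [h2])

/-- `V` is absolutely simple if `L ⊗ V` is a simple Yetter-Drinfeld module over `L G` for each field
extension `L` of `K`. -/
def IsAbsolutelySimple {K : Type u} {G V : Type*} [Field K] [Group G] [AddCommGroup V]
    [Module K V] (D : YDModule K G V) : Prop :=
  ∀ (L : Type u) [Field L] [Algebra K L], (D.baseChange L).IsSimple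

/-- The direct sum of two Yetter-Drinfeld modules. -/
noncomputable def prod {W : Type*} [AddCommGroup W] [Module K W] (D : YDModule K G V)
    (E : YDModule K G W) : YDModule K G (V × W) :=
  ofGenerators
    { toFun := fun g => (D.act g).prodMap (E.act g)
      map_one' := by ext <;> simp
      map_mul' := fun g h => by ext <;> simp }
    (Finsupp.mapRange.linearMap (LinearMap.inl K V W) ∘ₗ D.coact ∘ₗ LinearMap.fst K V W +
      Finsupp.mapRange.linearMap (LinearMap.inr K V W) ∘ₗ E.coact ∘ₗ LinearMap.snd K V W)
    (fun g u => D.IsHomogeneous g u.1 ∧ E.IsHomogeneous g u.2)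
    (fun p h0 hadd hhom u => by
      have hu : u = (u.1, 0) + (0, u.2) := by simp
      rw [hu]
      refine hadd _ _ ?_ ?_
      · induction u.1 using D.induction_homogeneous with
        | zero => exact h0
        | add x y hx hy => simpa using hadd _ _ hx hy
        | hom g x hx => exact hhom g _ ⟨hx, by simp [IsHomogeneous]⟩
      · induction u.2 using E.induction_homogeneous with
        | zero => exact h0
        | add x y hx hy => simpa using hadd _ _ hx hy
        | hom g x hx => exact hhom g _ ⟨by simp [IsHomogeneous], hx⟩)
    (by
      rintro g v ⟨h1, h2⟩
      unfold IsHomogeneous at h1 h2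
      simp [h1, h2, ← Finsupp.single_add])
    (by
      rintro g h v ⟨h1, h2⟩
      have h3 := h1.act g
      have h4 := h2.act g
      unfold IsHomogeneous at h3 h4
      simp [h3, h4, ← Finsupp.single_add])

end Basic

section Induced

variable {K G A : Type*} [Field K] [Group G] [AddCommGroup A] [Module K A]

/-- The coaction on the induced representation of `G`. In the notation `K G ⊗_{K G^x} A` for the
induced representation, the element `IndV.mk h a` is `h⁻¹ ⊗ a`, which has degree `h⁻¹ x h`. -/
noncomputable def inducedCoact (x : G)
    (σ : Representation K (Subgroup.centralizer ({x} : Set G)) A) :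
    Representation.IndV (Subgroup.centralizer ({x} : Set G)).subtype σ →ₗ[K]
      (G →₀ Representation.IndV (Subgroup.centralizer ({x} : Set G)).subtype σ) :=
  Representation.Coinvariants.lift _
    (TensorProduct.lift (Finsupp.lsum K (fun h : G =>
        LinearMap.toSpanSingleton K (A →ₗ[K] (G →₀ _))
          (Finsupp.lsingle (h⁻¹ * x * h) ∘ₗ Representation.IndV.mk _ σ h)) ∘ₗ
      (MonoidAlgebra.coeffLinearEquiv K).toLinearMap))
    (fun c => by
      have hc : (c : G)⁻¹ * x * c = x := by
        have := Subgroup.mem_centralizer_singleton_iff.1 c.2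
        rw [mul_assoc, ← this]; group
      refine TensorProduct.ext (MonoidAlgebra.lhom_ext' fun h => LinearMap.ext_ring ?_)
      ext a
      have : (h⁻¹ * (c : G)⁻¹ * x * ((c : G) * h)) = h⁻¹ * x * h := by
        calc _ = h⁻¹ * ((c : G)⁻¹ * x * c) * h := by group
          _ = _ := by rw [hc]
      simp [this, ← Representation.Coinvariants.mk_inv_tmul])

theorem inducedCoact_mk (x : G)
    (σ : Representation K (Subgroup.centralizer ({x} : Set G)) A) (h : G) (a : A) :
    inducedCoact x σ (Representation.IndV.mk _ σ h a) =
      Finsupp.single (h⁻¹ * x * h) (Representation.IndV.mk _ σ h a) := by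
  simp [inducedCoact]

/-- The Yetter-Drinfeld module `M(x, σ) = K G ⊗_{K G^x} A`, where `σ` is a representation of the
centralizer `G^x` of `x` on `A`: the group acts by left multiplication, and `h ⊗ a` has degree
`h x h⁻¹`. -/
noncomputable def induced (x : G)
    (σ : Representation K (Subgroup.centralizer ({x} : Set G)) A) :
    YDModule K G (Representation.IndV (Subgroup.centralizer ({x} : Set G)).subtype σ) :=
  ofGenerators (Representation.ind _ σ) (inducedCoact x σ)
    (fun g v => ∃ (h : G) (a : A), g = h⁻¹ * x * h ∧ v = Representation.IndV.mk _ σ h a)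
    (fun p h0 hadd hhom v => by
      induction v using Representation.Coinvariants.induction_on with
      | h t =>
        induction t with
        | zero => rw [map_zero]; exact h0
        | add s t hs ht => rw [map_add]; exact hadd _ _ hs ht
        | tmul f a =>
          induction f using MonoidAlgebra.induction_linear with
          | zero => rw [TensorProduct.zero_tmul, map_zero]; exact h0
          | add f f' hf hf' => rw [TensorProduct.add_tmul, map_add]; exact hadd _ _ hf hf'
          | single h c =>
            refine hhom (h⁻¹ * x * h) _ ⟨h, c • a, rfl, ?_⟩
            simp only [LinearMap.comp_apply, TensorProduct.mk_apply, map_smul]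
            rw [← map_smul, TensorProduct.smul_tmul', MonoidAlgebra.smul_single, smul_eq_mul,
              mul_one])
    (by
      rintro _ _ ⟨h, a, rfl, rfl⟩
      exact inducedCoact_mk x σ h a)
    (by
      rintro g _ _ ⟨h, a, rfl, rfl⟩
      rw [Representation.ind_mk, inducedCoact_mk]
      congr 1
      group)

end Induced

section Tensor

variable {K G U : Type*} [Field K] [Group G] [AddCommGroup U] [Module K U]

open TensorAlgebra

/-- The diagonal action of `G` on the tensor algebra `T(U)`, by algebra automorphisms. -/
noncomputable def tensorAct (D : YDModule K G U) : G →* (TensorAlgebra K U →ₐ[K] TensorAlgebra K U) where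
  toFun g := TensorAlgebra.lift K (TensorAlgebra.ι K ∘ₗ D.act g)
  map_one' := by ext; simp
  map_mul' g h := by ext; simp

@[simp] theorem tensorAct_ι (D : YDModule K G U) (g : G) (u : U) :
    D.tensorAct g (ι K u) = ι K (D.act g u) := by simp [tensorAct]

/-- The `G`-grading of the tensor algebra `T(U)` that extends the one of `U` multiplicatively, written
as the coaction `T(U) → T(U) ⊗ K G`, an algebra homomorphism. -/
noncomputable def tensorCoact (D : YDModule K G U) :
    TensorAlgebra K U →ₐ[K] MonoidAlgebra (TensorAlgebra K U) G :=
  TensorAlgebra.lift K ((MonoidAlgebra.coeffLinearEquiv K).symm.toLinearMap ∘ₗ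
    Finsupp.mapRange.linearMap (ι K) ∘ₗ D.coact)

theorem tensorCoact_ι (D : YDModule K G U) {g : G} {u : U} (hu : D.IsHomogeneous g u) :
    D.tensorCoact (ι K u) = MonoidAlgebra.single g (ι K u) := by
  unfold IsHomogeneous at hu
  simp [tensorCoact, hu]

/-- `x` is a scalar multiple of a product of homogeneous vectors of `U`, with total degree `g`. -/
inductive IsMonomial (D : YDModule K G U) : G → TensorAlgebra K U → Prop
  | algebraMap (c : K) : IsMonomial D 1 (algebraMap K _ c)
  | mul (g h : G) (u : U) (y : TensorAlgebra K U) :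
      D.IsHomogeneous g u → IsMonomial D h y → IsMonomial D (g * h) (ι K u * y)

theorem induction_left {p : TensorAlgebra K U → Prop} (hc : ∀ c : K, p (algebraMap K _ c))
    (hadd : ∀ x y, p x → p y → p (x + y)) (hmul : ∀ u y, p y → p (ι K u * y))
    (x : TensorAlgebra K U) : p x := by
  have key : ∀ x y : TensorAlgebra K U, (∀ c : K, p (c • y)) → ∀ c : K, p (c • (x * y)) := by
    intro x
    induction x using TensorAlgebra.induction with
    | algebraMap r =>
      intro y hy c
      rw [← Algebra.smul_def, smul_smul]
      exact hy _
    | ι u =>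
      intro y hy c
      rw [← mul_smul_comm]
      exact hmul u _ (hy c)
    | mul a b ha hb =>
      intro y hy c
      rw [mul_assoc]
      exact ha _ (hb _ hy) c
    | add a b ha hb =>
      intro y hy c
      rw [add_mul, smul_add]
      exact hadd _ _ (ha _ hy c) (hb _ hy c)
  have := key x 1 (fun c => by rw [← Algebra.algebraMap_eq_smul_one]; exact hc c) 1
  rwa [one_smul, mul_one] at this

theorem induction_monomial (D : YDModule K G U) {p : TensorAlgebra K U → Prop} (h0 : p 0)
    (hadd : ∀ x y, p x → p y → p (x + y)) (hmon : ∀ g x, D.IsMonomial g x → p x)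
    (x : TensorAlgebra K U) : p x := by
  suffices h : x ∈ AddSubmonoid.closure {x | ∃ g, D.IsMonomial g x} by
    induction h using AddSubmonoid.closure_induction with
    | mem x hx => exact hx.elim fun g hx => hmon g x hx
    | zero => exact h0
    | add x y _ _ hx hy => exact hadd x y hx hy
  induction x using induction_left with
  | hc c => exact AddSubmonoid.subset_closure ⟨1, .algebraMap c⟩
  | hadd x y hx hy => exact add_mem hx hy
  | hmul u y hy =>
    induction hy using AddSubmonoid.closure_induction with
    | mem y hy =>
      obtain ⟨h, hy⟩ := hy
      induction u using D.induction_homogeneous with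
      | zero => rw [map_zero, zero_mul]; exact zero_mem _
      | add u v hu hv => rw [map_add, add_mul]; exact add_mem hu hv
      | hom g u hu => exact AddSubmonoid.subset_closure ⟨g * h, .mul g h u y hu hy⟩
    | zero => rw [mul_zero]; exact zero_mem _
    | add x y _ _ hx hy => rw [mul_add]; exact add_mem hx hy

theorem IsMonomial.tensorCoact {D : YDModule K G U} {g : G} {x : TensorAlgebra K U}
    (hx : D.IsMonomial g x) : D.tensorCoact x = MonoidAlgebra.single g x := by
  induction hx with
  | algebraMap c => rw [AlgHom.commutes]; rfl
  | mul g h u y hu _ hy => rw [map_mul, hy, D.tensorCoact_ι hu, MonoidAlgebra.single_mul_single]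

theorem IsMonomial.tensorAct {D : YDModule K G U} {h : G} {x : TensorAlgebra K U}
    (hx : D.IsMonomial h x) (g : G) : D.IsMonomial (g * h * g⁻¹) (D.tensorAct g x) := by
  induction hx with
  | algebraMap c =>
    rw [AlgHom.commutes, mul_one, mul_inv_cancel]
    exact .algebraMap c
  | mul k h u y hu _ hy =>
    rw [map_mul, tensorAct_ι, show g * (k * h) * g⁻¹ = (g * k * g⁻¹) * (g * h * g⁻¹) by group]
    exact .mul _ _ _ _ (hu.act g) hy

/-- The tensor algebra `T(U)` as a Yetter-Drinfeld module. -/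
noncomputable def tensor (D : YDModule K G U) : YDModule K G (TensorAlgebra K U) :=
  ofGenerators
    { toFun := fun g => (D.tensorAct g).toLinearMap
      map_one' := by rw [map_one]; rfl
      map_mul' := fun g h => by rw [map_mul]; rfl }
    ((MonoidAlgebra.coeffLinearEquiv K).toLinearMap ∘ₗ D.tensorCoact.toLinearMap)
    D.IsMonomial
    (fun _ h0 hadd hmon => D.induction_monomial h0 hadd hmon)
    (fun g x hx => by simp [hx.tensorCoact])
    (fun g h x hx => by simp [(hx.tensorAct g).tensorCoact])

theorem tensor_isHomogeneous_iff (D : YDModule K G U) (g : G) (x : TensorAlgebra K U) :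
    D.tensor.IsHomogeneous g x ↔ D.tensorCoact x = MonoidAlgebra.single g x :=
  MonoidAlgebra.coeff_injective.eq_iff (a := D.tensorCoact x) (b := MonoidAlgebra.single g x)

theorem tensor_isHomogeneous_ι {D : YDModule K G U} {g : G} {u : U} (hu : D.IsHomogeneous g u) :
    D.tensor.IsHomogeneous g (ι K u) :=
  (D.tensor_isHomogeneous_iff _ _).2 (D.tensorCoact_ι hu)

theorem tensor_isHomogeneous_mul {D : YDModule K G U} {g h : G} {x y : TensorAlgebra K U}
    (hx : D.tensor.IsHomogeneous g x) (hy : D.tensor.IsHomogeneous h y) :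
    D.tensor.IsHomogeneous (g * h) (x * y) := by
  rw [tensor_isHomogeneous_iff] at *
  rw [map_mul, hx, hy, MonoidAlgebra.single_mul_single]

/-- Definition of linear maps on `T(U)` by recursion: the linear map `r` with `r 1 = m₀` and
`r (u * y) = f u y + F u (r y)` for `u ∈ U`. -/
noncomputable def tensorRec {M : Type*} [AddCommGroup M] [Module K M] (m₀ : M)
    (f : U →ₗ[K] TensorAlgebra K U →ₗ[K] M) (F : U →ₗ[K] M →ₗ[K] M) :
    TensorAlgebra K U →ₗ[K] M :=
  LinearMap.snd K (TensorAlgebra K U) M ∘ₗ LinearMap.applyₗ (1, m₀) ∘ₗ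
    (TensorAlgebra.lift K (A := Module.End K (TensorAlgebra K U × M))
      (LinearMap.mk₂ K (fun u q => (ι K u * q.1, f u q.1 + F u q.2))
        (fun u v q => by ext <;> simp [add_mul]; abel)
        (fun c u q => by ext <;> simp)
        (fun u q r => by ext <;> simp [mul_add]; abel)
        (fun c u q => by ext <;> simp))).toLinearMap

theorem tensorRec_one {M : Type*} [AddCommGroup M] [Module K M] (m₀ : M)
    (f : U →ₗ[K] TensorAlgebra K U →ₗ[K] M) (F : U →ₗ[K] M →ₗ[K] M) :
    tensorRec m₀ f F 1 = m₀ := by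
  simp [tensorRec]

theorem tensorRec_ι_mul {M : Type*} [AddCommGroup M] [Module K M] (m₀ : M)
    (f : U →ₗ[K] TensorAlgebra K U →ₗ[K] M) (F : U →ₗ[K] M →ₗ[K] M) (u : U)
    (y : TensorAlgebra K U) :
    tensorRec m₀ f F (ι K u * y) = f u y + F u (tensorRec m₀ f F y) := by
  have key : ∀ y : TensorAlgebra K U, (TensorAlgebra.lift K
      (A := Module.End K (TensorAlgebra K U × M))
      (LinearMap.mk₂ K (fun u q => (ι K u * q.1, f u q.1 + F u q.2))
        (fun u v q => by ext <;> simp [add_mul]; abel)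
        (fun c u q => by ext <;> simp)
        (fun u q r => by ext <;> simp [mul_add]; abel)
        (fun c u q => by ext <;> simp)) y (1, m₀)).1 = y := by
    intro y
    induction y using induction_left with
    | hc c => simp [Algebra.algebraMap_eq_smul_one]
    | hadd x y hx hy => rw [map_add, LinearMap.add_apply, Prod.fst_add, hx, hy]
    | hmul u y hy => rw [map_mul, lift_ι_apply, Module.End.mul_apply, LinearMap.mk₂_apply, hy]
  simp only [tensorRec, LinearMap.comp_apply, AlgHom.toLinearMap_apply, map_mul, lift_ι_apply,
    LinearMap.applyₗ_apply_apply, Module.End.mul_apply, LinearMap.mk₂_apply, LinearMap.snd_apply,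
    key]

/-- For `u ∈ U` of degree `g`, moving `u` by the braiding `c (u ⊗ y) = g y ⊗ u` to all the places of a
tensor:
`insert g (y₁ ⋯ yₙ) u = ∑ k, (g y₁) ⋯ (g yₖ) u yₖ₊₁ ⋯ yₙ = (1 + c₁ + c₂ c₁ + ⋯ + cₙ ⋯ c₁) (u y₁ ⋯ yₙ)`,
where `cᵢ` is the braiding of the tensor factors `i` and `i + 1`. -/
noncomputable def insert (D : YDModule K G U) (g : G) :
    TensorAlgebra K U →ₗ[K] U →ₗ[K] TensorAlgebra K U :=
  tensorRec (ι K)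
    (LinearMap.mk₂ K (fun a y => LinearMap.mulRight K (ι K a * y) ∘ₗ ι K)
      (fun a b y => by ext; simp [add_mul, mul_add, mul_assoc])
      (fun c a y => by ext; simp [mul_assoc])
      (fun a y z => by ext; simp [mul_add, mul_assoc])
      (fun c a y => by ext; simp [mul_assoc]))
    (LinearMap.mk₂ K (fun a q => LinearMap.mulLeft K (ι K (D.act g a)) ∘ₗ q)
      (fun a b y => by ext; simp [add_mul])
      (fun c a y => by ext; simp)
      (fun a y z => by ext; simp [mul_add])
      (fun c a y => by ext; simp))

theorem insert_one (D : YDModule K G U) (g : G) (u : U) : D.insert g 1 u = ι K u := by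
  rw [insert, tensorRec_one]

theorem insert_ι_mul (D : YDModule K G U) (g : G) (a u : U) (y : TensorAlgebra K U) :
    D.insert g (ι K a * y) u =
      ι K u * (ι K a * y) + ι K (D.act g a) * D.insert g y u := by
  rw [insert, tensorRec_ι_mul]; rfl

/-- The map `u ⊗ y ↦ (1 + c₁ + c₂ c₁ + ⋯ + cₙ ⋯ c₁) (u ⊗ y)` for all `u ∈ U` and `y` in degree `n` of
`T(U)` (the left multiplication by `u` in the quantum shuffle algebra). -/
noncomputable def shuffle (D : YDModule K G U) : U →ₗ[K] Module.End K (TensorAlgebra K U) :=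
  LinearMap.mk₂ K (fun u y => (D.coact u).sum fun g v => D.insert g y v)
    (fun u v y => by
      rw [map_add, Finsupp.sum_add_index' (fun _ => map_zero _) (fun _ => map_add _)])
    (fun c u y => by
      rw [map_smul, Finsupp.sum_smul_index' (fun _ => map_zero _), Finsupp.smul_sum]
      simp only [map_smul])
    (fun u y z => by simp only [map_add, LinearMap.add_apply, Finsupp.sum_add])
    (fun c u y => by simp only [map_smul, LinearMap.smul_apply, Finsupp.smul_sum])

theorem shuffle_homogeneous (D : YDModule K G U) {g : G} {u : U} (hu : D.IsHomogeneous g u)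
    (y : TensorAlgebra K U) : D.shuffle u y = D.insert g y u := by
  unfold IsHomogeneous at hu
  simp [shuffle, hu]

/-- The quantum symmetrizer `S = ⨁ Sₙ` on `T(U) = ⨁ U^{⊗ n}`, given by `S₀ = 1` and
`Sₙ₊₁ = (1 + c₁ + c₂ c₁ + ⋯ + cₙ ⋯ c₁) (id ⊗ Sₙ)`. Equivalently, `Sₙ` is the sum over all
permutations of the endomorphisms of `U^{⊗ n}` which reduced expressions define in terms of
`c₁, …, cₙ₋₁`. -/
noncomputable def symmetrizer (D : YDModule K G U) : TensorAlgebra K U →ₗ[K] TensorAlgebra K U :=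
  LinearMap.applyₗ 1 ∘ₗ (TensorAlgebra.lift K D.shuffle).toLinearMap

theorem symmetrizer_one (D : YDModule K G U) : D.symmetrizer 1 = 1 := by simp [symmetrizer]

theorem symmetrizer_ι_mul (D : YDModule K G U) (u : U) (y : TensorAlgebra K U) :
    D.symmetrizer (ι K u * y) = D.shuffle u (D.symmetrizer y) := by simp [symmetrizer]

/-- The braiding `x ⊗ w ↦ x₍₋₁₎ w ⊗ x₍₀₎` followed by the multiplication of `T(U)`. -/
noncomputable def rightBraid (D : YDModule K G U) :
    TensorAlgebra K U →ₗ[K] U →ₗ[K] TensorAlgebra K U :=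
  LinearMap.mk₂ K (fun x w => (D.tensor.coact x).sum fun g v => ι K (D.act g w) * v)
    (fun x y w => by
      rw [map_add, Finsupp.sum_add_index' (fun _ => mul_zero _) (fun _ => mul_add _)])
    (fun c x w => by
      rw [map_smul, Finsupp.sum_smul_index' (fun _ => mul_zero _), Finsupp.smul_sum]
      simp only [mul_smul_comm])
    (fun u y z => by simp only [map_add, add_mul, Finsupp.sum_add])
    (fun c u y => by simp only [map_smul, smul_mul_assoc, Finsupp.smul_sum])

theorem rightBraid_homogeneous (D : YDModule K G U) {g : G} {x : TensorAlgebra K U}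
    (hx : D.tensor.IsHomogeneous g x) (w : U) : D.rightBraid x w = ι K (D.act g w) * x := by
  unfold IsHomogeneous at hx
  simp [rightBraid, hx]

/-- The right multiplication by `w` in the quantum shuffle algebra (used to see that the kernel of
the quantum symmetrizer is a two-sided ideal). -/
noncomputable def rightShuffle (D : YDModule K G U) :
    TensorAlgebra K U →ₗ[K] U →ₗ[K] TensorAlgebra K U :=
  tensorRec (ι K)
    (LinearMap.mk₂ K (fun a y => D.rightBraid (ι K a * y))
      (fun a b y => by simp [add_mul])
      (fun c a y => by simp)
      (fun a y z => by simp [mul_add])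
      (fun c a y => by simp))
    (LinearMap.mk₂ K (fun a q => LinearMap.mulLeft K (ι K a) ∘ₗ q)
      (fun a b y => by ext; simp [add_mul])
      (fun c a y => by ext; simp)
      (fun a y z => by ext; simp [mul_add])
      (fun c a y => by ext; simp))

theorem rightShuffle_one (D : YDModule K G U) (w : U) : D.rightShuffle 1 w = ι K w := by
  rw [rightShuffle, tensorRec_one]

theorem rightShuffle_ι_mul (D : YDModule K G U) (a w : U) (y : TensorAlgebra K U) :
    D.rightShuffle (ι K a * y) w = D.rightBraid (ι K a * y) w + ι K a * D.rightShuffle y w := by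
  rw [rightShuffle, tensorRec_ι_mul]; rfl

theorem IsMonomial.isHomogeneous {D : YDModule K G U} {g : G} {x : TensorAlgebra K U}
    (hx : D.IsMonomial g x) : D.tensor.IsHomogeneous g x :=
  (D.tensor_isHomogeneous_iff _ _).2 hx.tensorCoact

theorem IsHomogeneous.add {V : Type*} [AddCommGroup V] [Module K V] {D : YDModule K G V} {g : G}
    {v w : V} (hv : D.IsHomogeneous g v) (hw : D.IsHomogeneous g w) :
    D.IsHomogeneous g (v + w) := by
  unfold IsHomogeneous at *
  rw [map_add, hv, hw, Finsupp.single_add]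

theorem IsHomogeneous.smul {V : Type*} [AddCommGroup V] [Module K V] {D : YDModule K G V} {g : G}
    {v : V} (hv : D.IsHomogeneous g v) (c : K) : D.IsHomogeneous g (c • v) := by
  unfold IsHomogeneous at *
  rw [map_smul, hv, Finsupp.smul_single]

theorem IsMonomial.insert {D : YDModule K G U} {g h : G} {x : TensorAlgebra K U}
    (hx : D.IsMonomial h x) {u : U} (hu : D.IsHomogeneous g u) :
    D.tensor.IsHomogeneous (g * h) (D.insert g x u) := by
  induction hx with
  | algebraMap c =>
    rw [Algebra.algebraMap_eq_smul_one, map_smul, LinearMap.smul_apply, insert_one, mul_one]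
    exact (tensor_isHomogeneous_ι hu).smul c
  | mul k h a y ha hy ih =>
    rw [insert_ι_mul]
    refine (tensor_isHomogeneous_mul (tensor_isHomogeneous_ι hu)
      (IsMonomial.mul k h a y ha hy).isHomogeneous).add ?_
    have := tensor_isHomogeneous_mul (tensor_isHomogeneous_ι (ha.act g)) ih
    rwa [show g * k * g⁻¹ * (g * h) = g * (k * h) by group] at this

theorem shuffle_rightShuffle (D : YDModule K G U) (u w : U) (x : TensorAlgebra K U) :
    D.shuffle u (D.rightShuffle x w) = D.rightShuffle (D.shuffle u x) w := by
  induction u using D.induction_homogeneous with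
  | zero => simp
  | add u v hu hv => simp only [map_add, LinearMap.add_apply, hu, hv]
  | hom g u hu =>
    rw [D.shuffle_homogeneous hu, D.shuffle_homogeneous hu]
    induction x using D.induction_monomial with
    | h0 => simp
    | hadd x y hx hy => simp only [map_add, LinearMap.add_apply, hx, hy]
    | hmon h x hx =>
      induction hx with
      | algebraMap c =>
        have h1 : ι K u * ι K w = ι K u * (ι K w * 1) := by rw [mul_one]
        have h2 : D.insert g (ι K w) u = D.insert g (ι K w * 1) u := by rw [mul_one]
        have h3 : D.rightShuffle (ι K u) w = D.rightShuffle (ι K u * 1) w := by rw [mul_one]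
        rw [Algebra.algebraMap_eq_smul_one]
        simp only [map_smul, LinearMap.smul_apply, insert_one, rightShuffle_one]
        rw [h2, h3, insert_ι_mul, rightShuffle_ι_mul, insert_one, rightShuffle_one, mul_one, mul_one,
          D.rightBraid_homogeneous (tensor_isHomogeneous_ι hu), add_comm]
      | mul k h a y ha hy ih =>
        have hay := (IsMonomial.mul k h a y ha hy).isHomogeneous
        have e1 := tensor_isHomogeneous_mul (tensor_isHomogeneous_ι hu) hay
        have e2 := tensor_isHomogeneous_mul (tensor_isHomogeneous_ι (ha.act g)) (hy.insert hu)
        rw [rightShuffle_ι_mul, D.rightBraid_homogeneous hay, map_add, LinearMap.add_apply,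
          insert_ι_mul, insert_ι_mul, insert_ι_mul, map_add, LinearMap.add_apply,
          rightShuffle_ι_mul, rightShuffle_ι_mul, rightShuffle_ι_mul, ih,
          D.rightBraid_homogeneous hay, D.rightBraid_homogeneous e1, D.rightBraid_homogeneous e2,
          show g * k * g⁻¹ * (g * h) = g * (k * h) by group, map_mul D.act g (k * h),
          Module.End.mul_apply]
        simp only [mul_add]
        abel

theorem symmetrizer_mul_ι (D : YDModule K G U) (x : TensorAlgebra K U) (w : U) :
    D.symmetrizer (x * ι K w) = D.rightShuffle (D.symmetrizer x) w := by
  induction x using induction_left with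
  | hc c =>
    rw [Algebra.algebraMap_eq_smul_one, smul_mul_assoc, one_mul, map_smul, map_smul,
      symmetrizer_one, map_smul, LinearMap.smul_apply, rightShuffle_one, ← mul_one (ι K w),
      symmetrizer_ι_mul, symmetrizer_one]
    congr 1
    induction w using D.induction_homogeneous with
    | zero => simp
    | add u v hu hv => rw [map_add, LinearMap.add_apply, hu, hv, map_add, add_mul]
    | hom g u hu => rw [D.shuffle_homogeneous hu, insert_one, mul_one]
  | hadd x y hx hy => simp only [add_mul, map_add, LinearMap.add_apply, hx, hy]
  | hmul u y hy => rw [mul_assoc, symmetrizer_ι_mul, hy, symmetrizer_ι_mul, shuffle_rightShuffle]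

theorem symmetrizer_mul_left (D : YDModule K G U) (a : TensorAlgebra K U) {x : TensorAlgebra K U}
    (hx : D.symmetrizer x = 0) : D.symmetrizer (a * x) = 0 := by
  simp only [symmetrizer, LinearMap.comp_apply, AlgHom.toLinearMap_apply, map_mul,
    LinearMap.applyₗ_apply_apply, Module.End.mul_apply] at *
  rw [hx, map_zero]

theorem symmetrizer_mul_right (D : YDModule K G U) (b : TensorAlgebra K U) :
    ∀ {x : TensorAlgebra K U}, D.symmetrizer x = 0 → D.symmetrizer (x * b) = 0 := by
  induction b using TensorAlgebra.induction with
  | algebraMap r =>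
    intro x hx
    rw [← Algebra.commutes, ← Algebra.smul_def, map_smul, hx, smul_zero]
  | ι w =>
    intro x hx
    rw [symmetrizer_mul_ι, hx, map_zero, LinearMap.zero_apply]
  | mul a b ha hb =>
    intro x hx
    rw [← mul_assoc]
    exact hb (ha hx)
  | add a b ha hb =>
    intro x hx
    rw [mul_add, map_add, ha hx, hb hx, add_zero]

/-- The defining ideal of the Nichols algebra, `⨁ ker Sₙ`, the kernel of the quantum symmetrizer. -/
def nicholsIdeal (D : YDModule K G U) : Ideal (TensorAlgebra K U) where
  carrier := {x | D.symmetrizer x = 0}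
  zero_mem' := map_zero _
  add_mem' := fun {x y} hx hy => by
    simp only [Set.mem_ofPred_eq] at *
    rw [map_add, hx, hy, add_zero]
  smul_mem' := fun a _ hx => D.symmetrizer_mul_left a hx

instance (D : YDModule K G U) : D.nicholsIdeal.IsTwoSided :=
  ⟨fun b hx => D.symmetrizer_mul_right b hx⟩

/-- The Nichols algebra `𝔅(U) = T(U) / ⨁ ker Sₙ`. -/
abbrev NicholsAlgebra (D : YDModule K G U) : Type _ := TensorAlgebra K U ⧸ D.nicholsIdeal

theorem tensorAct_insert (D : YDModule K G U) (g k : G) (x : TensorAlgebra K U) (u : U) :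
    D.tensorAct g (D.insert k x u) =
      D.insert (g * k * g⁻¹) (D.tensorAct g x) (D.act g u) := by
  induction x using induction_left with
  | hc c =>
    simp only [Algebra.algebraMap_eq_smul_one, map_smul, LinearMap.smul_apply, map_one, insert_one,
      tensorAct_ι]
  | hadd x y hx hy => simp only [map_add, LinearMap.add_apply, hx, hy]
  | hmul a y hy =>
    rw [insert_ι_mul, map_mul, tensorAct_ι, insert_ι_mul, map_add, map_mul, map_mul, map_mul, hy,
      tensorAct_ι, tensorAct_ι, tensorAct_ι, ← Module.End.mul_apply, ← map_mul,
      ← Module.End.mul_apply, ← map_mul]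
    congr 5
    group

theorem tensorAct_symmetrizer (D : YDModule K G U) (g : G) (x : TensorAlgebra K U) :
    D.tensorAct g (D.symmetrizer x) = D.symmetrizer (D.tensorAct g x) := by
  induction x using induction_left with
  | hc c =>
    simp only [Algebra.algebraMap_eq_smul_one, map_smul, map_one, symmetrizer_one]
  | hadd x y hx hy => simp only [map_add, hx, hy]
  | hmul u y hy =>
    rw [map_mul (D.tensorAct g), tensorAct_ι, symmetrizer_ι_mul, symmetrizer_ι_mul, ← hy]
    induction u using D.induction_homogeneous with
    | zero => simp
    | add u v hu hv => simp only [map_add, LinearMap.add_apply, hu, hv]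
    | hom k u hu =>
      rw [D.shuffle_homogeneous hu, D.shuffle_homogeneous (hu.act g), tensorAct_insert]

theorem coact_insert (D : YDModule K G U) {g : G} {u : U} (hu : D.IsHomogeneous g u)
    (x : TensorAlgebra K U) (k : G) :
    D.tensor.coact (D.insert g x u) k = D.insert g (D.tensor.coact x (g⁻¹ * k)) u := by
  classical
  induction x using D.induction_monomial with
  | h0 => simp
  | hadd x y hx hy => simp only [map_add, LinearMap.add_apply, Finsupp.add_apply, hx, hy]
  | hmon h x hx =>
    have h1 := hx.insert hu
    have h2 := hx.isHomogeneous
    unfold IsHomogeneous at h1 h2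
    rw [h1, h2, Finsupp.single_apply, Finsupp.single_apply]
    by_cases hk : g * h = k
    · rw [if_pos hk, if_pos (eq_inv_mul_of_mul_eq hk)]
    · rw [if_neg hk, if_neg (fun h' => hk (by rw [h']; group)), map_zero, LinearMap.zero_apply]

theorem coact_symmetrizer (D : YDModule K G U) (x : TensorAlgebra K U) (k : G) :
    D.tensor.coact (D.symmetrizer x) k = D.symmetrizer (D.tensor.coact x k) := by
  classical
  induction x using D.induction_monomial generalizing k with
  | h0 => simp
  | hadd x y hx hy => simp only [map_add, Finsupp.add_apply, hx, hy]
  | hmon h x hx =>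
    have key : D.tensor.IsHomogeneous h (D.symmetrizer x) := by
      induction hx with
      | algebraMap c =>
        rw [Algebra.algebraMap_eq_smul_one, map_smul, symmetrizer_one,
          ← Algebra.algebraMap_eq_smul_one]
        exact (IsMonomial.algebraMap c).isHomogeneous
      | mul g h u y hu hy ih =>
        rw [symmetrizer_ι_mul, D.shuffle_homogeneous hu]
        unfold IsHomogeneous at ih ⊢
        ext k : 1
        rw [D.coact_insert hu, ih, Finsupp.single_apply, Finsupp.single_apply]
        by_cases hk : g * h = k
        · rw [if_pos hk, if_pos (eq_inv_mul_of_mul_eq hk)]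
        · rw [if_neg hk, if_neg (fun h' => hk (by rw [h']; group)), map_zero, LinearMap.zero_apply]
    have h2 := hx.isHomogeneous
    unfold IsHomogeneous at key h2
    rw [key, h2, Finsupp.single_apply, Finsupp.single_apply]
    split_ifs <;> simp

/-- The action of `G` on `𝔅(U)`, induced by the one on `T(U)`. -/
noncomputable def nicholsAct (D : YDModule K G U) :
    G →* (D.NicholsAlgebra →ₐ[K] D.NicholsAlgebra) where
  toFun g := Ideal.Quotient.liftₐ D.nicholsIdeal
    ((Ideal.Quotient.mkₐ K D.nicholsIdeal).comp (D.tensorAct g)) (fun x hx => by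
      have h : D.symmetrizer x = 0 := hx
      refine Ideal.Quotient.eq_zero_iff_mem.2 ?_
      change D.symmetrizer (D.tensorAct g x) = 0
      rw [← tensorAct_symmetrizer, h, map_zero])
  map_one' := by
    refine AlgHom.ext fun b => ?_
    obtain ⟨x, rfl⟩ := Ideal.Quotient.mkₐ_surjective K D.nicholsIdeal b
    change Ideal.Quotient.mkₐ K D.nicholsIdeal (D.tensorAct 1 x) = _
    rw [map_one]
    rfl
  map_mul' g h := by
    refine AlgHom.ext fun b => ?_
    obtain ⟨x, rfl⟩ := Ideal.Quotient.mkₐ_surjective K D.nicholsIdeal b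
    change Ideal.Quotient.mkₐ K D.nicholsIdeal (D.tensorAct (g * h) x) = _
    rw [map_mul]
    rfl

theorem nicholsAct_mk (D : YDModule K G U) (g : G) (x : TensorAlgebra K U) :
    D.nicholsAct g (Ideal.Quotient.mkₐ K D.nicholsIdeal x) =
      Ideal.Quotient.mkₐ K D.nicholsIdeal (D.tensorAct g x) := rfl

/-- The coaction on `𝔅(U)`, induced by the one on `T(U)`. -/
noncomputable def nicholsCoact (D : YDModule K G U) :
    D.NicholsAlgebra →ₗ[K] (G →₀ D.NicholsAlgebra) :=
  (D.nicholsIdeal.restrictScalars K).liftQ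
    (Finsupp.mapRange.linearMap (Ideal.Quotient.mkₐ K D.nicholsIdeal).toLinearMap ∘ₗ
      D.tensor.coact) (fun x hx => by
      have h : D.symmetrizer x = 0 := hx
      ext k : 1
      refine Ideal.Quotient.eq_zero_iff_mem.2 ?_
      change D.symmetrizer (D.tensor.coact x k) = 0
      rw [← coact_symmetrizer, h, map_zero, Finsupp.zero_apply]) ∘ₗ
    (Submodule.Quotient.restrictScalarsEquiv K D.nicholsIdeal).symm.toLinearMap

theorem nicholsCoact_mk (D : YDModule K G U) (x : TensorAlgebra K U) :
    D.nicholsCoact (Ideal.Quotient.mkₐ K D.nicholsIdeal x) =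
      Finsupp.mapRange.linearMap (Ideal.Quotient.mkₐ K D.nicholsIdeal).toLinearMap
        (D.tensor.coact x) := rfl

/-- The Nichols algebra as a Yetter-Drinfeld module. -/
noncomputable def nichols (D : YDModule K G U) : YDModule K G D.NicholsAlgebra :=
  ofGenerators
    { toFun := fun g => (D.nicholsAct g).toLinearMap
      map_one' := by rw [map_one]; rfl
      map_mul' := fun g h => by rw [map_mul]; rfl }
    D.nicholsCoact
    (fun g b => ∃ x, D.tensor.IsHomogeneous g x ∧ b = Ideal.Quotient.mkₐ K D.nicholsIdeal x)
    (fun p h0 hadd hhom b => by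
      obtain ⟨x, rfl⟩ := Ideal.Quotient.mkₐ_surjective K D.nicholsIdeal b
      induction x using D.tensor.induction_homogeneous with
      | zero => rw [map_zero]; exact h0
      | add x y hx hy => rw [map_add]; exact hadd _ _ hx hy
      | hom g x hx => exact hhom g _ ⟨x, hx, rfl⟩)
    (by
      rintro g _ ⟨x, hx, rfl⟩
      unfold IsHomogeneous at hx
      rw [nicholsCoact_mk, hx]
      simp)
    (by
      rintro g h _ ⟨x, hx, rfl⟩
      have h2 := hx.act g
      unfold IsHomogeneous at h2
      change D.nicholsCoact (Ideal.Quotient.mkₐ K D.nicholsIdeal (D.tensor.act g x)) = _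
      rw [nicholsCoact_mk, h2]
      simp only [Finsupp.mapRange.linearMap_apply, Finsupp.mapRange_single]
      rfl)

/-- The embedding of `U` into its Nichols algebra. -/
noncomputable def nicholsι (D : YDModule K G U) : U →ₗ[K] D.NicholsAlgebra :=
  (Ideal.Quotient.mkₐ K D.nicholsIdeal).toLinearMap ∘ₗ ι K

theorem nichols_act_nicholsι (D : YDModule K G U) (g : G) (u : U) :
    D.nichols.act g (D.nicholsι u) = D.nicholsι (D.act g u) :=
  congrArg (Ideal.Quotient.mkₐ K D.nicholsIdeal) (D.tensorAct_ι g u)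

theorem nichols_coact_nicholsι (D : YDModule K G U) (g : G) (u : U) :
    D.nichols.coact (D.nicholsι u) g = D.nicholsι (D.coact u g) := by
  change Ideal.Quotient.mkₐ K D.nicholsIdeal ((D.tensorCoact (ι K u)).coeff g) = _
  simp [tensorCoact, nicholsι]

/-- The (braided) adjoint action of `U` on the Nichols algebra:
`(ad u) b = u b - (u₍₋₁₎ b) u₍₀₎`, that is, `(ad u) b = u b - (g b) u` for `u ∈ U_g`. -/
noncomputable def ad (D : YDModule K G U) :
    U →ₗ[K] D.NicholsAlgebra →ₗ[K] D.NicholsAlgebra :=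
  LinearMap.mk₂ K (fun u b => D.nicholsι u * b -
      (D.coact u).sum fun g v => D.nichols.act g b * D.nicholsι v)
    (fun u v b => by
      rw [map_add, map_add, Finsupp.sum_add_index' (fun _ => by rw [map_zero, mul_zero])
        (fun _ _ _ => by rw [map_add, mul_add]), add_mul]
      abel)
    (fun c u b => by
      rw [map_smul, map_smul, Finsupp.sum_smul_index' (fun _ => by rw [map_zero, mul_zero]),
        smul_mul_assoc, smul_sub, Finsupp.smul_sum]
      simp only [map_smul, mul_smul_comm])
    (fun u b c => by
      simp only [map_add, add_mul, mul_add, Finsupp.sum_add]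
      abel)
    (fun c u b => by simp only [map_smul, smul_mul_assoc, mul_smul_comm, smul_sub, Finsupp.smul_sum])

theorem ad_homogeneous (D : YDModule K G U) {g : G} {u : U} (hu : D.IsHomogeneous g u)
    (b : D.NicholsAlgebra) :
    D.ad u b = D.nicholsι u * b - D.nichols.act g b * D.nicholsι u := by
  unfold IsHomogeneous at hu
  simp [ad, hu]

/-- For subspaces `P, Q` of `U`, the subspace `(ad P)^m (Q)` of `𝔅(U)`, spanned by all
`(ad p₁) ⋯ (ad pₘ) q` with `pᵢ ∈ P` and `q ∈ Q`. -/
noncomputable def adPow (D : YDModule K G U) (P Q : Submodule K U) :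
    ℕ → Submodule K D.NicholsAlgebra
  | 0 => Q.map D.nicholsι
  | m + 1 => Submodule.map₂ D.ad P (adPow D P Q m)

theorem nichols_act_mul (D : YDModule K G U) (g : G) (b c : D.NicholsAlgebra) :
    D.nichols.act g (b * c) = D.nichols.act g b * D.nichols.act g c :=
  map_mul (D.nicholsAct g) b c

theorem nichols_isHomogeneous_mul {D : YDModule K G U} {g h : G} {b c : D.NicholsAlgebra}
    (hb : D.nichols.IsHomogeneous g b) (hc : D.nichols.IsHomogeneous h c) :
    D.nichols.IsHomogeneous (g * h) (b * c) := by
  have key : ∀ (k : G) (b : D.NicholsAlgebra), D.nichols.IsHomogeneous k b →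
      ∃ x, D.tensor.IsHomogeneous k x ∧ Ideal.Quotient.mkₐ K D.nicholsIdeal x = b := by
    intro k b hb
    obtain ⟨x, rfl⟩ := Ideal.Quotient.mkₐ_surjective K D.nicholsIdeal b
    refine ⟨D.tensor.coact x k, D.tensor.coact_homogeneous x k, ?_⟩
    have := DFunLike.congr_fun hb k
    rwa [Finsupp.single_eq_same] at this
  obtain ⟨x, hx, rfl⟩ := key g b hb
  obtain ⟨y, hy, rfl⟩ := key h c hc
  have h1 := tensor_isHomogeneous_mul hx hy
  unfold IsHomogeneous at h1 ⊢
  rw [← map_mul]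
  change D.nicholsCoact _ = _
  rw [nicholsCoact_mk, h1, Finsupp.mapRange.linearMap_apply, Finsupp.mapRange_single]
  rfl

theorem nichols_act_ad (D : YDModule K G U) (g : G) (u : U) (b : D.NicholsAlgebra) :
    D.nichols.act g (D.ad u b) = D.ad (D.act g u) (D.nichols.act g b) := by
  induction u using D.induction_homogeneous with
  | zero => simp
  | add u v hu hv => simp only [map_add, LinearMap.add_apply, hu, hv]
  | hom k u hu =>
    rw [D.ad_homogeneous hu, D.ad_homogeneous (hu.act g), map_sub, nichols_act_mul,
      nichols_act_mul, nichols_act_nicholsι, ← Module.End.mul_apply, ← map_mul,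
      ← Module.End.mul_apply, ← map_mul, inv_mul_cancel_right]

theorem nichols_coact_ad (D : YDModule K G U) {g : G} {u : U} (hu : D.IsHomogeneous g u)
    (b : D.NicholsAlgebra) (k : G) :
    D.nichols.coact (D.ad u b) k = D.ad u (D.nichols.coact b (g⁻¹ * k)) := by
  classical
  induction b using D.nichols.induction_homogeneous with
  | zero => simp
  | add b c hb hc => simp only [map_add, Finsupp.add_apply, hb, hc]
  | hom h b hb =>
    have hu' : D.nichols.IsHomogeneous g (D.nicholsι u) := by
      unfold IsHomogeneous at hu ⊢
      ext k
      rw [nichols_coact_nicholsι, hu, Finsupp.single_apply, Finsupp.single_apply]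
      split_ifs <;> simp
    have h1 := nichols_isHomogeneous_mul hu' hb
    have h2 := nichols_isHomogeneous_mul (hb.act g) hu'
    rw [inv_mul_cancel_right] at h2
    unfold IsHomogeneous at h1 h2 hb
    rw [D.ad_homogeneous hu, map_sub, h1, h2, ← Finsupp.single_sub, ← D.ad_homogeneous hu, hb,
      Finsupp.single_apply, Finsupp.single_apply]
    by_cases hk : g * h = k
    · rw [if_pos hk, if_pos (eq_inv_mul_of_mul_eq hk)]
    · rw [if_neg hk, if_neg (fun h' => hk (by rw [h']; group)), map_zero]

theorem isSub_adPow (D : YDModule K G U) {P Q : Submodule K U} (hP : D.IsSub P) (hQ : D.IsSub Q)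
    (m : ℕ) : D.nichols.IsSub (D.adPow P Q m) := by
  induction m with
  | zero =>
    constructor
    · rintro g _ ⟨u, hu, rfl⟩
      rw [nichols_act_nicholsι]
      exact Submodule.mem_map_of_mem (hQ.1 g u hu)
    · rintro g _ ⟨u, hu, rfl⟩
      rw [nichols_coact_nicholsι]
      exact Submodule.mem_map_of_mem (hQ.2 g u hu)
  | succ m ih =>
    constructor
    · intro g v hv
      change v ∈ (D.adPow P Q (m + 1)).comap (D.nichols.act g)
      revert v
      refine Submodule.map₂_le.2 fun u hu b hb => ?_
      rw [Submodule.mem_comap, nichols_act_ad]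
      exact Submodule.apply_mem_map₂ _ (hP.1 g u hu) (ih.1 g b hb)
    · intro g v hv
      change v ∈ (D.adPow P Q (m + 1)).comap (Finsupp.lapply g ∘ₗ D.nichols.coact)
      revert v
      refine Submodule.map₂_le.2 fun u hu b hb => ?_
      rw [← D.counit u, Finsupp.sum, map_sum, LinearMap.sum_apply]
      refine sum_mem fun k _ => ?_
      change D.nichols.coact (D.ad (D.coact u k) b) g ∈ D.adPow P Q (m + 1)
      rw [D.nichols_coact_ad (D.coact_homogeneous u k)]
      exact Submodule.apply_mem_map₂ _ (hP.2 k u hu) (ih.2 _ b hb)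

end Tensor

section Pair

variable {K G V W : Type*} [Field K] [Group G] [AddCommGroup V] [Module K V] [AddCommGroup W]
  [Module K W]

theorem isSub_inl (D : YDModule K G V) (E : YDModule K G W) :
    (D.prod E).IsSub (LinearMap.range (LinearMap.inl K V W)) := by
  constructor
  · rintro g _ ⟨v, rfl⟩
    exact ⟨D.act g v, by simp [prod, ofGenerators]⟩
  · rintro g _ ⟨v, rfl⟩
    exact ⟨D.coact v g, by simp [prod, ofGenerators]⟩

theorem isSub_inr (D : YDModule K G V) (E : YDModule K G W) :
    (D.prod E).IsSub (LinearMap.range (LinearMap.inr K V W)) := by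
  constructor
  · rintro g _ ⟨v, rfl⟩
    exact ⟨E.act g v, by simp [prod, ofGenerators]⟩
  · rintro g _ ⟨v, rfl⟩
    exact ⟨E.coact v g, by simp [prod, ofGenerators]⟩

/-- `(ad V)^m (W) ⊆ 𝔅(V ⊕ W)`. -/
noncomputable def adLeft (D : YDModule K G V) (E : YDModule K G W) (m : ℕ) :
    Submodule K (D.prod E).NicholsAlgebra :=
  (D.prod E).adPow (LinearMap.range (LinearMap.inl K V W)) (LinearMap.range (LinearMap.inr K V W)) m

/-- `(ad W)^m (V) ⊆ 𝔅(V ⊕ W)`. -/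
noncomputable def adRight (D : YDModule K G V) (E : YDModule K G W) (m : ℕ) :
    Submodule K (D.prod E).NicholsAlgebra :=
  (D.prod E).adPow (LinearMap.range (LinearMap.inr K V W)) (LinearMap.range (LinearMap.inl K V W)) m

/-- The Yetter-Drinfeld module `(ad V)^m (W)`. -/
noncomputable def adLeftYD (D : YDModule K G V) (E : YDModule K G W) (m : ℕ) :
    YDModule K G (adLeft D E m) :=
  (D.prod E).nichols.restrict _ (isSub_adPow _ (isSub_inl D E) (isSub_inr D E) m)

/-- The Yetter-Drinfeld module `(ad W)^m (V)`. -/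
noncomputable def adRightYD (D : YDModule K G V) (E : YDModule K G W) (m : ℕ) :
    YDModule K G (adRight D E m) :=
  (D.prod E).nichols.restrict _ (isSub_adPow _ (isSub_inr D E) (isSub_inl D E) m)

end Pair
end YDModule

/-- The operation `i ▷ j` of the quandle of the vertices of the tetrahedron, with the vertices
`1, 2, 3, 4` numbered `0, 1, 2, 3`. -/
def tetraOp (i j : Fin 4) : Fin 4 :=
  !![0, 3, 1, 2; 2, 1, 3, 0; 3, 0, 2, 1; 1, 2, 0, 3] i j

/-- The relations `χᵢ χⱼ = χ_{i ▷ j} χᵢ`. -/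
def tetraRels : Set (FreeGroup (Fin 4)) :=
  {r | ∃ i j, r = (FreeGroup.of i * FreeGroup.of j) *
    (FreeGroup.of (tetraOp i j) * FreeGroup.of i)⁻¹}

/-- The group `T = ⟨ζ⟩ × ⟨χ₁, χ₂, χ₃, χ₄ ∣ χᵢ χⱼ = χ_{i ▷ j} χᵢ⟩`, where `⟨ζ⟩` is infinite cyclic. -/
abbrev TetraGroup : Type := Multiplicative ℤ × PresentedGroup tetraRels

namespace TetraGroup

/-- The central generator `ζ` of `T`. -/
def ζ : TetraGroup := (Multiplicative.ofAdd 1, 1)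

/-- The generators of `T`: `χ 0, χ 1, χ 2, χ 3` are `χ₁, χ₂, χ₃, χ₄`. -/
def χ (i : Fin 4) : TetraGroup := (1, PresentedGroup.of i)

theorem χ_mul_χ (i j : Fin 4) : χ i * χ j = χ (tetraOp i j) * χ i := by
  refine Prod.ext rfl ?_
  have : PresentedGroup.mk tetraRels ((FreeGroup.of i * FreeGroup.of j) *
      (FreeGroup.of (tetraOp i j) * FreeGroup.of i)⁻¹) = 1 :=
    PresentedGroup.one_of_mem ⟨i, j, rfl⟩
  rw [map_mul, map_inv, mul_inv_eq_one, map_mul, map_mul] at this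
  exact this

theorem ζ_mul_χ (i : Fin 4) : ζ * χ i = χ i * ζ :=
  Prod.ext (by simp [ζ, χ]) (by simp [ζ, χ])

theorem χ_comm : χ 0 * (χ 1 * χ 2) = (χ 1 * χ 2) * χ 0 := by
  have h1 : χ 0 * χ 1 = χ 3 * χ 0 := χ_mul_χ 0 1
  have h2 : χ 0 * χ 2 = χ 1 * χ 0 := χ_mul_χ 0 2
  have h3 : χ 3 * χ 1 = χ 2 * χ 3 := χ_mul_χ 3 1
  have h4 : χ 2 * χ 3 = χ 1 * χ 2 := χ_mul_χ 2 3
  rw [← mul_assoc, h1, mul_assoc, h2, ← mul_assoc, h3, h4]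

variable {G : Type*} [Group G] (f : TetraGroup →* G)

/-- The element `x₁` of the centralizer of `x₁`, where `xᵢ` is the image of `χᵢ`. -/
def centX₁ : Subgroup.centralizer ({f (χ 0)} : Set G) :=
  ⟨f (χ 0), Subgroup.mem_centralizer_singleton_iff.2 rfl⟩

/-- The element `x₂ x₃` of the centralizer of `x₁`, where `xᵢ` is the image of `χᵢ`. -/
def centX₂X₃ : Subgroup.centralizer ({f (χ 0)} : Set G) :=
  ⟨f (χ 1) * f (χ 2), Subgroup.mem_centralizer_singleton_iff.2 (by
    rw [← map_mul, ← map_mul, ← map_mul, χ_comm])⟩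

/-- The element `z` of the centralizer of `x₁`, where `z` is the image of `ζ`. -/
def centZ : Subgroup.centralizer ({f (χ 0)} : Set G) :=
  ⟨f ζ, Subgroup.mem_centralizer_singleton_iff.2 (by rw [← map_mul, ← map_mul, ζ_mul_χ])⟩

end TetraGroup

/-- The representation of degree one that a character `c : H → Kˣ` defines. -/
def charRep {K H : Type*} [Field K] [Group H] (c : H →* Kˣ) : Representation K H K where
  toFun h := (c h : K) • LinearMap.id
  map_one' := by ext; simp
  map_mul' g h := by ext; simp [mul_comm]

/-- `M(x, σ)` for a representation `σ` of degree one of the centralizer of `x`. -/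
noncomputable abbrev YDModule.inducedChar {K G : Type*} [Field K] [Group G] (x : G)
    (σ : Subgroup.centralizer ({x} : Set G) →* Kˣ) :=
  YDModule.induced x (charRep σ)

/-- The Yetter-Drinfeld module `V = M(z, ρ)` over `G`. Here `z` is the image of `ζ` in the quotient
`G` of `T`, the centralizer of `z` is the whole group, and `ρ` is a character of `G`. -/
noncomputable abbrev TetraGroup.moduleV {K G : Type*} [Field K] [Group G] (f : TetraGroup →* G)
    (ρ : G →* Kˣ) :=
  YDModule.inducedChar (f TetraGroup.ζ)
    (ρ.comp (Subgroup.centralizer ({f TetraGroup.ζ} : Set G)).subtype)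

/-- The Yetter-Drinfeld module `W = M(x₁, σ)` over `G`, where `x₁` is the image of `χ₁` in the
quotient `G` of `T`, and `σ` is a character of the centralizer of `x₁`. -/
noncomputable abbrev TetraGroup.moduleW {K G : Type*} [Field K] [Group G] (f : TetraGroup →* G)
    (σ : Subgroup.centralizer ({f (TetraGroup.χ 0)} : Set G) →* Kˣ) :=
  YDModule.inducedChar (f (TetraGroup.χ 0)) σ

/-! The skew derivations `der f` strip the last letter of an element of a Nichols algebra. An
element of augmentation zero vanishes as soon as all its skew derivatives do (`eq_zero_of_der`), so
every identity and every non-vanishing statement below is a computation with derivatives, and no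
presentation of the algebra is needed.

Number the vertices 0, 1, 2, 3, as in `tetraOp`. Let v, w_0, ..., w_3 be the basis vectors of V and
W, let x_i be the degree of w_i, and put q = ρ(x_0)σ(z), s = σ(x_1 x_2). Only four scalars r =
ρ(x_0), rz = ρ(z), t = σ(z), s enter; `IsTetraPair` records this data, so that q = r t and the last
hypothesis reads r rz t = 1.

For (ad V)^m(W): the derivative dual to w_j sends (ad v)(w_j) to (1 - q) v and (ad v)²(w_j) to (1 -
q)(1 - r rz t) v² = 0; all other derivatives of these elements vanish.

For (ad W)^m(V): these spaces lie in `coinv`, where the derivatives dual to W vanish, so the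
derivative ∂ dual to v is injective there on elements of augmentation zero (`eq_zero_of_derV`). It
satisfies ∂((ad w_i) y) = w_i ∂y - q (x_i ∂y) w_i (`derV_adW`), and thus turns questions about (ad
W)^m(V) into questions about degree m of the subalgebra generated by W.

Necessity comes from m = 2. On a finite-dimensional absolutely simple module the endomorphism that
acts on degree g by g is a scalar (`IsAbsolutelySimple.exists_twist`). Applied to (ad w_1)(ad
w_2)(v), this gives three equations in q, s and the scalar, which force q² - q + 1 = 0 and s = 1
(`eq_of_isAbsolutelySimple`).

Conversely, for s = 1 the squares w_i² vanish and each 3-cycle (i, j), (i ▷ j, i), (j, i ▷ j) gives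
a quadratic relation. With q² - q + 1 = 0 the vectors (ad w_i)(ad w_j)(v) of a cycle are therefore
proportional (`adWW_cycle`), and (ad W)²(V) is spanned by four translates of one vector, in distinct
degrees. Only ad w_0 does not annihilate that vector, and the result `topW` is a common eigenvector
of all x_i (`act_x_topW`), so it spans (ad W)³(V). It is non-zero, and is annihilated by ad W
because w_0² = 0. Simplicity in each degree follows from `isSimple_of_orbit`.

It remains to realise M(z, ρ) and M(x_1, σ) as such a pair, which is `exists_isTetraPair`. -/

namespace YDModule

/-! ### Skew derivations and the vanishing criterion in a Nichols algebra -/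

section SkewDerivations

variable {K G U : Type*} [Field K] [Group G] [AddCommGroup U] [Module K U]

open TensorAlgebra

/-- The linear map `x u ↦ f u • x` on the tensors of positive degree, for `u ∈ U`. -/
noncomputable def rightDiv (f : Module.Dual K U) : TensorAlgebra K U →ₗ[K] TensorAlgebra K U :=
  tensorRec 0
    -- The letter u is the last one of u y only for the constant term of y, which `algebraMapInv`
    -- extracts.
    (LinearMap.mk₂ K (fun u y => f u • algebraMap K (TensorAlgebra K U) (algebraMapInv y))
      (fun u v y => by rw [map_add, add_smul])
      (fun c u y => by rw [map_smul, smul_assoc])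
      (fun u y z => by simp only [map_add, smul_add])
      (fun c u y => by
        rw [map_smul, Algebra.algebraMap_eq_smul_one, Algebra.algebraMap_eq_smul_one, smul_assoc,
          smul_comm]))
    (LinearMap.mul K (TensorAlgebra K U) ∘ₗ ι K)

theorem rightDiv_one (f : Module.Dual K U) : rightDiv f 1 = 0 := by
  rw [rightDiv, tensorRec_one]

theorem rightDiv_ι_mul (f : Module.Dual K U) (u : U) (y : TensorAlgebra K U) :
    rightDiv f (ι K u * y) =
      f u • algebraMap K (TensorAlgebra K U) (algebraMapInv y) + ι K u * rightDiv f y := by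
  rw [rightDiv, tensorRec_ι_mul]; rfl

theorem rightDiv_algebraMap (f : Module.Dual K U) (c : K) :
    rightDiv f (algebraMap K (TensorAlgebra K U) c) = 0 := by
  rw [Algebra.algebraMap_eq_smul_one, map_smul, rightDiv_one, smul_zero]

/-- The right skew derivation of `T(U)` which extends the linear form `f`. -/
noncomputable def tensorDer (D : YDModule K G U) (f : Module.Dual K U) :
    TensorAlgebra K U →ₗ[K] TensorAlgebra K U :=
  tensorRec 0
    (LinearMap.mk₂ K (fun u y => (D.coact u).sum fun g w => f w • D.tensorAct g y)
      (fun u v y => by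
        rw [map_add, Finsupp.sum_add_index' (fun _ => by rw [map_zero, zero_smul])
          (fun _ _ _ => by rw [map_add, add_smul])])
      (fun c u y => by
        rw [map_smul, Finsupp.sum_smul_index' (fun _ => by rw [map_zero, zero_smul]),
          Finsupp.smul_sum]
        simp only [map_smul, smul_assoc])
      (fun u y z => by simp only [map_add, smul_add, Finsupp.sum_add])
      (fun c u y => by
        rw [Finsupp.smul_sum]
        simp only [map_smul]
        exact Finsupp.sum_congr fun _ _ => smul_comm _ _ _))
    (LinearMap.mul K (TensorAlgebra K U) ∘ₗ ι K)

theorem tensorDer_one (D : YDModule K G U) (f : Module.Dual K U) : D.tensorDer f 1 = 0 := by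
  rw [tensorDer, tensorRec_one]

theorem tensorDer_algebraMap (D : YDModule K G U) (f : Module.Dual K U) (c : K) :
    D.tensorDer f (algebraMap K (TensorAlgebra K U) c) = 0 := by
  rw [Algebra.algebraMap_eq_smul_one, map_smul, tensorDer_one, smul_zero]

theorem tensorDer_ι_mul (D : YDModule K G U) (f : Module.Dual K U) {g : G} {u : U}
    (hu : D.IsHomogeneous g u) (y : TensorAlgebra K U) :
    D.tensorDer f (ι K u * y) = f u • D.tensorAct g y + ι K u * D.tensorDer f y := by
  unfold IsHomogeneous at hu
  rw [tensorDer, tensorRec_ι_mul]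
  simp [hu]

theorem algebraMapInv_insert (D : YDModule K G U) (g : G) (y : TensorAlgebra K U) (u : U) :
    algebraMapInv (D.insert g y u) = 0 := by
  induction y using induction_left with
  | hc c =>
    rw [Algebra.algebraMap_eq_smul_one, map_smul, LinearMap.smul_apply, insert_one, map_smul]
    simp [algebraMapInv]
  | hadd x y hx hy => simp only [map_add, LinearMap.add_apply, hx, hy, add_zero]
  | hmul a y hy =>
    rw [insert_ι_mul, map_add, map_mul, map_mul, map_mul, hy]
    simp [algebraMapInv]

theorem algebraMapInv_symmetrizer (D : YDModule K G U) (x : TensorAlgebra K U) :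
    algebraMapInv (D.symmetrizer x) = algebraMapInv x := by
  induction x using induction_left with
  | hc c => rw [Algebra.algebraMap_eq_smul_one, map_smul, symmetrizer_one]
  | hadd x y hx hy => simp only [map_add, hx, hy]
  | hmul u y hy =>
    rw [symmetrizer_ι_mul]
    induction u using D.induction_homogeneous with
    | zero => simp
    | add u v hu hv => simp only [map_add, add_mul, LinearMap.add_apply, hu, hv]
    | hom g u hu =>
      rw [D.shuffle_homogeneous hu, algebraMapInv_insert, map_mul]
      simp [algebraMapInv]

/-- In the sum defining `insert`, one summand has u in the last place, with g applied to all of y;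
stripping u leaves f(u) g y. The other summands end in the last letter of y, and stripping it
commutes with the insertion of u. -/
theorem rightDiv_insert (D : YDModule K G U) (f : Module.Dual K U) (g : G)
    (y : TensorAlgebra K U) (u : U) :
    rightDiv f (D.insert g y u) = D.insert g (rightDiv f y) u + f u • D.tensorAct g y := by
  induction y using induction_left with
  | hc c =>
    have h := rightDiv_ι_mul f u 1
    rw [mul_one, rightDiv_one, map_one, map_one, mul_zero, add_zero] at h
    rw [rightDiv_algebraMap, map_zero, LinearMap.zero_apply, zero_add,
      Algebra.algebraMap_eq_smul_one, map_smul, LinearMap.smul_apply, insert_one, map_smul, h,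
      map_smul, map_one, smul_comm]
  | hadd x y hx hy =>
    simp only [map_add, LinearMap.add_apply, hx, hy, smul_add]
    abel
  | hmul a y hy =>
    have h : algebraMapInv (ι K a * y) = (0 : K) := by
      rw [map_mul]; simp [algebraMapInv]
    rw [insert_ι_mul, map_add, rightDiv_ι_mul, rightDiv_ι_mul, rightDiv_ι_mul, hy,
      algebraMapInv_insert, h, map_add, LinearMap.add_apply, insert_ι_mul, map_mul, tensorAct_ι,
      map_smul, LinearMap.smul_apply, Algebra.algebraMap_eq_smul_one (algebraMapInv y), map_smul,
      LinearMap.smul_apply, insert_one, map_zero, smul_zero, smul_zero, zero_add, zero_add]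
    simp only [mul_add, mul_smul_comm, mul_one]
    abel

/-- This intertwining is what makes the skew derivations descend to 𝔅(U) and detect zero there:
stripping a letter after symmetrizing is the same as differentiating before it. -/
theorem rightDiv_symmetrizer (D : YDModule K G U) (f : Module.Dual K U) (x : TensorAlgebra K U) :
    rightDiv f (D.symmetrizer x) = D.symmetrizer (D.tensorDer f x) := by
  induction x using induction_left with
  | hc c =>
    rw [tensorDer_algebraMap, Algebra.algebraMap_eq_smul_one, map_smul, symmetrizer_one, map_smul,
      rightDiv_one, smul_zero, map_zero]
  | hadd x y hx hy => simp only [map_add, hx, hy]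
  | hmul u y hy =>
    induction u using D.induction_homogeneous with
    | zero => simp
    | add u v hu hv => simp only [map_add, add_mul, hu, hv]
    | hom g u hu =>
      rw [symmetrizer_ι_mul, D.shuffle_homogeneous hu, rightDiv_insert, hy, D.tensorDer_ι_mul f hu,
        map_add, symmetrizer_ι_mul, D.shuffle_homogeneous hu, map_smul, tensorAct_symmetrizer,
        add_comm]

/-- A tensor is recovered from its constant term and from what precedes each possible last letter.
-/
theorem eq_sum_rightDiv {I : Type*} [Fintype I] (b : Module.Basis I K U) (x : TensorAlgebra K U) :
    x = algebraMap K (TensorAlgebra K U) (algebraMapInv x) +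
      ∑ i, rightDiv (b.coord i) x * ι K (b i) := by
  induction x using induction_left with
  | hc c => simp [rightDiv_algebraMap, algebraMap_leftInverse U c]
  | hadd x y hx hy =>
    conv_lhs => rw [hx, hy]
    simp only [map_add, add_mul, Finset.sum_add_distrib]
    abel
  | hmul u y hy =>
    have h : algebraMapInv (ι K u * y) = (0 : K) := by
      rw [map_mul]; simp [algebraMapInv]
    rw [h, map_zero, zero_add]
    have hu : ∑ i, (b.coord i u • algebraMap K (TensorAlgebra K U) (algebraMapInv y)) * ι K (b i) =
        ι K u * algebraMap K (TensorAlgebra K U) (algebraMapInv y) := by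
      rw [← Algebra.commutes, ← Algebra.smul_def]
      conv_rhs => rw [← b.sum_repr u, map_sum, Finset.smul_sum]
      refine Finset.sum_congr rfl fun i _ => ?_
      rw [smul_mul_assoc, ← Algebra.smul_def, map_smul, smul_comm]
      rfl
    simp only [rightDiv_ι_mul, add_mul, Finset.sum_add_distrib, mul_assoc, ← Finset.mul_sum]
    rw [hu, ← mul_add, ← hy]

theorem tensorDer_mem (D : YDModule K G U) (f : Module.Dual K U) {x : TensorAlgebra K U}
    (hx : x ∈ D.nicholsIdeal) : D.tensorDer f x ∈ D.nicholsIdeal := by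
  change D.symmetrizer _ = 0
  rw [← rightDiv_symmetrizer, show D.symmetrizer x = 0 from hx, map_zero]

/-- The right skew derivation of `𝔅(U)` which extends the linear form `f`. -/
noncomputable def der (D : YDModule K G U) (f : Module.Dual K U) :
    D.NicholsAlgebra →ₗ[K] D.NicholsAlgebra :=
  (D.nicholsIdeal.restrictScalars K).liftQ
    ((Ideal.Quotient.mkₐ K D.nicholsIdeal).toLinearMap ∘ₗ D.tensorDer f) (fun _ hx =>
      Ideal.Quotient.eq_zero_iff_mem.2 (D.tensorDer_mem f hx)) ∘ₗ
    (Submodule.Quotient.restrictScalarsEquiv K D.nicholsIdeal).symm.toLinearMap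

theorem der_mk (D : YDModule K G U) (f : Module.Dual K U) (x : TensorAlgebra K U) :
    D.der f (Ideal.Quotient.mkₐ K D.nicholsIdeal x) =
      Ideal.Quotient.mkₐ K D.nicholsIdeal (D.tensorDer f x) := rfl

theorem tensorDer_add (D : YDModule K G U) (f f' : Module.Dual K U) (x : TensorAlgebra K U) :
    D.tensorDer (f + f') x = D.tensorDer f x + D.tensorDer f' x := by
  induction x using induction_left with
  | hc c => simp only [tensorDer_algebraMap, add_zero]
  | hadd x y hx hy =>
    simp only [map_add, hx, hy]
    abel
  | hmul u y hy =>
    induction u using D.induction_homogeneous with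
    | zero => simp
    | add u v hu hv =>
      simp only [map_add, add_mul, hu, hv]
      abel
    | hom g u hu =>
      simp only [D.tensorDer_ι_mul _ hu, hy, LinearMap.add_apply, add_smul, mul_add]
      abel

theorem tensorDer_smul (D : YDModule K G U) (c : K) (f : Module.Dual K U)
    (x : TensorAlgebra K U) : D.tensorDer (c • f) x = c • D.tensorDer f x := by
  induction x using induction_left with
  | hc c => simp only [tensorDer_algebraMap, smul_zero]
  | hadd x y hx hy => simp only [map_add, hx, hy, smul_add]
  | hmul u y hy =>
    induction u using D.induction_homogeneous with
    | zero => simp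
    | add u v hu hv => simp only [map_add, add_mul, hu, hv, smul_add]
    | hom g u hu =>
      simp only [D.tensorDer_ι_mul _ hu, hy, LinearMap.smul_apply, smul_assoc, mul_smul_comm,
        smul_add]

theorem der_add (D : YDModule K G U) (f f' : Module.Dual K U) (y : D.NicholsAlgebra) :
    D.der (f + f') y = D.der f y + D.der f' y := by
  obtain ⟨y, rfl⟩ := Ideal.Quotient.mkₐ_surjective K D.nicholsIdeal y
  rw [der_mk, der_mk, der_mk, tensorDer_add, map_add]

theorem der_smul (D : YDModule K G U) (c : K) (f : Module.Dual K U) (y : D.NicholsAlgebra) :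
    D.der (c • f) y = c • D.der f y := by
  obtain ⟨y, rfl⟩ := Ideal.Quotient.mkₐ_surjective K D.nicholsIdeal y
  rw [der_mk, der_mk, tensorDer_smul, map_smul]

/-- The augmentation `𝔅(U) → K`. -/
noncomputable def aug (D : YDModule K G U) : D.NicholsAlgebra →ₐ[K] K :=
  Ideal.Quotient.liftₐ D.nicholsIdeal algebraMapInv (fun x hx => by
    rw [← D.algebraMapInv_symmetrizer, show D.symmetrizer x = 0 from hx, map_zero])

theorem aug_mk (D : YDModule K G U) (x : TensorAlgebra K U) :
    D.aug (Ideal.Quotient.mkₐ K D.nicholsIdeal x) = algebraMapInv x := rfl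

theorem aug_ι (D : YDModule K G U) (u : U) : D.aug (D.nicholsι u) = 0 := by
  change D.aug (Ideal.Quotient.mkₐ K D.nicholsIdeal (ι K u)) = 0
  rw [aug_mk]
  simp [algebraMapInv]

/-- By `rightDiv_symmetrizer`, the hypotheses say that the symmetrized representative has no
constant term and that stripping any last letter gives zero; then it is zero by `eq_sum_rightDiv`.
-/
theorem eq_zero_of_der (D : YDModule K G U) {I : Type*} [Fintype I] (b : Module.Basis I K U)
    {y : D.NicholsAlgebra} (h0 : D.aug y = 0) (h : ∀ i, D.der (b.coord i) y = 0) : y = 0 := by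
  obtain ⟨x, rfl⟩ := Ideal.Quotient.mkₐ_surjective K D.nicholsIdeal y
  refine Ideal.Quotient.eq_zero_iff_mem.2 ?_
  change D.symmetrizer x = 0
  rw [aug_mk] at h0
  rw [eq_sum_rightDiv b (D.symmetrizer x), algebraMapInv_symmetrizer, h0, map_zero, zero_add]
  refine Finset.sum_eq_zero fun i _ => ?_
  have : D.tensorDer (b.coord i) x ∈ D.nicholsIdeal := Ideal.Quotient.eq_zero_iff_mem.1 (h i)
  rw [rightDiv_symmetrizer, show D.symmetrizer _ = 0 from this, zero_mul]

/-- The linear form `f` vanishes on all homogeneous components except the one of degree `g`. -/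
def IsHomogeneousForm (D : YDModule K G U) (g : G) (f : Module.Dual K U) : Prop :=
  ∀ h u, D.IsHomogeneous h u → h ≠ g → f u = 0

/-- Only letters of degree g survive under a form concentrated in degree g, so the twist on the
right factor is the action of the single element g. -/
theorem tensorDer_mul (D : YDModule K G U) {g : G} {f : Module.Dual K U}
    (hf : D.IsHomogeneousForm g f) (x y : TensorAlgebra K U) :
    D.tensorDer f (x * y) = x * D.tensorDer f y + D.tensorDer f x * D.tensorAct g y := by
  induction x using induction_left with
  | hc c =>
    rw [tensorDer_algebraMap, zero_mul, add_zero, ← Algebra.smul_def, map_smul, Algebra.smul_def]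
  | hadd x x' hx hx' =>
    simp only [map_add, add_mul, hx, hx']
    abel
  | hmul u x hx =>
    induction u using D.induction_homogeneous with
    | zero => simp
    | add u v hu hv =>
      simp only [map_add, add_mul, hu, hv]
      abel
    | hom h u hu =>
      rw [mul_assoc, D.tensorDer_ι_mul f hu, D.tensorDer_ι_mul f hu, hx, map_mul]
      by_cases hg : h = g
      · rw [hg, add_mul, smul_mul_assoc, mul_add]
        simp only [mul_assoc]
        abel
      · rw [hf h u hu hg, zero_smul, zero_smul, zero_add, zero_add, mul_add]
        simp only [mul_assoc]

theorem der_mul (D : YDModule K G U) {g : G} {f : Module.Dual K U}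
    (hf : D.IsHomogeneousForm g f) (x y : D.NicholsAlgebra) :
    D.der f (x * y) = x * D.der f y + D.der f x * D.nichols.act g y := by
  obtain ⟨x, rfl⟩ := Ideal.Quotient.mkₐ_surjective K D.nicholsIdeal x
  obtain ⟨y, rfl⟩ := Ideal.Quotient.mkₐ_surjective K D.nicholsIdeal y
  rw [← map_mul, der_mk, D.tensorDer_mul hf, map_add, map_mul, map_mul]
  rfl

theorem der_ι (D : YDModule K G U) (f : Module.Dual K U) (u : U) :
    D.der f (D.nicholsι u) = algebraMap K _ (f u) := by
  change D.der f (Ideal.Quotient.mkₐ K D.nicholsIdeal (ι K u)) = _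
  rw [der_mk]
  induction u using D.induction_homogeneous with
  | zero => simp
  | add u v hu hv => simp only [map_add, hu, hv]
  | hom g u hu =>
    have h := D.tensorDer_ι_mul f hu 1
    rw [mul_one, map_one, tensorDer_one, mul_zero, add_zero] at h
    rw [h, map_smul, map_one, Algebra.algebraMap_eq_smul_one]

theorem tensorDer_tensorAct (D : YDModule K G U) (f : Module.Dual K U) (g : G)
    (x : TensorAlgebra K U) :
    D.tensorDer f (D.tensorAct g x) = D.tensorAct g (D.tensorDer (f ∘ₗ D.act g) x) := by
  induction x using induction_left with
  | hc c => rw [AlgHom.commutes, tensorDer_algebraMap, tensorDer_algebraMap, map_zero]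
  | hadd x y hx hy => simp only [map_add, hx, hy]
  | hmul u y hy =>
    induction u using D.induction_homogeneous with
    | zero => simp
    | add u v hu hv => simp only [map_add, add_mul, hu, hv]
    | hom h u hu =>
      rw [map_mul, tensorAct_ι, D.tensorDer_ι_mul _ (hu.act g), D.tensorDer_ι_mul _ hu, hy,
        map_add, map_mul (D.tensorAct g) (ι K u), tensorAct_ι, map_smul, ← AlgHom.mul_apply,
        ← map_mul, inv_mul_cancel_right, map_mul]
      rfl

theorem der_act (D : YDModule K G U) (f : Module.Dual K U) (g : G) (y : D.NicholsAlgebra) :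
    D.der f (D.nichols.act g y) = D.nichols.act g (D.der (f ∘ₗ D.act g) y) := by
  obtain ⟨y, rfl⟩ := Ideal.Quotient.mkₐ_surjective K D.nicholsIdeal y
  exact congrArg (Ideal.Quotient.mkₐ K D.nicholsIdeal) (D.tensorDer_tensorAct f g y)

end SkewDerivations

end YDModule

namespace YDModule

/-! ### Criteria for and consequences of absolute simplicity -/

section Simplicity

variable {K G X : Type*} [Field K] [Group G] [AddCommGroup X] [Module K X]

theorem baseChange_act_tmul (D : YDModule K G X) {L : Type*} [Field L] [Algebra K L] (g : G)
    (a : L) (v : X) : (D.baseChange L).act g (a ⊗ₜ[K] v) = a ⊗ₜ[K] D.act g v := rfl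

theorem IsHomogeneous.baseChange {D : YDModule K G X} {g : G} {v : X} (hv : D.IsHomogeneous g v)
    (L : Type*) [Field L] [Algebra K L] (a : L) :
    (D.baseChange L).IsHomogeneous g (a ⊗ₜ[K] v) := by
  classical
  unfold IsHomogeneous at *
  simp [YDModule.baseChange, ofGenerators, hv]

/-- The distinct degrees let the coaction isolate one term c_j g_j e of any non-zero element of a
submodule. Acting by the inverse of g_j puts e, and then everything, into the submodule. -/
theorem isSimple_of_orbit (D : YDModule K G X) {J : Type*} [Fintype J] (g : J → G) {d : G} {e : X}
    (he : e ≠ 0) (hd : D.IsHomogeneous d e)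
    (hg : Function.Injective fun j => g j * d * (g j)⁻¹)
    (hspan : Submodule.span K (Set.range fun j => D.act (g j) e) = ⊤) : D.IsSimple := by
  classical
  refine ⟨⟨e, 0, he⟩, fun N hN => or_iff_not_imp_left.2 fun hbot => ?_⟩
  obtain ⟨n, hnN, hn⟩ := Submodule.exists_mem_ne_zero_of_ne_bot hbot
  have hmem : n ∈ Submodule.span K (Set.range fun j => D.act (g j) e) := by
    rw [hspan]; exact Submodule.mem_top
  obtain ⟨c, rfl⟩ := (Submodule.mem_span_range_iff_exists_fun K).1 hmem
  have hcoact : ∀ j, D.coact (∑ i, c i • D.act (g i) e) (g j * d * (g j)⁻¹) =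
      c j • D.act (g j) e := by
    intro j
    rw [map_sum, Finsupp.finsetSum_apply, Finset.sum_eq_single j]
    · have := hd.act (g j)
      unfold IsHomogeneous at this
      rw [map_smul, this, Finsupp.smul_apply, Finsupp.single_eq_same]
    · intro i _ hij
      have := hd.act (g i)
      unfold IsHomogeneous at this
      rw [map_smul, this, Finsupp.smul_apply, Finsupp.single_eq_of_ne', smul_zero]
      exact fun h => hij (hg h)
    · simp
  obtain ⟨j, hj⟩ : ∃ j, c j ≠ 0 := by
    by_contra! h
    exact hn (by simp [h])
  have heN : e ∈ N := by
    have h1 := hN.2 (g j * d * (g j)⁻¹) _ hnN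
    rw [hcoact, Submodule.smul_mem_iff _ hj] at h1
    have h2 := hN.1 (g j)⁻¹ _ h1
    rwa [← Module.End.mul_apply, ← map_mul, inv_mul_cancel, map_one] at h2
  rw [eq_top_iff, ← hspan, Submodule.span_le]
  rintro _ ⟨i, rfl⟩
  exact hN.1 _ _ heN

theorem one_tmul_eq_zero {L : Type*} [Field L] [Algebra K L] {v : X}
    (h : (1 : L) ⊗ₜ[K] v = 0) : v = 0 :=
  (Module.FaithfullyFlat.one_tmul_eq_zero_iff K X v).1 h

/-- The hypotheses of `isSimple_of_orbit` are stable under extension of scalars, with 1 ⊗ e in place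
of e. -/
theorem isAbsolutelySimple_of_orbit {K : Type u} {G X : Type*} [Field K] [Group G]
    [AddCommGroup X] [Module K X] (D : YDModule K G X) {J : Type*} [Fintype J] (g : J → G) {d : G}
    {e : X} (he : e ≠ 0) (hd : D.IsHomogeneous d e)
    (hg : Function.Injective fun j => g j * d * (g j)⁻¹)
    (hspan : Submodule.span K (Set.range fun j => D.act (g j) e) = ⊤) :
    D.IsAbsolutelySimple := by
  intro L _ _
  refine (D.baseChange L).isSimple_of_orbit g (fun h => he (one_tmul_eq_zero h))
    (hd.baseChange L 1) hg ?_
  rw [← Submodule.baseChange_top, ← hspan, Submodule.baseChange_span, ← Set.range_comp]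
  rfl

theorem isAbsolutelySimple_restrict_of_orbit {K : Type u} {G X : Type*} [Field K] [Group G]
    [AddCommGroup X] [Module K X] (D : YDModule K G X) (N : Submodule K X) (hN : D.IsSub N)
    {J : Type*} [Fintype J] (g : J → G) {d : G}
    {e : X} (he : e ≠ 0) (hd : D.IsHomogeneous d e)
    (hg : Function.Injective fun j => g j * d * (g j)⁻¹)
    (hspan : Submodule.span K (Set.range fun j => D.act (g j) e) = N) (heN : e ∈ N) :
    (D.restrict N hN).IsAbsolutelySimple := by
  classical
  refine isAbsolutelySimple_of_orbit _ g (e := ⟨e, heN⟩) (d := d) (by simpa using he) ?_ hg ?_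
  · unfold IsHomogeneous at *
    ext k
    have := DFunLike.congr_fun hd k
    rw [Finsupp.single_apply] at this ⊢
    change D.coact e k = _
    rw [this]
    split_ifs <;> rfl
  · refine Submodule.map_injective_of_injective N.injective_subtype ?_
    rw [Submodule.map_span, ← Set.range_comp, Submodule.map_top, Submodule.range_subtype]
    exact hspan

/-- The endomorphism `v ↦ g v` for `v` of degree `g`. -/
noncomputable def twist (D : YDModule K G X) : Module.End K X :=
  Finsupp.lsum K (fun g => (D.act g : X →ₗ[K] X)) ∘ₗ D.coact

theorem twist_homogeneous (D : YDModule K G X) {g : G} {v : X} (hv : D.IsHomogeneous g v) :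
    D.twist v = D.act g v := by
  unfold IsHomogeneous at hv
  simp [twist, hv]

theorem act_twist (D : YDModule K G X) (g : G) (v : X) :
    D.twist (D.act g v) = D.act g (D.twist v) := by
  induction v using D.induction_homogeneous with
  | zero => simp
  | add u v hu hv => simp only [map_add, hu, hv]
  | hom h v hv =>
    rw [D.twist_homogeneous hv, D.twist_homogeneous (hv.act g), ← Module.End.mul_apply,
      ← Module.End.mul_apply, ← map_mul, ← map_mul, inv_mul_cancel_right]

theorem coact_twist (D : YDModule K G X) (g : G) (v : X) :
    D.coact (D.twist v) g = D.twist (D.coact v g) := by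
  classical
  induction v using D.induction_homogeneous with
  | zero => simp
  | add u v hu hv => simp only [map_add, Finsupp.add_apply, hu, hv]
  | hom h v hv =>
    have h1 := hv.act h
    rw [mul_inv_cancel_right] at h1
    rw [D.twist_homogeneous hv]
    unfold IsHomogeneous at hv h1
    rw [h1, hv, Finsupp.single_apply, Finsupp.single_apply]
    split_ifs
    · rw [D.twist_homogeneous hv]
    · rw [map_zero]

/-- The twist commutes with action and coaction, so its eigenspaces are subobjects; this is Schur's
lemma for the twist. -/
theorem isSub_ker_twist_sub (D : YDModule K G X) (c : K) :
    D.IsSub (D.twist.eigenspace c) := by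
  constructor
  · intro g v hv
    rw [Module.End.mem_eigenspace_iff] at *
    rw [act_twist, hv, map_smul]
  · intro g v hv
    rw [Module.End.mem_eigenspace_iff] at *
    rw [← coact_twist, hv, map_smul, Finsupp.smul_apply]

theorem IsSimple.exists_twist [IsAlgClosed K] [FiniteDimensional K X] {D : YDModule K G X}
    (hD : D.IsSimple) : ∃ c : K, ∀ v, D.twist v = c • v := by
  obtain ⟨_, h⟩ := hD
  obtain ⟨c, hc⟩ := Module.End.exists_eigenvalue D.twist
  refine ⟨c, fun v => Module.End.mem_eigenspace_iff.1 ?_⟩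
  rw [(h _ (D.isSub_ker_twist_sub c)).resolve_left hc]
  exact Submodule.mem_top

/-- Over an algebraic closure the twist has an eigenvalue, hence is a scalar l there. Since the
twist is defined over K, so is l. -/
theorem IsAbsolutelySimple.exists_twist {K : Type u} {G X : Type*} [Field K] [Group G]
    [AddCommGroup X] [Module K X] [FiniteDimensional K X] {D : YDModule K G X}
    (hD : D.IsAbsolutelySimple) :
    ∃ c : K, ∀ g v, D.IsHomogeneous g v → D.act g v = c • v := by
  obtain ⟨l, hl⟩ := (hD (AlgebraicClosure K)).exists_twist
  have key : ∀ g v, D.IsHomogeneous g v →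
      (1 : AlgebraicClosure K) ⊗ₜ[K] D.act g v = l ⊗ₜ[K] v := by
    intro g v hv
    rw [← baseChange_act_tmul, ← twist_homogeneous _ (hv.baseChange _ 1), hl,
      TensorProduct.smul_tmul', smul_eq_mul, mul_one]
  by_cases h0 : ∀ g v, D.IsHomogeneous g v → v = 0
  · exact ⟨0, fun g v hv => by rw [h0 g v hv, map_zero, smul_zero]⟩
  push Not at h0
  obtain ⟨g₀, v₀, hv₀, hne⟩ := h0
  obtain ⟨φ, hφ⟩ := Module.Projective.exists_dual_eq_one K hne
  -- Applying a linear form φ with φ(v₀) = 1 to the second tensor factor exhibits l as the image of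
  -- φ(g₀ v₀) ∈ K.
  have h1 := congrArg
    ((TensorProduct.rid K (AlgebraicClosure K)).toLinearMap ∘ₗ φ.lTensor (AlgebraicClosure K))
    (key g₀ v₀ hv₀)
  simp only [LinearMap.coe_comp, LinearEquiv.coe_coe, Function.comp_apply, LinearMap.lTensor_tmul,
    TensorProduct.rid_tmul, hφ, one_smul] at h1
  refine ⟨φ (D.act g₀ v₀), fun g v hv => ?_⟩
  rw [← sub_eq_zero]
  refine one_tmul_eq_zero (K := K) (L := AlgebraicClosure K) ?_
  rw [TensorProduct.tmul_sub, key g v hv, ← h1, TensorProduct.tmul_smul,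
    TensorProduct.smul_tmul', sub_self]

end Simplicity
end YDModule

namespace YDModule

/-! ### Pairs of dimensions one and four over the tetrahedron quandle -/

section TetraPair

/-- The scalars in the action `xᵢ wⱼ = - tetraSign s i j • w_{i ▷ j}` on `M(x₁, σ)`, where
`σ(x₁) = -1` and `σ(x₂ x₃) = s`. -/
def tetraSign {K : Type*} [One K] (s : K) (i j : Fin 4) : K :=
  if i = 0 ∨ j = 0 ∨ i = j then 1 else s

variable {K G V W : Type*} [Field K] [Group G] [AddCommGroup V] [Module K V] [AddCommGroup W]
  [Module K W]

/-- A pair `V`, `W` of Yetter-Drinfeld modules of dimensions one and four, where the braiding of `W`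
comes from the tetrahedron quandle. -/
structure IsTetraPair (D : YDModule K G V) (E : YDModule K G W) (z : G) (x : Fin 4 → G)
    (bV : Module.Basis Unit K V) (bW : Module.Basis (Fin 4) K W) (r rz t s : K) : Prop where
  homV : D.IsHomogeneous z (bV ())
  homW : ∀ i, E.IsHomogeneous (x i) (bW i)
  actxV : ∀ i, D.act (x i) (bV ()) = r • bV ()
  actzV : D.act z (bV ()) = rz • bV ()
  actzW : ∀ i, E.act z (bW i) = t • bW i
  actxW : ∀ i j, E.act (x i) (bW j) = -(tetraSign s i j • bW (tetraOp i j))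
  inj : Function.Injective x
  rel : ∀ i j, x i * x j = x (tetraOp i j) * x i
  comm : ∀ i, z * x i = x i * z
  sq : s * s = 1

theorem prod_act (D : YDModule K G V) (E : YDModule K G W) (g : G) (u : V × W) :
    (D.prod E).act g u = (D.act g u.1, E.act g u.2) := rfl

theorem prod_coact (D : YDModule K G V) (E : YDModule K G W) (g : G) (u : V × W) :
    (D.prod E).coact u g = (D.coact u.1 g, E.coact u.2 g) := by
  simp [prod, ofGenerators]

theorem prod_isHomogeneous_inl {D : YDModule K G V} (E : YDModule K G W) {g : G} {a : V}
    (ha : D.IsHomogeneous g a) : (D.prod E).IsHomogeneous g (a, 0) := by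
  classical
  unfold IsHomogeneous at *
  ext k : 1
  rw [prod_coact, ha, Finsupp.single_apply, Finsupp.single_apply]
  split_ifs <;> simp

theorem prod_isHomogeneous_inr (D : YDModule K G V) {E : YDModule K G W} {g : G} {a : W}
    (ha : E.IsHomogeneous g a) : (D.prod E).IsHomogeneous g (0, a) := by
  classical
  unfold IsHomogeneous at *
  ext k : 1
  rw [prod_coact, ha, Finsupp.single_apply, Finsupp.single_apply]
  split_ifs <;> simp

theorem IsHomogeneous.prod_fst {D : YDModule K G V} {E : YDModule K G W} {g : G} {u : V × W}
    (hu : (D.prod E).IsHomogeneous g u) : D.IsHomogeneous g u.1 := by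
  classical
  unfold IsHomogeneous at *
  ext k
  have := congrArg Prod.fst (DFunLike.congr_fun hu k)
  rw [prod_coact, Finsupp.single_apply] at this
  rw [Finsupp.single_apply]
  simp only at this
  rw [this]
  split_ifs <;> rfl

theorem IsHomogeneous.prod_snd {D : YDModule K G V} {E : YDModule K G W} {g : G} {u : V × W}
    (hu : (D.prod E).IsHomogeneous g u) : E.IsHomogeneous g u.2 := by
  classical
  unfold IsHomogeneous at *
  ext k
  have := congrArg Prod.snd (DFunLike.congr_fun hu k)
  rw [prod_coact, Finsupp.single_apply] at this
  rw [Finsupp.single_apply]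
  simp only at this
  rw [this]
  split_ifs <;> rfl

/-- This makes the coordinate forms of a homogeneous basis eligible for the product rule `der_mul`;
the degrees d need not be distinct. -/
theorem isHomogeneousForm_coord {I : Type*} [Finite I] {D : YDModule K G V} {b : Module.Basis I K V}
    {d : I → G} (hb : ∀ i, D.IsHomogeneous (d i) (b i)) (i : I) :
    D.IsHomogeneousForm (d i) (b.coord i) := by
  classical
  cases nonempty_fintype I
  intro h u hu hne
  have key : ∀ u, b.coord i (D.coact u h) = 0 := by
    intro u
    rw [← b.sum_repr u, map_sum, Finsupp.finsetSum_apply, map_sum]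
    refine Finset.sum_eq_zero fun j _ => ?_
    have := hb j
    unfold IsHomogeneous at this
    rw [map_smul, this, Finsupp.smul_apply, map_smul, Finsupp.single_apply]
    split_ifs with hj
    · rw [b.coord_apply, b.repr_self, Finsupp.single_apply, if_neg, smul_zero]
      rintro rfl
      exact hne hj.symm
    · rw [map_zero, smul_zero]
  have h1 := key u
  unfold IsHomogeneous at hu
  rwa [hu, Finsupp.single_eq_same] at h1

theorem IsHomogeneous.ad {U : Type*} [AddCommGroup U] [Module K U] {D : YDModule K G U} {g h : G}
    {u : U} {b : D.NicholsAlgebra} (hu : D.IsHomogeneous g u) (hb : D.nichols.IsHomogeneous h b) :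
    D.nichols.IsHomogeneous (g * h) (D.ad u b) := by
  classical
  unfold IsHomogeneous at hb ⊢
  ext k : 1
  rw [D.nichols_coact_ad hu, hb, Finsupp.single_apply, Finsupp.single_apply]
  by_cases hk : g * h = k
  · rw [if_pos hk, if_pos (eq_inv_mul_of_mul_eq hk)]
  · rw [if_neg hk, if_neg (fun h' => hk (by rw [h']; group)), map_zero]

theorem IsHomogeneous.nicholsι {U : Type*} [AddCommGroup U] [Module K U] {D : YDModule K G U}
    {g : G} {u : U} (hu : D.IsHomogeneous g u) : D.nichols.IsHomogeneous g (D.nicholsι u) := by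
  classical
  unfold IsHomogeneous at hu ⊢
  ext k
  rw [nichols_coact_nicholsι, hu, Finsupp.single_apply, Finsupp.single_apply]
  split_ifs <;> simp

theorem aug_ad {U : Type*} [AddCommGroup U] [Module K U] (D : YDModule K G U)
    (u : U) (b : D.NicholsAlgebra) : D.aug (D.ad u b) = 0 := by
  induction u using D.induction_homogeneous with
  | zero => simp
  | add u v hu hv => simp only [map_add, LinearMap.add_apply, hu, hv, add_zero]
  | hom g u hu => rw [D.ad_homogeneous hu, map_sub, map_mul, map_mul, aug_ι, zero_mul, mul_zero,
      sub_zero]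

theorem nichols_act_one {U : Type*} [AddCommGroup U] [Module K U] (D : YDModule K G U) (g : G) :
    D.nichols.act g 1 = 1 := map_one (D.nicholsAct g)

instance {U : Type*} [AddCommGroup U] [Module K U] (D : YDModule K G U) :
    Nontrivial D.NicholsAlgebra := D.aug.toRingHom.domain_nontrivial

variable {D : YDModule K G V} {E : YDModule K G W} {z : G} {x : Fin 4 → G}
    {bV : Module.Basis Unit K V} {bW : Module.Basis (Fin 4) K W} {r rz t s : K}

/-- The image of the basis vector of `V` in `𝔅(V ⊕ W)`. -/
noncomputable def genV (D : YDModule K G V) (E : YDModule K G W) (bV : Module.Basis Unit K V) :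
    (D.prod E).NicholsAlgebra := (D.prod E).nicholsι (bV (), 0)

/-- The images of the basis vectors of `W` in `𝔅(V ⊕ W)`. -/
noncomputable def genW (D : YDModule K G V) (E : YDModule K G W) (bW : Module.Basis (Fin 4) K W)
    (i : Fin 4) : (D.prod E).NicholsAlgebra := (D.prod E).nicholsι (0, bW i)

/-- The skew derivation of `𝔅(V ⊕ W)` dual to the basis vector of `V`. -/
noncomputable def derV (D : YDModule K G V) (E : YDModule K G W) (bV : Module.Basis Unit K V) :
    (D.prod E).NicholsAlgebra →ₗ[K] (D.prod E).NicholsAlgebra :=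
  (D.prod E).der (bV.coord () ∘ₗ LinearMap.fst K V W)

/-- The skew derivations of `𝔅(V ⊕ W)` dual to the basis vectors of `W`. -/
noncomputable def derW (D : YDModule K G V) (E : YDModule K G W) (bW : Module.Basis (Fin 4) K W)
    (i : Fin 4) : (D.prod E).NicholsAlgebra →ₗ[K] (D.prod E).NicholsAlgebra :=
  (D.prod E).der (bW.coord i ∘ₗ LinearMap.snd K V W)

/-- The adjoint action of the basis vectors of `W` on `𝔅(V ⊕ W)`. -/
noncomputable def adW (D : YDModule K G V) (E : YDModule K G W) (bW : Module.Basis (Fin 4) K W)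
    (i : Fin 4) : (D.prod E).NicholsAlgebra →ₗ[K] (D.prod E).NicholsAlgebra :=
  (D.prod E).ad (0, bW i)

end TetraPair
end YDModule

namespace YDModule

/-! ### Differential calculus in 𝔅(V ⊕ W) -/

section TetraPair

variable {K G V W : Type*} [Field K] [Group G] [AddCommGroup V] [Module K V] [AddCommGroup W]
  [Module K W] {D : YDModule K G V} {E : YDModule K G W} {z : G} {x : Fin 4 → G}
  {bV : Module.Basis Unit K V} {bW : Module.Basis (Fin 4) K W} {r rz t s : K}

theorem derV_genV : derV D E bV (genV D E bV) = 1 := by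
  rw [derV, genV, der_ι]
  simp

theorem derV_genW (i : Fin 4) : derV D E bV (genW D E bW i) = 0 := by
  rw [derV, genW, der_ι]
  simp

theorem derW_genV (i : Fin 4) : derW D E bW i (genV D E bV) = 0 := by
  rw [derW, genV, der_ι]
  simp

theorem derW_genW (i j : Fin 4) : derW D E bW i (genW D E bW j) = if i = j then 1 else 0 := by
  rw [derW, genW, der_ι]
  simp only [LinearMap.comp_apply, LinearMap.snd_apply, Module.Basis.coord_apply,
    Module.Basis.repr_self, Finsupp.single_apply, eq_comm (a := j)]
  split_ifs <;> simp

theorem genW_ne_zero (i : Fin 4) : genW D E bW i ≠ 0 := by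
  intro h
  have := derW_genW (D := D) (E := E) (bW := bW) i i
  rw [h, map_zero, if_pos rfl] at this
  exact zero_ne_one this

theorem genV_ne_zero : genV D E bV ≠ 0 := by
  intro h
  have := derV_genV (D := D) (E := E) (bV := bV)
  rw [h, map_zero] at this
  exact zero_ne_one this

theorem eq_zero_of_derV_derW (bV : Module.Basis Unit K V) (bW : Module.Basis (Fin 4) K W)
    {y : (D.prod E).NicholsAlgebra} (h0 : (D.prod E).aug y = 0)
    (hV : derV D E bV y = 0) (hW : ∀ i, derW D E bW i y = 0) : y = 0 := by
  refine (D.prod E).eq_zero_of_der (bV.prod bW) h0 ?_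
  rintro (⟨⟩ | i)
  · rw [show (bV.prod bW).coord (Sum.inl ()) = bV.coord () ∘ₗ LinearMap.fst K V W by ext <;> simp]
    exact hV
  · rw [show (bV.prod bW).coord (Sum.inr i) = bW.coord i ∘ₗ LinearMap.snd K V W by ext <;> simp]
    exact hW i

/-- The subspace of all elements of `𝔅(V ⊕ W)` on which the skew derivations dual to `W` vanish. -/
noncomputable def coinv (D : YDModule K G V) (E : YDModule K G W) :
    Submodule K (D.prod E).NicholsAlgebra :=
  ⨅ f : Module.Dual K W, LinearMap.ker ((D.prod E).der (f ∘ₗ LinearMap.snd K V W))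

theorem mem_coinv {y : (D.prod E).NicholsAlgebra} :
    y ∈ coinv D E ↔ ∀ f : Module.Dual K W, (D.prod E).der (f ∘ₗ LinearMap.snd K V W) y = 0 := by
  simp [coinv]

/-- Since `coinv` is defined with all forms on W and not only the coordinates, precomposing a form
with g stays within the family. -/
theorem act_mem_coinv {y : (D.prod E).NicholsAlgebra} (hy : y ∈ coinv D E) (g : G) :
    (D.prod E).nichols.act g y ∈ coinv D E := by
  rw [mem_coinv] at *
  intro f
  rw [der_act]
  exact (congrArg _ (hy (f ∘ₗ E.act g))).trans (map_zero _)

theorem derW_of_mem_coinv {y : (D.prod E).NicholsAlgebra} (hy : y ∈ coinv D E) (i : Fin 4) :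
    derW D E bW i y = 0 := mem_coinv.1 hy _

theorem genV_mem_coinv : genV D E bV ∈ coinv D E := by
  rw [mem_coinv]
  intro f
  rw [genV, der_ι]
  simp

/-- On coinvariants a single derivative decides vanishing. All identities in (ad W)^m(V) below are
proved through this. -/
theorem eq_zero_of_derV (bV : Module.Basis Unit K V) (bW : Module.Basis (Fin 4) K W)
    {y : (D.prod E).NicholsAlgebra} (h0 : (D.prod E).aug y = 0) (hy : y ∈ coinv D E)
    (hV : derV D E bV y = 0) : y = 0 :=
  eq_zero_of_derV_derW bV bW h0 hV fun i => derW_of_mem_coinv hy i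

theorem mem_coinv_of_derW (bW : Module.Basis (Fin 4) K W) {y : (D.prod E).NicholsAlgebra}
    (h : ∀ i, derW D E bW i y = 0) : y ∈ coinv D E := by
  rw [mem_coinv]
  intro f
  rw [← bW.sum_dual_apply_smul_coord f]
  refine Finset.sum_induction _
    (fun f : Module.Dual K W => (D.prod E).der (f ∘ₗ LinearMap.snd K V W) y = 0)
    (fun f f' hf hf' => ?_) ?_ fun i _ => ?_
  · rw [LinearMap.add_comp, der_add, hf, hf', add_zero]
  · rw [← zero_smul K (0 : Module.Dual K W), LinearMap.smul_comp, der_smul, zero_smul]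
  · rw [LinearMap.smul_comp, der_smul, show (D.prod E).der _ y = 0 from h i, smul_zero]

namespace IsTetraPair

theorem derV_mul (H : IsTetraPair D E z x bV bW r rz t s) (a b : (D.prod E).NicholsAlgebra) :
    derV D E bV (a * b) = a * derV D E bV b + derV D E bV a * (D.prod E).nichols.act z b :=
  (D.prod E).der_mul (fun h u hu hne =>
    isHomogeneousForm_coord (d := fun _ => z) (fun _ => H.homV) () h u.1 hu.prod_fst hne) a b

theorem derW_mul (H : IsTetraPair D E z x bV bW r rz t s) (i : Fin 4)
    (a b : (D.prod E).NicholsAlgebra) :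
    derW D E bW i (a * b) =
      a * derW D E bW i b + derW D E bW i a * (D.prod E).nichols.act (x i) b :=
  (D.prod E).der_mul (fun h u hu hne =>
    isHomogeneousForm_coord H.homW i h u.2 hu.prod_snd hne) a b

theorem act_x_genV (H : IsTetraPair D E z x bV bW r rz t s) (i : Fin 4) :
    (D.prod E).nichols.act (x i) (genV D E bV) = r • genV D E bV := by
  rw [genV, nichols_act_nicholsι, ← map_smul, prod_act]
  simp [H.actxV]

theorem act_z_genV (H : IsTetraPair D E z x bV bW r rz t s) :
    (D.prod E).nichols.act z (genV D E bV) = rz • genV D E bV := by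
  rw [genV, nichols_act_nicholsι, ← map_smul, prod_act]
  simp [H.actzV]

theorem act_z_genW (H : IsTetraPair D E z x bV bW r rz t s) (i : Fin 4) :
    (D.prod E).nichols.act z (genW D E bW i) = t • genW D E bW i := by
  rw [genW, nichols_act_nicholsι, ← map_smul, prod_act]
  simp [H.actzW]

theorem act_x_genW (H : IsTetraPair D E z x bV bW r rz t s) (i j : Fin 4) :
    (D.prod E).nichols.act (x i) (genW D E bW j) =
      -(tetraSign s i j • genW D E bW (tetraOp i j)) := by
  rw [genW, genW, nichols_act_nicholsι, ← map_smul, ← map_neg, prod_act]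
  simp [H.actxW]

theorem adW_apply (H : IsTetraPair D E z x bV bW r rz t s) (i : Fin 4)
    (y : (D.prod E).NicholsAlgebra) :
    adW D E bW i y = genW D E bW i * y - (D.prod E).nichols.act (x i) y * genW D E bW i :=
  (D.prod E).ad_homogeneous (prod_isHomogeneous_inr D (H.homW i)) y

theorem adV_apply (H : IsTetraPair D E z x bV bW r rz t s) (y : (D.prod E).NicholsAlgebra) :
    (D.prod E).ad (bV (), 0) y =
      genV D E bV * y - (D.prod E).nichols.act z y * genV D E bV :=
  (D.prod E).ad_homogeneous (prod_isHomogeneous_inl E H.homV) y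

theorem act_x_adW (H : IsTetraPair D E z x bV bW r rz t s) (i j : Fin 4)
    (y : (D.prod E).NicholsAlgebra) :
    (D.prod E).nichols.act (x i) (adW D E bW j y) =
      -(tetraSign s i j • adW D E bW (tetraOp i j) ((D.prod E).nichols.act (x i) y)) := by
  have h : (D.prod E).act (x i) (0, bW j) = -(tetraSign s i j • (0, bW (tetraOp i j))) := by
    rw [prod_act]
    simp [H.actxW]
  rw [adW, nichols_act_ad, h, map_neg, map_smul]
  rfl

theorem derV_act_x (H : IsTetraPair D E z x bV bW r rz t s) (i : Fin 4)
    (y : (D.prod E).NicholsAlgebra) :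
    derV D E bV ((D.prod E).nichols.act (x i) y) =
      r • (D.prod E).nichols.act (x i) (derV D E bV y) := by
  have h : (bV.coord () ∘ₗ LinearMap.fst K V W) ∘ₗ (D.prod E).act (x i) =
      r • (bV.coord () ∘ₗ LinearMap.fst K V W) := by
    refine LinearMap.prod_ext (bV.ext fun _ => ?_) (bW.ext fun _ => ?_)
    · simp [prod_act, H.actxV]
    · simp [prod_act]
  rw [derV, der_act, h, der_smul, map_smul]

/-- The factor r t combines the action of z on w_i, from the product rule, with the action of x_i on
v. -/
theorem derV_adW (H : IsTetraPair D E z x bV bW r rz t s) (i : Fin 4)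
    (y : (D.prod E).NicholsAlgebra) :
    derV D E bV (adW D E bW i y) = genW D E bW i * derV D E bV y -
      (r * t) • ((D.prod E).nichols.act (x i) (derV D E bV y) * genW D E bW i) := by
  rw [H.adW_apply, map_sub, H.derV_mul, H.derV_mul, derV_genW, mul_zero, zero_mul, zero_add, add_zero, H.act_z_genW, H.derV_act_x, smul_mul_smul_comm]

/-- The derivative dual to w_i takes the value x_i y on both w_i y and (x_i y) w_i, so the two terms
of the adjoint action cancel. -/
theorem adW_mem_coinv (H : IsTetraPair D E z x bV bW r rz t s) (i : Fin 4)
    {y : (D.prod E).NicholsAlgebra} (hy : y ∈ coinv D E) : adW D E bW i y ∈ coinv D E := by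
  refine mem_coinv_of_derW bW fun j => ?_
  rw [H.adW_apply, map_sub, H.derW_mul, H.derW_mul, derW_of_mem_coinv hy,
    derW_of_mem_coinv (act_mem_coinv hy _), derW_genW, mul_zero, zero_mul, zero_add, add_zero]
  split_ifs with h
  · rw [h, one_mul, mul_one, sub_self]
  · rw [zero_mul, mul_zero, sub_self]

end IsTetraPair

end TetraPair
end YDModule

/-! ### Combinatorics of the tetrahedron quandle -/

theorem tetraOp_surjective (k i : Fin 4) : ∃ j, tetraOp k j = i := by
  revert k i; decide

theorem tetraOp_self (i : Fin 4) : tetraOp i i = i := by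
  revert i; decide

/-- Together with `tetraOp_tetraOp`, this says that (i, j) ↦ (i ▷ j, i) has order three on pairs of
distinct vertices: (i, j), (i ▷ j, i), (j, i ▷ j). -/
theorem tetraOp_cycle {i j : Fin 4} : i ≠ j → tetraOp (tetraOp i j) i = j := by
  revert i j; decide

theorem tetraOp_tetraOp {i j : Fin 4} : i ≠ j → tetraOp j (tetraOp i j) = i := by
  revert i j; decide

namespace YDModule

/-! ### Spanning sets, and the modules (ad V)^m(W) -/

section TetraPair

variable {K G V W : Type*} [Field K] [Group G] [AddCommGroup V] [Module K V] [AddCommGroup W]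
  [Module K W] {D : YDModule K G V} {E : YDModule K G W} {z : G} {x : Fin 4 → G}
  {bV : Module.Basis Unit K V} {bW : Module.Basis (Fin 4) K W} {r rz t s : K}

theorem range_inl_eq_span (bV : Module.Basis Unit K V) :
    LinearMap.range (LinearMap.inl K V W) = Submodule.span K {(bV (), 0)} := by
  rw [LinearMap.range_eq_map, ← bV.span_eq, Submodule.map_span, Set.range_unique,
    Set.image_singleton]
  rfl

theorem range_inr_eq_span (bW : Module.Basis (Fin 4) K W) :
    LinearMap.range (LinearMap.inr K V W) =
      Submodule.span K (Set.range fun i => ((0 : V), bW i)) := by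
  rw [LinearMap.range_eq_map, ← bW.span_eq, Submodule.map_span, ← Set.range_comp]
  rfl

theorem adRight_zero (D : YDModule K G V) (E : YDModule K G W) (bV : Module.Basis Unit K V) :
    adRight D E 0 = Submodule.span K {genV D E bV} := by
  rw [adRight, adPow, range_inl_eq_span bV, Submodule.map_span, Set.image_singleton]
  rfl

theorem adRight_succ (bW : Module.Basis (Fin 4) K W) {m : ℕ}
    {A : Set (D.prod E).NicholsAlgebra} (hA : adRight D E m = Submodule.span K A) :
    adRight D E (m + 1) = Submodule.span K {y | ∃ i, ∃ a ∈ A, y = adW D E bW i a} := by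
  have h : adRight D E (m + 1) =
    Submodule.map₂ (D.prod E).ad (LinearMap.range (LinearMap.inr K V W)) (adRight D E m) := rfl
  rw [h, hA, range_inr_eq_span bW, Submodule.map₂_span_span]
  congr 1
  ext y
  simp only [Set.mem_image2, Set.exists_range_iff, Set.mem_ofPred_eq, eq_comm (a := y)]
  rfl

theorem adLeft_zero (D : YDModule K G V) (E : YDModule K G W) (bW : Module.Basis (Fin 4) K W) :
    adLeft D E 0 = Submodule.span K (Set.range (genW D E bW)) := by
  rw [adLeft, adPow, range_inr_eq_span bW, Submodule.map_span, ← Set.range_comp]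
  rfl

theorem adLeft_succ (bV : Module.Basis Unit K V) {m : ℕ} {J : Type*}
    {a : J → (D.prod E).NicholsAlgebra} (ha : adLeft D E m = Submodule.span K (Set.range a)) :
    adLeft D E (m + 1) =
      Submodule.span K (Set.range fun j => (D.prod E).ad (bV (), 0) (a j)) := by
  have h : adLeft D E (m + 1) =
    Submodule.map₂ (D.prod E).ad (LinearMap.range (LinearMap.inl K V W)) (adLeft D E m) := rfl
  rw [h, ha, range_inl_eq_span bV, Submodule.map₂_span_span, Set.image2_singleton_left,
    ← Set.range_comp]
  rfl

theorem span_range_smul {M J : Type*} [AddCommGroup M] [Module K M] {a b : J → M}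
    (h : ∀ j, ∃ c : K, c ≠ 0 ∧ a j = c • b j) :
    Submodule.span K (Set.range a) = Submodule.span K (Set.range b) := by
  choose c hc h using h
  refine le_antisymm (Submodule.span_le.2 ?_) (Submodule.span_le.2 ?_)
  · rintro _ ⟨j, rfl⟩
    rw [h]
    exact Submodule.smul_mem _ _ (Submodule.subset_span ⟨j, rfl⟩)
  · rintro _ ⟨j, rfl⟩
    rw [SetLike.mem_coe, ← Submodule.smul_mem_iff _ (hc j), ← h]
    exact Submodule.subset_span ⟨j, rfl⟩

namespace IsTetraPair

theorem conj_x (H : IsTetraPair D E z x bV bW r rz t s) (i j : Fin 4) :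
    x i * x j * (x i)⁻¹ = x (tetraOp i j) := by
  rw [H.rel, mul_inv_cancel_right]

theorem sign_ne_zero (H : IsTetraPair D E z x bV bW r rz t s) (i j : Fin 4) :
    tetraSign s i j ≠ 0 := by
  have hs : s ≠ 0 := left_ne_zero_of_mul_eq_one H.sq
  unfold tetraSign
  split_ifs
  · exact one_ne_zero
  · exact hs

theorem r_ne_zero (H : IsTetraPair D E z x bV bW r rz t s) : r ≠ 0 := by
  intro h
  have h1 := H.act_x_genV 0
  rw [h, zero_smul] at h1
  have h2 := congrArg ((D.prod E).nichols.act (x 0)⁻¹) h1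
  rw [← Module.End.mul_apply, ← map_mul, inv_mul_cancel, map_one, map_zero] at h2
  exact genV_ne_zero h2

/-- The elements `1, x₄, x₂, x₃` which conjugate `x₁` to `x₁, x₂, x₃, x₄`. -/
def orbit (x : Fin 4 → G) : Fin 4 → G := ![1, x 3, x 1, x 2]

theorem conj_orbit (H : IsTetraPair D E z x bV bW r rz t s) (j : Fin 4) :
    orbit x j * x 0 * (orbit x j)⁻¹ = x j := by
  fin_cases j
  · simp [orbit]
  · exact H.conj_x 3 0
  · exact H.conj_x 1 0
  · exact H.conj_x 2 0

theorem z_comm_orbit (H : IsTetraPair D E z x bV bW r rz t s) (j : Fin 4) :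
    z * orbit x j = orbit x j * z := by
  fin_cases j
  · simp [orbit]
  · exact H.comm 3
  · exact H.comm 1
  · exact H.comm 2

/-- The conjugates are x_j z, because z commutes with the x_i. -/
theorem injective_conj_orbit (H : IsTetraPair D E z x bV bW r rz t s) :
    Function.Injective fun j => orbit x j * (x 0 * z) * (orbit x j)⁻¹ := by
  have h : ∀ j, orbit x j * (x 0 * z) * (orbit x j)⁻¹ = x j * z := by
    intro j
    have hz : z * (orbit x j)⁻¹ = (orbit x j)⁻¹ * z :=
      (show Commute z (orbit x j) from H.z_comm_orbit j).inv_right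
    rw [← H.conj_orbit j, mul_assoc, mul_assoc (x 0), hz]
    group
  intro i j hij
  simp only [h] at hij
  exact H.inj (mul_right_cancel hij)

theorem act_orbit_genW (H : IsTetraPair D E z x bV bW r rz t s) (j : Fin 4) :
    ∃ c : K, c ≠ 0 ∧ (D.prod E).nichols.act (orbit x j) (genW D E bW 0) = c • genW D E bW j := by
  fin_cases j
  · exact ⟨1, one_ne_zero, by simp [orbit]⟩
  · exact ⟨-1, by simp, by
      rw [show orbit x _ = x 3 from rfl, H.act_x_genW]; simp [tetraSign, tetraOp]⟩
  · exact ⟨-1, by simp, by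
      rw [show orbit x _ = x 1 from rfl, H.act_x_genW]; simp [tetraSign, tetraOp]⟩
  · exact ⟨-1, by simp, by
      rw [show orbit x _ = x 2 from rfl, H.act_x_genW]; simp [tetraSign, tetraOp]⟩

theorem genW_isHomogeneous (H : IsTetraPair D E z x bV bW r rz t s) (i : Fin 4) :
    (D.prod E).nichols.IsHomogeneous (x i) (genW D E bW i) :=
  (prod_isHomogeneous_inr D (H.homW i)).nicholsι

theorem genV_isHomogeneous (H : IsTetraPair D E z x bV bW r rz t s) :
    (D.prod E).nichols.IsHomogeneous z (genV D E bV) :=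
  (prod_isHomogeneous_inl E H.homV).nicholsι

theorem adW_isHomogeneous (H : IsTetraPair D E z x bV bW r rz t s) (i : Fin 4) {g : G}
    {y : (D.prod E).NicholsAlgebra} (hy : (D.prod E).nichols.IsHomogeneous g y) :
    (D.prod E).nichols.IsHomogeneous (x i * g) (adW D E bW i y) :=
  (prod_isHomogeneous_inr D (H.homW i)).ad hy

theorem derW_ad_genV_genW (H : IsTetraPair D E z x bV bW r rz t s) (i j : Fin 4) :
    derW D E bW i ((D.prod E).ad (bV (), 0) (genW D E bW j)) =
      if i = j then (1 - r * t) • genV D E bV else 0 := by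
  rw [H.adV_apply, H.act_z_genW, map_sub, H.derW_mul, smul_mul_assoc, map_smul, H.derW_mul,
    derW_genV, derW_genW, mul_zero, zero_mul, zero_add, add_zero, H.act_x_genV]
  split_ifs
  · rw [mul_one, one_mul, smul_smul, sub_smul, one_smul, mul_comm]
  · rw [mul_zero, zero_mul, smul_zero, sub_zero]

theorem derV_ad_genV_genW (H : IsTetraPair D E z x bV bW r rz t s) (j : Fin 4) :
    derV D E bV ((D.prod E).ad (bV (), 0) (genW D E bW j)) = 0 := by
  rw [H.adV_apply, H.act_z_genW, map_sub, H.derV_mul, smul_mul_assoc, map_smul, H.derV_mul,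
    derV_genW, derV_genV, mul_zero, zero_mul, one_mul, zero_add, add_zero, H.act_z_genW, mul_one,
    sub_self]

theorem ad_genV_genW_ne_zero (H : IsTetraPair D E z x bV bW r rz t s) (hq : r * t ≠ 1)
    (j : Fin 4) : (D.prod E).ad (bV (), 0) (genW D E bW j) ≠ 0 := by
  intro h
  have := H.derW_ad_genV_genW j j
  rw [h, map_zero, if_pos rfl] at this
  exact smul_ne_zero (sub_ne_zero.2 hq.symm) genV_ne_zero this.symm

theorem act_ad_genV (H : IsTetraPair D E z x bV bW r rz t s) (i : Fin 4)
    (y : (D.prod E).NicholsAlgebra) :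
    (D.prod E).nichols.act (x i) ((D.prod E).ad (bV (), 0) y) =
      r • (D.prod E).ad (bV (), 0) ((D.prod E).nichols.act (x i) y) := by
  have h : (D.prod E).act (x i) (bV (), 0) = r • (bV (), 0) := by
    rw [prod_act]
    simp [H.actxV]
  rw [nichols_act_ad, h, map_smul, LinearMap.smul_apply]

theorem act_orbit_ad_genV (H : IsTetraPair D E z x bV bW r rz t s) (j : Fin 4) :
    ∃ c : K, c ≠ 0 ∧ ∀ y, (D.prod E).nichols.act (orbit x j) ((D.prod E).ad (bV (), 0) y) =
      c • (D.prod E).ad (bV (), 0) ((D.prod E).nichols.act (orbit x j) y) := by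
  fin_cases j
  · exact ⟨1, one_ne_zero, by simp [orbit]⟩
  · exact ⟨r, H.r_ne_zero, H.act_ad_genV 3⟩
  · exact ⟨r, H.r_ne_zero, H.act_ad_genV 1⟩
  · exact ⟨r, H.r_ne_zero, H.act_ad_genV 2⟩

/-- The only derivatives of (ad v)²(w_j) that could be non-zero are multiples of v² with coefficient
(1 - r t)(1 - r rz t), and the second factor vanishes. -/
theorem adLeft_two (H : IsTetraPair D E z x bV bW r rz t s) (h : r * rz * t = 1) :
    adLeft D E 2 = ⊥ := by
  rw [adLeft_succ bV (adLeft_succ bV (adLeft_zero D E bW)), Submodule.span_eq_bot]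
  rintro _ ⟨j, rfl⟩
  have hz : (D.prod E).nichols.act z ((D.prod E).ad (bV (), 0) (genW D E bW j)) =
      (rz * t) • (D.prod E).ad (bV (), 0) (genW D E bW j) := by
    have h : (D.prod E).act z (bV (), 0) = rz • (bV (), 0) := by
      rw [prod_act]
      simp [H.actzV]
    rw [nichols_act_ad, h, map_smul, LinearMap.smul_apply, H.act_z_genW, map_smul, smul_smul]
  refine eq_zero_of_derV_derW bV bW (aug_ad _ _ _) ?_ fun i => ?_
  · simp only
    rw [H.adV_apply, map_sub, H.derV_mul, H.derV_mul, hz, LinearMap.map_smul, H.derV_ad_genV_genW, derV_genV,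
      smul_zero, mul_zero, zero_mul, one_mul, mul_one, zero_add, add_zero, sub_self]
  · simp only
    rw [H.adV_apply, map_sub, H.derW_mul, H.derW_mul, hz, LinearMap.map_smul, H.derW_ad_genV_genW, derW_genV,
      H.act_x_genV, zero_mul, mul_zero, zero_add, add_zero]
    split_ifs
    · rw [mul_smul_comm, smul_mul_smul_comm, smul_mul_assoc, smul_smul, ← sub_smul,
        show 1 - r * t - rz * t * r * (1 - r * t) = 0 by linear_combination (r * t - 1) * h,
        zero_smul]
    · simp

theorem isAbsolutelySimple_adLeft_one {K : Type u} {G V W : Type*} [Field K] [Group G]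
    [AddCommGroup V] [Module K V] [AddCommGroup W] [Module K W] {D : YDModule K G V}
    {E : YDModule K G W} {z : G} {x : Fin 4 → G} {bV : Module.Basis Unit K V}
    {bW : Module.Basis (Fin 4) K W} {r rz t s : K}
    (H : IsTetraPair D E z x bV bW r rz t s) (hq : r * t ≠ 1) :
    (adLeftYD D E 1).IsAbsolutelySimple := by
  have hspan := adLeft_succ bV (adLeft_zero D E bW)
  refine isAbsolutelySimple_restrict_of_orbit _ _ _ (orbit x) (H.ad_genV_genW_ne_zero hq 0)
    ((prod_isHomogeneous_inl E H.homV).ad (H.genW_isHomogeneous 0)) ?_ ?_ ?_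
  · rw [H.comm]
    exact H.injective_conj_orbit
  · rw [hspan]
    refine span_range_smul fun j => ?_
    obtain ⟨c, hc, h1⟩ := H.act_orbit_ad_genV j
    obtain ⟨d, hd, h2⟩ := H.act_orbit_genW j
    exact ⟨c * d, mul_ne_zero hc hd, by rw [h1, h2, map_smul, smul_smul]⟩
  · rw [hspan]
    exact Submodule.subset_span ⟨0, rfl⟩

end IsTetraPair

end TetraPair
end YDModule

namespace YDModule

/-! ### (ad W)^m(V) for m ≤ 2, and the necessary conditions -/

section TetraPair

variable {K G V W : Type*} [Field K] [Group G] [AddCommGroup V] [Module K V] [AddCommGroup W]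
  [Module K W] {D : YDModule K G V} {E : YDModule K G W} {z : G} {x : Fin 4 → G}
  {bV : Module.Basis Unit K V} {bW : Module.Basis (Fin 4) K W} {r rz t s : K}

/-- The elements `(ad wᵢ)(ad wⱼ)(v)`. -/
noncomputable def adWW (D : YDModule K G V) (E : YDModule K G W) (bV : Module.Basis Unit K V)
    (bW : Module.Basis (Fin 4) K W) (i j : Fin 4) : (D.prod E).NicholsAlgebra :=
  adW D E bW i (adW D E bW j (genV D E bV))

theorem aug_adW (i : Fin 4) (y : (D.prod E).NicholsAlgebra) :
    (D.prod E).aug (adW D E bW i y) = 0 := aug_ad _ _ _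

theorem adRight_one (D : YDModule K G V) (E : YDModule K G W) (bV : Module.Basis Unit K V)
    (bW : Module.Basis (Fin 4) K W) :
    adRight D E 1 = Submodule.span K (Set.range fun i => adW D E bW i (genV D E bV)) := by
  rw [adRight_succ bW (adRight_zero D E bV)]
  congr 1
  ext y
  simp [eq_comm]

theorem adRight_two (D : YDModule K G V) (E : YDModule K G W) (bV : Module.Basis Unit K V)
    (bW : Module.Basis (Fin 4) K W) :
    adRight D E 2 = Submodule.span K {y | ∃ i j, y = adWW D E bV bW i j} := by
  rw [adRight_succ bW (adRight_one D E bV bW)]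
  congr 1
  ext y
  simp [adWW]

namespace IsTetraPair

theorem derV_adW_genV (H : IsTetraPair D E z x bV bW r rz t s) (i : Fin 4) :
    derV D E bV (adW D E bW i (genV D E bV)) = (1 - r * t) • genW D E bW i := by
  rw [H.derV_adW, derV_genV, nichols_act_one, mul_one, one_mul, sub_smul, one_smul]

theorem derV_adWW (H : IsTetraPair D E z x bV bW r rz t s) (i j : Fin 4) :
    derV D E bV (adWW D E bV bW i j) = (1 - r * t) • (genW D E bW i * genW D E bW j +
      (r * t * tetraSign s i j) • (genW D E bW (tetraOp i j) * genW D E bW i)) := by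
  rw [adWW, H.derV_adW, H.derV_adW_genV, map_smul, H.act_x_genW, mul_smul_comm, smul_mul_assoc,
    neg_mul, smul_mul_assoc]
  module

theorem derW_mul_genW (H : IsTetraPair D E z x bV bW r rz t s) (k i j : Fin 4) :
    derW D E bW k (genW D E bW i * genW D E bW j) =
      (if k = j then genW D E bW i else 0) -
        if k = i then tetraSign s k j • genW D E bW (tetraOp k j) else 0 := by
  rw [H.derW_mul, derW_genW, derW_genW, H.act_x_genW]
  split_ifs <;> simp [sub_eq_add_neg]

theorem act_x_adWW (H : IsTetraPair D E z x bV bW r rz t s) (k i j : Fin 4) :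
    (D.prod E).nichols.act (x k) (adWW D E bV bW i j) =
      (tetraSign s k i * tetraSign s k j * r) •
        adWW D E bV bW (tetraOp k i) (tetraOp k j) := by
  rw [adWW, H.act_x_adW, H.act_x_adW, H.act_x_genV]
  simp only [map_neg, map_smul, smul_neg, neg_neg, smul_smul, adWW, mul_assoc]

theorem adWW_mem_coinv (H : IsTetraPair D E z x bV bW r rz t s) (i j : Fin 4) :
    adWW D E bV bW i j ∈ coinv D E :=
  H.adW_mem_coinv _ (H.adW_mem_coinv _ genV_mem_coinv)

theorem adW_genV_isHomogeneous (H : IsTetraPair D E z x bV bW r rz t s) (i : Fin 4) :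
    (D.prod E).nichols.IsHomogeneous (x i * z) (adW D E bW i (genV D E bV)) :=
  H.adW_isHomogeneous _ H.genV_isHomogeneous

theorem adWW_isHomogeneous (H : IsTetraPair D E z x bV bW r rz t s) (i j : Fin 4) :
    (D.prod E).nichols.IsHomogeneous (x i * (x j * z)) (adWW D E bV bW i j) :=
  H.adW_isHomogeneous _ (H.adW_genV_isHomogeneous j)

theorem act_z_adWW (H : IsTetraPair D E z x bV bW r rz t s) (i j : Fin 4) :
    (D.prod E).nichols.act z (adWW D E bV bW i j) = (t * t * rz) • adWW D E bV bW i j := by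
  have h : ∀ i, (D.prod E).act z (0, bW i) = t • (0, bW i) := by
    intro i
    rw [prod_act]
    simp [H.actzW]
  rw [adWW, adW, adW, nichols_act_ad, nichols_act_ad, h, h, H.act_z_genV]
  simp only [map_smul, LinearMap.smul_apply, smul_smul]
  congr 1
  ring

theorem adW_genV_ne_zero (H : IsTetraPair D E z x bV bW r rz t s) (hq : r * t ≠ 1) (i : Fin 4) :
    adW D E bW i (genV D E bV) ≠ 0 := by
  intro h
  have h1 := H.derV_adW_genV i
  rw [h, map_zero] at h1
  exact smul_ne_zero (sub_ne_zero.2 hq.symm) (genW_ne_zero i) h1.symm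

/-- Apply first the derivative dual to v, then the one dual to w_2: the result is a non-zero
multiple of w_1, since w_2 does not occur as a letter of the second product w_3 w_1. -/
theorem adWW_ne_zero (H : IsTetraPair D E z x bV bW r rz t s) (hq : r * t ≠ 1) :
    adWW D E bV bW 1 2 ≠ 0 := by
  intro h
  have h1 := H.derV_adWW 1 2
  rw [h, map_zero, eq_comm, smul_eq_zero, or_iff_right (sub_ne_zero.2 hq.symm)] at h1
  have h2 := congrArg (derW D E bW 2) h1
  rw [map_add, map_smul, H.derW_mul_genW, H.derW_mul_genW, map_zero] at h2
  simp [tetraOp] at h2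
  exact genW_ne_zero 1 h2

theorem isAbsolutelySimple_adRight_zero {K : Type u} {G V W : Type*} [Field K] [Group G]
    [AddCommGroup V] [Module K V] [AddCommGroup W] [Module K W] {D : YDModule K G V}
    {E : YDModule K G W} {z : G} {x : Fin 4 → G} {bV : Module.Basis Unit K V}
    {bW : Module.Basis (Fin 4) K W} {r rz t s : K}
    (H : IsTetraPair D E z x bV bW r rz t s) : (adRightYD D E 0).IsAbsolutelySimple := by
  have hspan := adRight_zero D E bV
  refine isAbsolutelySimple_restrict_of_orbit _ _ _ (fun _ : Unit => 1) (genV_ne_zero (bV := bV))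
    H.genV_isHomogeneous (Function.injective_of_subsingleton _) ?_ ?_
  · rw [hspan]
    simp
  · rw [hspan]
    exact Submodule.mem_span_singleton_self _

theorem act_orbit_adW_genV (H : IsTetraPair D E z x bV bW r rz t s) (j : Fin 4) :
    ∃ c : K, c ≠ 0 ∧ (D.prod E).nichols.act (orbit x j) (adW D E bW 0 (genV D E bV)) =
      c • adW D E bW j (genV D E bV) := by
  have key : ∀ k, (D.prod E).nichols.act (x k) (adW D E bW 0 (genV D E bV)) =
      (-(tetraSign s k 0 * r)) • adW D E bW (tetraOp k 0) (genV D E bV) := by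
    intro k
    rw [H.act_x_adW, H.act_x_genV, map_smul, smul_smul, neg_smul]
  have hc : ∀ k, -(tetraSign s k 0 * r) ≠ 0 :=
    fun k => neg_ne_zero.2 (mul_ne_zero (H.sign_ne_zero k 0) H.r_ne_zero)
  fin_cases j
  · exact ⟨1, one_ne_zero, by simp [orbit]⟩
  · exact ⟨_, hc 3, key 3⟩
  · exact ⟨_, hc 1, key 1⟩
  · exact ⟨_, hc 2, key 2⟩

theorem isAbsolutelySimple_adRight_one {K : Type u} {G V W : Type*} [Field K] [Group G]
    [AddCommGroup V] [Module K V] [AddCommGroup W] [Module K W] {D : YDModule K G V}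
    {E : YDModule K G W} {z : G} {x : Fin 4 → G} {bV : Module.Basis Unit K V}
    {bW : Module.Basis (Fin 4) K W} {r rz t s : K}
    (H : IsTetraPair D E z x bV bW r rz t s) (hq : r * t ≠ 1) :
    (adRightYD D E 1).IsAbsolutelySimple := by
  have hspan := adRight_one D E bV bW
  refine isAbsolutelySimple_restrict_of_orbit _ _ _ (orbit x) (H.adW_genV_ne_zero hq 0)
    (H.adW_genV_isHomogeneous 0) H.injective_conj_orbit ?_ ?_
  · rw [hspan]
    exact span_range_smul H.act_orbit_adW_genV
  · rw [hspan]
    exact Submodule.subset_span ⟨0, rfl⟩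

/-- The degree x_1 x_2 z of (ad w_1)(ad w_2)(v) maps this vector to q (ad w_2)(ad w_3)(v), where q =
r t. By simplicity this equals k times the original vector for a scalar k. Differentiating by v and
then by w_1, w_2, w_3 turns the proportionality into scalar equations. -/
theorem eq_of_isAbsolutelySimple {K : Type u} {G V W : Type*} [Field K] [Group G]
    [AddCommGroup V] [Module K V] [AddCommGroup W] [Module K W] {D : YDModule K G V}
    {E : YDModule K G W} {z : G} {x : Fin 4 → G} {bV : Module.Basis Unit K V}
    {bW : Module.Basis (Fin 4) K W} {r rz t s : K}
    (H : IsTetraPair D E z x bV bW r rz t s) (hq : r * t ≠ 1) (h : r * rz * t = 1)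
    (hX : (adRightYD D E 2).IsAbsolutelySimple) :
    (r * t) ^ 2 - r * t + 1 = 0 ∧ s = 1 := by
  classical
  have hfin : FiniteDimensional K (adRight D E 2) := by
    have hset : {y | ∃ i j, y = adWW D E bV bW i j} =
        Set.range fun p : Fin 4 × Fin 4 => adWW D E bV bW p.1 p.2 := by
      ext y
      simp [eq_comm]
    rw [adRight_two D E bV bW, hset]
    exact FiniteDimensional.span_of_finite K (Set.finite_range _)
  obtain ⟨k, hk⟩ := hX.exists_twist
  have hmem : adWW D E bV bW 1 2 ∈ adRight D E 2 := by
    rw [adRight_two D E bV bW]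
    exact Submodule.subset_span ⟨1, 2, rfl⟩
  have h1 : (D.prod E).nichols.act (x 1 * (x 2 * z)) (adWW D E bV bW 1 2) =
      k • adWW D E bV bW 1 2 := by
    refine congrArg Subtype.val (hk (x 1 * (x 2 * z)) ⟨_, hmem⟩ ?_)
    have := H.adWW_isHomogeneous 1 2
    unfold IsHomogeneous at *
    ext g
    have := DFunLike.congr_fun this g
    rw [Finsupp.single_apply] at this ⊢
    change (D.prod E).nichols.coact (adWW D E bV bW 1 2) g = _
    rw [this]
    split_ifs <;> rfl
  -- The scalar by which z, x_2 and x_1 act, up to signs s: it reduces to q by the hypothesis `h`.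
  have hr : t * t * rz * (r * r) = r * t := by linear_combination r * t * h
  have hs2 : s ^ 2 = 1 := by rw [pow_two, H.sq]
  rw [map_mul, map_mul, Module.End.mul_apply, Module.End.mul_apply, H.act_z_adWW, map_smul, map_smul,
    H.act_x_adWW, map_smul, H.act_x_adWW] at h1
  have h2 := congrArg (derV D E bV) h1
  simp only [map_smul, H.derV_adWW, smul_smul] at h2
  have e1 := congrArg (derW D E bW 1) h2
  have e2 := congrArg (derW D E bW 2) h2
  have e3 := congrArg (derW D E bW 3) h2
  simp [H.derW_mul_genW, tetraOp, tetraSign] at e1 e2 e3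
  have hA : t * t * rz * (s * r * (s * r)) = r * t := by linear_combination hr * s ^ 2 + r * t * hs2
  rw [hA] at e1 e2 e3
  have hc : 1 - r * t ≠ 0 := sub_ne_zero.2 hq.symm
  have hq0 : r * t ≠ 0 := by
    intro h0
    have : r * rz * t = r * t * rz := by ring
    rw [h, h0, zero_mul] at this
    exact one_ne_zero this
  generalize r * t = q at *
  have scal : ∀ (a : K) (i : Fin 4), a • genW D E bW i = 0 → a = 0 := fun a i ha =>
    (smul_eq_zero.1 ha).resolve_right (genW_ne_zero i)
  -- The derivatives by w_1, w_2, w_3 are multiples of w_3, w_1, w_2 respectively; their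
  -- coefficients are compared.
  have f1 : q * (1 - q) * (q * s) * s - k * (1 - q) * s + k * (1 - q) * (q * s) = 0 :=
    scal _ 3 (by rw [← sub_eq_zero] at e1; linear_combination (norm := module) -e1)
  have f2 : -(q * (1 - q) * s) + q * (1 - q) * (q * s) - k * (1 - q) = 0 :=
    scal _ 1 (by rw [← sub_eq_zero] at e2; linear_combination (norm := module) e2)
  have f3 : q * (1 - q) + k * (1 - q) * (q * s) * s = 0 :=
    scal _ 2 (by rw [← sub_eq_zero] at e3; linear_combination (norm := module) e3)
  have hk1 : k = -1 := by
    have : (1 - q) * q * (k + 1) = 0 := by linear_combination f3 - k * (1 - q) * q * hs2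
    rcases mul_eq_zero.1 this with h' | h'
    · exact absurd h' (mul_ne_zero hc hq0)
    · exact eq_neg_of_add_eq_zero_left h'
  subst hk1
  have g2 : q * s * (q - 1) + 1 = 0 := by
    refine (mul_eq_zero.1 (?_ : (1 - q) * _ = 0)).resolve_left hc
    linear_combination f2
  have g1 : q ^ 2 - s * (q - 1) = 0 := by
    refine (mul_eq_zero.1 (?_ : (1 - q) * _ = 0)).resolve_left hc
    linear_combination f1 - (1 - q) * q ^ 2 * hs2
  -- If s = -1, the two equations add up to 2 q = 0, so the characteristic is two and -1 = 1 anyway.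
  have hs : s = 1 := by
    rcases mul_self_eq_one_iff.1 H.sq with h' | h'
    · exact h'
    · rw [h'] at g1 g2
      have h2 : q * 2 = 0 := by linear_combination g1 + g2
      rw [h']
      linear_combination -(mul_eq_zero.1 h2).resolve_left hq0
  subst hs
  exact ⟨by linear_combination g1, rfl⟩

end IsTetraPair

end TetraPair
end YDModule

/-! ### Relations of degrees two and three for s = 1 and q² - q + 1 = 0 -/

namespace YDModule

theorem tetraSign_one {K : Type*} [One K] (i j : Fin 4) : tetraSign (1 : K) i j = 1 := by
  simp [tetraSign]

section TetraPair

variable {K G V W : Type*} [Field K] [Group G] [AddCommGroup V] [Module K V] [AddCommGroup W]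
  [Module K W] {D : YDModule K G V} {E : YDModule K G W} {z : G} {x : Fin 4 → G}
  {bV : Module.Basis Unit K V} {bW : Module.Basis (Fin 4) K W} {r rz t : K}

/-- An identity in degree three of the algebra given by the quadratic relations of the Nichols
algebra of the tetrahedron quandle. -/
theorem tetra_cubic {B K : Type*} [Field K] [Ring B] [Algebra K B] {q : K}
    (hq : q ^ 2 - q + 1 = 0)
    {a b c d : B} (h0 : b * c + d * b + c * d = 0) (h1 : a * d + c * a + d * c = 0)
    (h2 : a * b + d * a + b * d = 0) (h3 : a * c + b * a + c * b = 0) (p : K) :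
    c * (p • (b * d + q • (a * b))) - q • ((p • (a * b + q • (d * a))) * c) =
      -q • (a * (p • (b * c + q • (d * b))) + q ^ 2 • ((p • (b * c + q • (d * b))) * a)) := by
  -- The monomial d c b cancels between the two multiples of relations.
  have e1 : c * a * b - d * a * c + a * d * b - d * b * a = 0 := by
    have : c * a * b - d * a * c + a * d * b - d * b * a =
        (a * d + c * a + d * c) * b - d * (a * c + b * a + c * b) := by noncomm_ring
    rw [this, h1, h3, zero_mul, mul_zero, sub_zero]
  have e0 : c * b * d + d * a * c - a * d * b - b * c * a = 0 := by
    have : c * b * d + d * a * c - a * d * b - b * c * a =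
        (a * c + b * a + c * b) * d - a * (b * c + d * b + c * d) + (a * b + d * a + b * d) * c -
          b * (a * d + c * a + d * c) := by noncomm_ring
    rw [this, h0, h1, h2, h3]
    simp
  simp only [mul_add, add_mul, mul_smul_comm, smul_mul_assoc, ← mul_assoc]
  -- Modulo q² - q + 1, where q² = q - 1, q³ = -1 and q⁴ = -q, the difference of the two sides is
  -- exactly p (q e1 + e0).
  linear_combination (norm := module) (p * q) • e1 + p • e0 +
    (p * hq) • (a * d * b - d * a * c) + (p * (q + 1) * hq) • (b * c * a) +
      (p * (q + 1) * q * hq) • (d * b * a)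

/-- Since 1 + q² = q, the left side equals p q (a + b + c). -/
theorem smul_cycle {K M : Type*} [Field K] [AddCommGroup M] [Module K M] {q : K}
    (hq : q ^ 2 - q + 1 = 0) {a b c : M} (h : a + b + c = 0) (p : K) : p • (b + q • c) - -q • (p • (a + q • b)) = 0 := by
  linear_combination (norm := module) (q * p) • h + (p * hq) • b

namespace IsTetraPair

/-- Each letter of the 3-cycle is last in one product and first in another, and by the cycle
identities for ▷ the two contributions to its derivative cancel. -/
theorem tetra_relation (H : IsTetraPair D E z x bV bW r rz t 1) {i j : Fin 4} (hij : i ≠ j) :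
    genW D E bW i * genW D E bW j + genW D E bW (tetraOp i j) * genW D E bW i +
      genW D E bW j * genW D E bW (tetraOp i j) = 0 := by
  refine eq_zero_of_derV_derW bV bW ?_ ?_ fun k => ?_
  · simp [genW, aug_ι]
  · simp only [map_add, H.derV_mul, derV_genW, mul_zero, zero_mul, add_zero]
  · have h1 := tetraOp_cycle hij
    have h2 := tetraOp_tetraOp hij
    simp only [map_add, H.derW_mul_genW, tetraSign_one, one_smul]
    have e1 : (if k = i then genW D E bW (tetraOp k j) else 0) =
        if k = i then genW D E bW (tetraOp i j) else 0 := by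
      split_ifs with h <;> simp [h]
    have e2 : (if k = tetraOp i j then genW D E bW (tetraOp k i) else 0) =
        if k = tetraOp i j then genW D E bW j else 0 := by
      split_ifs with h
      · rw [h, h1]
      · rfl
    have e3 : (if k = j then genW D E bW (tetraOp k (tetraOp i j)) else 0) =
        if k = j then genW D E bW i else 0 := by
      split_ifs with h
      · rw [h, h2]
      · rfl
    rw [e1, e2, e3]
    abel

theorem genW_mul_self (H : IsTetraPair D E z x bV bW r rz t 1) (i : Fin 4) :
    genW D E bW i * genW D E bW i = 0 := by
  refine eq_zero_of_derV_derW bV bW ?_ ?_ fun k => ?_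
  · simp [genW, aug_ι]
  · simp only [H.derV_mul, derV_genW, mul_zero, zero_mul, add_zero]
  · rw [H.derW_mul_genW, tetraSign_one, one_smul]
    split_ifs with h
    · rw [h, tetraOp_self, sub_self]
    · rw [sub_self]

theorem genW_mul_self_mul (H : IsTetraPair D E z x bV bW r rz t 1) (i : Fin 4)
    (y : (D.prod E).NicholsAlgebra) : genW D E bW i * (genW D E bW i * y) = 0 := by
  rw [← mul_assoc, H.genW_mul_self, zero_mul]

theorem derV_adWW' (H : IsTetraPair D E z x bV bW r rz t 1) (i j : Fin 4) :
    derV D E bV (adWW D E bV bW i j) = (1 - r * t) • (genW D E bW i * genW D E bW j +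
      (r * t) • (genW D E bW (tetraOp i j) * genW D E bW i)) := by
  rw [H.derV_adWW, tetraSign_one, mul_one]

theorem act_x_adWW' (H : IsTetraPair D E z x bV bW r rz t 1) (k i j : Fin 4) :
    (D.prod E).nichols.act (x k) (adWW D E bV bW i j) =
      r • adWW D E bV bW (tetraOp k i) (tetraOp k j) := by
  rw [H.act_x_adWW, tetraSign_one, tetraSign_one, one_mul, one_mul]

theorem act_x_adW' (H : IsTetraPair D E z x bV bW r rz t 1) (k i : Fin 4)
    (y : (D.prod E).NicholsAlgebra) :
    (D.prod E).nichols.act (x k) (adW D E bW i y) =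
      -adW D E bW (tetraOp k i) ((D.prod E).nichols.act (x k) y) := by
  rw [H.act_x_adW, tetraSign_one, one_smul]

theorem adWW_self (H : IsTetraPair D E z x bV bW r rz t 1) (i : Fin 4) :
    adWW D E bV bW i i = 0 := by
  refine eq_zero_of_derV bV bW (aug_adW _ _) (H.adWW_mem_coinv i i) ?_
  rw [H.derV_adWW', tetraOp_self, H.genW_mul_self, smul_zero, add_zero, smul_zero]

/-- The derivatives by v of the two sides differ by a multiple of `tetra_relation`; this is where q²
- q + 1 = 0 makes the three vectors of a cycle proportional. -/
theorem adWW_cycle (H : IsTetraPair D E z x bV bW r rz t 1)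
    (hq : (r * t) ^ 2 - r * t + 1 = 0) {i j : Fin 4} (hij : i ≠ j) :
    adWW D E bV bW (tetraOp i j) i = -(r * t) • adWW D E bV bW i j := by
  rw [← sub_eq_zero]
  refine eq_zero_of_derV bV bW ?_ (Submodule.sub_mem _ (H.adWW_mem_coinv _ _)
    (Submodule.smul_mem _ _ (H.adWW_mem_coinv _ _))) ?_
  · rw [map_sub, map_smul, adWW, adWW, aug_adW, aug_adW, smul_zero, sub_zero]
  · rw [map_sub, map_smul, H.derV_adWW', H.derV_adWW', tetraOp_cycle hij]
    exact smul_cycle hq (H.tetra_relation hij) _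

theorem act_x_zero_adWW (H : IsTetraPair D E z x bV bW r rz t 1)
    (hq : (r * t) ^ 2 - r * t + 1 = 0) :
    (D.prod E).nichols.act (x 0) (adWW D E bV bW 1 2) =
      -(r * t * r) • adWW D E bV bW 1 2 := by
  have h := H.adWW_cycle hq (show (1 : Fin 4) ≠ 2 by decide)
  rw [show tetraOp 1 2 = 3 by decide] at h
  rw [H.act_x_adWW', show tetraOp 0 1 = 3 by decide, show tetraOp 0 2 = 1 by decide, h, smul_smul, mul_neg,
    mul_comm r]

theorem act_x_zero_derV_adWW (H : IsTetraPair D E z x bV bW r rz t 1)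
    (hq : (r * t) ^ 2 - r * t + 1 = 0) :
    (D.prod E).nichols.act (x 0) (derV D E bV (adWW D E bV bW 1 2)) =
      -(r * t) • derV D E bV (adWW D E bV bW 1 2) := by
  refine smul_right_injective _ H.r_ne_zero ?_
  simp only
  rw [← H.derV_act_x, H.act_x_zero_adWW hq, map_smul, smul_smul]
  congr 1
  ring

/-- For i = 1 the relation w_1² = 0 suffices. As (ad w_1)(ad w_2)(v) is an eigenvector of x_0, the
action of x_0, which permutes the other three vertices cyclically, gives the remaining cases. -/
theorem adW_adWW_eq_zero (H : IsTetraPair D E z x bV bW r rz t 1)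
    (hq : (r * t) ^ 2 - r * t + 1 = 0) {i : Fin 4} (hi : i ≠ 0) :
    adW D E bW i (adWW D E bV bW 1 2) = 0 := by
  have hq0 : r * t ≠ 0 := by
    intro h
    rw [h] at hq
    simp at hq
  have step : ∀ i, adW D E bW i (adWW D E bV bW 1 2) = 0 →
      adW D E bW (tetraOp 0 i) (adWW D E bV bW 1 2) = 0 := by
    intro i h
    have h' := congrArg ((D.prod E).nichols.act (x 0)) h
    rw [map_zero, H.act_x_adW', H.act_x_zero_adWW hq, map_smul, neg_eq_zero, smul_eq_zero] at h'
    exact h'.resolve_left (neg_ne_zero.2 (mul_ne_zero hq0 H.r_ne_zero))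
  have h1 : adW D E bW 1 (adWW D E bV bW 1 2) = 0 := by
    refine eq_zero_of_derV bV bW (aug_adW _ _) (H.adW_mem_coinv _ (H.adWW_mem_coinv _ _)) ?_
    rw [H.derV_adW, H.derV_adWW', map_smul, map_add, map_smul, nichols_act_mul, nichols_act_mul]
    simp only [H.act_x_genW, tetraSign_one, one_smul, neg_mul_neg]
    simp only [tetraOp, Matrix.of_apply, Matrix.cons_val]
    simp only [mul_smul_comm, smul_mul_assoc, mul_add, add_mul, H.genW_mul_self_mul, mul_assoc,
      H.genW_mul_self, mul_zero, zero_add, smul_zero, add_zero]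
    -- What is left are two equal multiples of w_1 w_3 w_1.
    rw [smul_comm, sub_self]
  have h3 := step 1 h1
  have h2 := step 3 h3
  fin_cases i
  · exact absurd rfl hi
  · exact h1
  · exact h2
  · exact h3

/-- A spanning vector of `(ad W)³(V)`. -/
noncomputable def topW (D : YDModule K G V) (E : YDModule K G W) (bV : Module.Basis Unit K V)
    (bW : Module.Basis (Fin 4) K W) : (D.prod E).NicholsAlgebra :=
  adW D E bW 0 (adWW D E bV bW 1 2)

theorem derV_topW (H : IsTetraPair D E z x bV bW r rz t 1)
    (hq : (r * t) ^ 2 - r * t + 1 = 0) :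
    derV D E bV (topW D E bV bW) = genW D E bW 0 * derV D E bV (adWW D E bV bW 1 2) +
      (r * t) ^ 2 • (derV D E bV (adWW D E bV bW 1 2) * genW D E bW 0) := by
  rw [topW, H.derV_adW, H.act_x_zero_derV_adWW hq, smul_mul_assoc]
  module

theorem act_x_zero_topW (H : IsTetraPair D E z x bV bW r rz t 1)
    (hq : (r * t) ^ 2 - r * t + 1 = 0) :
    (D.prod E).nichols.act (x 0) (topW D E bV bW) = (r * t * r) • topW D E bV bW := by
  rw [topW, H.act_x_adW', H.act_x_zero_adWW hq, map_smul, tetraOp_self, neg_smul, neg_neg]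

/-- The element x_1 sends `topW` to -r (ad w_2)(ad w_1)(ad w_3)(v). That this is again a multiple of
`topW` is the cubic identity `tetra_cubic`, seen after differentiating by v. -/
theorem act_x_one_topW (H : IsTetraPair D E z x bV bW r rz t 1)
    (hq : (r * t) ^ 2 - r * t + 1 = 0) :
    (D.prod E).nichols.act (x 1) (topW D E bV bW) = (r * t * r) • topW D E bV bW := by
  have key : adW D E bW 2 (adWW D E bV bW 1 3) = -(r * t) • topW D E bV bW := by
    rw [← sub_eq_zero]
    refine eq_zero_of_derV bV bW ?_ (Submodule.sub_mem _ (H.adW_mem_coinv _ (H.adWW_mem_coinv _ _))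
      (Submodule.smul_mem _ _ (H.adW_mem_coinv _ (H.adWW_mem_coinv _ _)))) ?_
    · rw [map_sub, map_smul, topW, aug_adW, aug_adW, smul_zero, sub_zero]
    · rw [map_sub, map_smul, H.derV_topW hq, H.derV_adW, H.derV_adWW', H.derV_adWW', map_smul,
        map_add, map_smul, nichols_act_mul, nichols_act_mul]
      simp only [H.act_x_genW, tetraSign_one, one_smul, neg_mul_neg]
      have h0 := H.tetra_relation (show (1 : Fin 4) ≠ 2 by decide)
      have h1 := H.tetra_relation (show (0 : Fin 4) ≠ 3 by decide)
      have h2 := H.tetra_relation (show (0 : Fin 4) ≠ 1 by decide)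
      have h3 := H.tetra_relation (show (0 : Fin 4) ≠ 2 by decide)
      rw [show tetraOp 1 2 = 3 by decide] at h0
      rw [show tetraOp 0 3 = 2 by decide] at h1
      rw [show tetraOp 0 1 = 3 by decide] at h2
      rw [show tetraOp 0 2 = 1 by decide] at h3
      rw [sub_eq_zero, show tetraOp 2 1 = 0 by decide, show tetraOp 2 3 = 1 by decide,
        show tetraOp 1 3 = 0 by decide, show tetraOp 2 0 = 3 by decide,
        show tetraOp 1 2 = 3 by decide]
      exact tetra_cubic hq h0 h1 h2 h3 _
  rw [topW, H.act_x_adW', H.act_x_adWW', map_smul, show tetraOp 1 0 = 2 by decide,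
    show tetraOp 1 1 = 1 by decide, show tetraOp 1 2 = 3 by decide, key, smul_smul, mul_neg, neg_smul,
    neg_neg, mul_comm r, topW]

/-- The set of i for which the claim holds is stable under 0 ▷, because x_{0 ▷ i} x_0 = x_0 x_i and
`topW` is an eigenvector of x_0. So the case i = 1 yields i = 3 and i = 2. -/
theorem act_x_topW (H : IsTetraPair D E z x bV bW r rz t 1)
    (hq : (r * t) ^ 2 - r * t + 1 = 0) (i : Fin 4) :
    (D.prod E).nichols.act (x i) (topW D E bV bW) = (r * t * r) • topW D E bV bW := by
  have hq0 : r * t * r ≠ 0 := by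
    refine mul_ne_zero ?_ H.r_ne_zero
    intro h
    rw [h] at hq
    simp at hq
  have step : ∀ i, (D.prod E).nichols.act (x i) (topW D E bV bW) = (r * t * r) • topW D E bV bW →
      (D.prod E).nichols.act (x (tetraOp 0 i)) (topW D E bV bW) =
        (r * t * r) • topW D E bV bW := by
    intro i h
    refine smul_right_injective _ hq0 ?_
    simp only
    rw [← map_smul, ← H.act_x_zero_topW hq, ← Module.End.mul_apply, ← map_mul, ← H.rel, map_mul,
      Module.End.mul_apply, h, map_smul]
  have h1 := H.act_x_one_topW hq
  have h3 := step 1 h1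
  have h2 := step 3 h3
  fin_cases i
  · exact H.act_x_zero_topW hq
  · exact h1
  · exact h2
  · exact h3

/-- Write u for the derivative of (ad w_1)(ad w_2)(v) by v. The derivative of `topW` by v is w_0 u +
q² u w_0, and differentiating by w_0 gives (q² - q) u = -u, which is non-zero. -/
theorem topW_ne_zero (H : IsTetraPair D E z x bV bW r rz t 1) (hq1 : r * t ≠ 1)
    (hq : (r * t) ^ 2 - r * t + 1 = 0) : topW D E bV bW ≠ 0 := by
  intro h
  have h1 := H.derV_topW hq
  have h0 : derW D E bW 0 (derV D E bV (adWW D E bV bW 1 2)) = 0 := by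
    rw [H.derV_adWW', map_smul, map_add, map_smul, H.derW_mul_genW, H.derW_mul_genW]
    simp [tetraOp]
  have h2 := congrArg (derW D E bW 0) h1
  rw [h, map_zero, map_zero, map_add, map_smul, H.derW_mul, H.derW_mul, h0, derW_genW, if_pos rfl,
    H.act_x_zero_derV_adWW hq, mul_zero, zero_mul, zero_add, add_zero, one_mul, mul_one,
    ← add_smul, show -(r * t) + (r * t) ^ 2 = -1 by linear_combination hq, neg_smul, one_smul,
    eq_comm, neg_eq_zero] at h2
  refine H.adWW_ne_zero hq1 ?_
  exact eq_zero_of_derV bV bW (aug_adW _ _) (H.adWW_mem_coinv _ _) h2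

end IsTetraPair

end TetraPair
end YDModule

namespace YDModule

/-! ### Structure of (ad W)^m(V) under the two conditions -/

section TetraPair

variable {K G V W : Type*} [Field K] [Group G] [AddCommGroup V] [Module K V] [AddCommGroup W]
  [Module K W] {D : YDModule K G V} {E : YDModule K G W} {z : G} {x : Fin 4 → G}
  {bV : Module.Basis Unit K V} {bW : Module.Basis (Fin 4) K W} {r rz t s : K}

namespace IsTetraPair

/-- This transports statements about ad w_j on one vector to its translates: up to a non-zero
scalar, an orbit element permutes the operators ad w_j, and sends the index 0 to k. -/
theorem act_orbit_adWW (H : IsTetraPair D E z x bV bW r rz t 1) (k : Fin 4) :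
    ∃ c : K, c ≠ 0 ∧ ∃ p : Fin 4 → Fin 4, (∀ i, ∃ j, p j = i) ∧ p 0 = k ∧
      (∀ j y, (D.prod E).nichols.act (orbit x k) (adW D E bW j y) =
        c • adW D E bW (p j) ((D.prod E).nichols.act (orbit x k) y)) := by
  have key : ∀ l y j, (D.prod E).nichols.act (x l) (adW D E bW j y) =
      (-1 : K) • adW D E bW (tetraOp l j) ((D.prod E).nichols.act (x l) y) := by
    intro l y j
    rw [H.act_x_adW', neg_smul, one_smul]
  have h1 : (-1 : K) ≠ 0 := neg_ne_zero.2 one_ne_zero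
  fin_cases k
  · exact ⟨1, one_ne_zero, id, fun i => ⟨i, rfl⟩, rfl, by simp [orbit]⟩
  · exact ⟨-1, h1, tetraOp 3, tetraOp_surjective 3, by decide, fun j y => key 3 y j⟩
  · exact ⟨-1, h1, tetraOp 1, tetraOp_surjective 1, by decide, fun j y => key 1 y j⟩
  · exact ⟨-1, h1, tetraOp 2, tetraOp_surjective 2, by decide, fun j y => key 2 y j⟩

/-- The twelve pairs of distinct vertices form four 3-cycles, in each of which the vectors are
proportional by `adWW_cycle`. The four translates represent the cycles of (1, 2), (2, 0), (1, 3) and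
(0, 2). -/
theorem adRight_two_eq (H : IsTetraPair D E z x bV bW r rz t 1)
    (hq : (r * t) ^ 2 - r * t + 1 = 0) :
    adRight D E 2 = Submodule.span K (Set.range fun j =>
      (D.prod E).nichols.act (orbit x j) (adWW D E bV bW 1 2)) := by
  set S := Submodule.span K (Set.range fun j =>
      (D.prod E).nichols.act (orbit x j) (adWW D E bV bW 1 2)) with hS
  have hr := H.r_ne_zero
  have base : ∀ j, (D.prod E).nichols.act (orbit x j) (adWW D E bV bW 1 2) ∈ S :=
    fun j => Submodule.subset_span ⟨j, rfl⟩
  have cyc : ∀ i j, i ≠ j → adWW D E bV bW i j ∈ S →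
      adWW D E bV bW (tetraOp i j) i ∈ S := by
    intro i j hij h
    rw [H.adWW_cycle hq hij]
    exact Submodule.smul_mem _ _ h
  have orb : ∀ k, (D.prod E).nichols.act (x k) (adWW D E bV bW 1 2) ∈ S →
      adWW D E bV bW (tetraOp k 1) (tetraOp k 2) ∈ S := by
    intro k h
    rwa [H.act_x_adWW', Submodule.smul_mem_iff _ hr] at h
  have a12 : adWW D E bV bW 1 2 ∈ S := by
    have := base 0
    rwa [show orbit x 0 = 1 from rfl, map_one] at this
  have a31 : adWW D E bV bW 3 1 ∈ S := cyc 1 2 (by decide) a12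
  have a23 : adWW D E bV bW 2 3 ∈ S := cyc 3 1 (by decide) a31
  have a20 : adWW D E bV bW 2 0 ∈ S := orb 3 (base 1)
  have a32 : adWW D E bV bW 3 2 ∈ S := cyc 2 0 (by decide) a20
  have a03 : adWW D E bV bW 0 3 ∈ S := cyc 3 2 (by decide) a32
  have a13 : adWW D E bV bW 1 3 ∈ S := orb 1 (base 2)
  have a01 : adWW D E bV bW 0 1 ∈ S := cyc 1 3 (by decide) a13
  have a30 : adWW D E bV bW 3 0 ∈ S := cyc 0 1 (by decide) a01
  have a02 : adWW D E bV bW 0 2 ∈ S := orb 2 (base 3)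
  have a10 : adWW D E bV bW 1 0 ∈ S := cyc 0 2 (by decide) a02
  have a21 : adWW D E bV bW 2 1 ∈ S := cyc 1 0 (by decide) a10
  have aii : ∀ i, adWW D E bV bW i i ∈ S := fun i => by
    rw [H.adWW_self]; exact Submodule.zero_mem _
  have hmem : adWW D E bV bW 1 2 ∈ adRight D E 2 := by
    rw [adRight_two D E bV bW]
    exact Submodule.subset_span ⟨1, 2, rfl⟩
  refine le_antisymm ?_ (Submodule.span_le.2 ?_)
  · rw [adRight_two D E bV bW, Submodule.span_le]
    rintro _ ⟨i, j, rfl⟩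
    fin_cases i <;> fin_cases j
    exacts [aii 0, a01, a02, a03, a10, aii 1, a12, a13, a20, a21, aii 2, a23, a30, a31, a32, aii 3]
  · rintro _ ⟨j, rfl⟩
    exact (isSub_adPow _ (isSub_inr D E) (isSub_inl D E) 2).1 _ _ hmem

/-- The degrees x_i x_j z are constant on 3-cycles. For two different cycles, representatives with
the same first vertex can be chosen; after cancelling, an equality of degrees contradicts the
injectivity of x. -/
theorem injective_conj_orbit_two (H : IsTetraPair D E z x bV bW r rz t s) :
    Function.Injective fun j => orbit x j * (x 1 * (x 2 * z)) * (orbit x j)⁻¹ := by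
  have hmul : ∀ i j k, x i * x j = x i * x k → j = k :=
    fun i j k h => H.inj (mul_left_cancel h)
  have h : ∀ j, orbit x j * (x 1 * (x 2 * z)) * (orbit x j)⁻¹ =
      ![x 1 * x 2, x 2 * x 0, x 1 * x 3, x 0 * x 2] j * z := by
    intro j
    have hz : z * (orbit x j)⁻¹ = (orbit x j)⁻¹ * z :=
      (show Commute z (orbit x j) from H.z_comm_orbit j).inv_right
    have : orbit x j * (x 1 * (x 2 * z)) * (orbit x j)⁻¹ =
        (orbit x j * x 1 * (orbit x j)⁻¹) * (orbit x j * x 2 * (orbit x j)⁻¹) * z := by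
      rw [mul_assoc, mul_assoc (x 1), mul_assoc (x 2), hz]
      group
    rw [this]
    congr 1
    fin_cases j
    · simp [orbit]
    · exact congrArg₂ _ (H.conj_x 3 1) (H.conj_x 3 2)
    · exact congrArg₂ _ (H.conj_x 1 1) (H.conj_x 1 2)
    · exact congrArg₂ _ (H.conj_x 2 1) (H.conj_x 2 2)
  have r12 : x 1 * x 2 = x 3 * x 1 := H.rel 1 2
  have r31 : x 3 * x 1 = x 2 * x 3 := H.rel 3 1
  have r20 : x 2 * x 0 = x 3 * x 2 := H.rel 2 0
  have r32 : x 3 * x 2 = x 0 * x 3 := H.rel 3 2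
  have r13 : x 1 * x 3 = x 0 * x 1 := H.rel 1 3
  have r02 : x 0 * x 2 = x 1 * x 0 := H.rel 0 2
  have r10 : x 1 * x 0 = x 2 * x 1 := H.rel 1 0
  have n01 : x 1 * x 2 ≠ x 2 * x 0 := fun h =>
    absurd (hmul 2 3 0 (by rw [← r31, ← r12, h])) (by decide)
  have n02 : x 1 * x 2 ≠ x 1 * x 3 := fun h => absurd (hmul _ _ _ h) (by decide)
  have n03 : x 1 * x 2 ≠ x 0 * x 2 := fun h =>
    absurd (hmul 1 2 0 (by rw [h, r02])) (by decide)
  have n12 : x 2 * x 0 ≠ x 1 * x 3 := fun h =>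
    absurd (hmul 0 3 1 (by rw [← r32, ← r20, h, r13])) (by decide)
  have n13 : x 2 * x 0 ≠ x 0 * x 2 := fun h =>
    absurd (hmul 2 0 1 (by rw [h, r02, r10])) (by decide)
  have n23 : x 1 * x 3 ≠ x 0 * x 2 := fun h =>
    absurd (hmul 1 3 0 (by rw [h, r02])) (by decide)
  intro i j hij
  simp only [h] at hij
  have hij := mul_right_cancel hij
  fin_cases i <;> fin_cases j
  exacts [rfl, absurd hij n01, absurd hij n02, absurd hij n03, absurd hij n01.symm, rfl,
    absurd hij n12, absurd hij n13, absurd hij n02.symm, absurd hij n12.symm, rfl, absurd hij n23,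
    absurd hij n03.symm, absurd hij n13.symm, absurd hij n23.symm, rfl]

theorem isAbsolutelySimple_adRight_two {K : Type u} {G V W : Type*} [Field K] [Group G]
    [AddCommGroup V] [Module K V] [AddCommGroup W] [Module K W] {D : YDModule K G V}
    {E : YDModule K G W} {z : G} {x : Fin 4 → G} {bV : Module.Basis Unit K V}
    {bW : Module.Basis (Fin 4) K W} {r rz t : K}
    (H : IsTetraPair D E z x bV bW r rz t 1) (hq1 : r * t ≠ 1)
    (hq : (r * t) ^ 2 - r * t + 1 = 0) : (adRightYD D E 2).IsAbsolutelySimple := by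
  refine isAbsolutelySimple_restrict_of_orbit _ _ _ (orbit x) (H.adWW_ne_zero hq1)
    (H.adWW_isHomogeneous 1 2) H.injective_conj_orbit_two (H.adRight_two_eq hq).symm ?_
  change _ ∈ adRight D E 2
  rw [adRight_two D E bV bW]
  exact Submodule.subset_span ⟨1, 2, rfl⟩

/-- Moving ad w_i past the group element of a translate reduces to ad w_j applied to (ad w_1)(ad
w_2)(v). This is zero unless j = 0, and for j = 0 it is `topW`, which spans a line stable under the
orbit elements. -/
theorem adRight_three (H : IsTetraPair D E z x bV bW r rz t 1)
    (hq : (r * t) ^ 2 - r * t + 1 = 0) :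
    adRight D E 3 = Submodule.span K {topW D E bV bW} := by
  rw [adRight_succ bW (H.adRight_two_eq hq)]
  have hact : ∀ k, ∃ c : K, (D.prod E).nichols.act (orbit x k) (topW D E bV bW) =
      c • topW D E bV bW := by
    intro k
    fin_cases k
    · exact ⟨1, by simp [orbit]⟩
    · exact ⟨_, H.act_x_topW hq 3⟩
    · exact ⟨_, H.act_x_topW hq 1⟩
    · exact ⟨_, H.act_x_topW hq 2⟩
  refine le_antisymm (Submodule.span_le.2 ?_) (Submodule.span_le.2 ?_)
  · rintro _ ⟨i, _, ⟨k, rfl⟩, rfl⟩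
    obtain ⟨c, hc, p, hp, -, hpk⟩ := H.act_orbit_adWW k
    obtain ⟨j, rfl⟩ := hp i
    simp only
    rw [SetLike.mem_coe, ← Submodule.smul_mem_iff _ hc, ← hpk]
    by_cases hj : j = 0
    · obtain ⟨d, hd⟩ := hact k
      rw [hj]
      refine Submodule.mem_span_singleton.2 ⟨d, hd.symm⟩
    · rw [H.adW_adWW_eq_zero hq hj, map_zero]
      exact Submodule.zero_mem _
  · rintro _ rfl
    refine Submodule.subset_span ⟨0, _, ⟨0, rfl⟩, ?_⟩
    simp [orbit, topW]

theorem isAbsolutelySimple_adRight_three {K : Type u} {G V W : Type*} [Field K] [Group G]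
    [AddCommGroup V] [Module K V] [AddCommGroup W] [Module K W] {D : YDModule K G V}
    {E : YDModule K G W} {z : G} {x : Fin 4 → G} {bV : Module.Basis Unit K V}
    {bW : Module.Basis (Fin 4) K W} {r rz t : K}
    (H : IsTetraPair D E z x bV bW r rz t 1) (hq1 : r * t ≠ 1)
    (hq : (r * t) ^ 2 - r * t + 1 = 0) : (adRightYD D E 3).IsAbsolutelySimple := by
  have hspan := H.adRight_three hq
  refine isAbsolutelySimple_restrict_of_orbit _ _ _ (fun _ : Unit => 1) (H.topW_ne_zero hq1 hq)
    (H.adW_isHomogeneous 0 (H.adWW_isHomogeneous 1 2)) (Function.injective_of_subsingleton _) ?_ ?_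
  · rw [hspan]
    simp
  · rw [hspan]
    exact Submodule.mem_span_singleton_self _

/-- For i = 0, both terms of the derivative by v reduce to q² w_0 u w_0 by w_0² = 0, with u the
derivative of (ad w_1)(ad w_2)(v) by v. The other cases are translates, since `topW` is a common
eigenvector. -/
theorem adW_topW_eq_zero (H : IsTetraPair D E z x bV bW r rz t 1)
    (hq : (r * t) ^ 2 - r * t + 1 = 0) (i : Fin 4) :
    adW D E bW i (topW D E bV bW) = 0 := by
  have hq0 : r * t * r ≠ 0 := by
    refine mul_ne_zero ?_ H.r_ne_zero
    intro h
    rw [h] at hq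
    simp at hq
  have h0 : adW D E bW 0 (topW D E bV bW) = 0 := by
    refine eq_zero_of_derV bV bW (aug_adW _ _)
      (H.adW_mem_coinv _ (H.adW_mem_coinv _ (H.adWW_mem_coinv _ _))) ?_
    have hx : (D.prod E).nichols.act (x 0) (derV D E bV (topW D E bV bW)) =
        (r * t) • derV D E bV (topW D E bV bW) := by
      refine smul_right_injective _ H.r_ne_zero ?_
      simp only
      rw [← H.derV_act_x, H.act_x_zero_topW hq, map_smul, smul_smul, mul_comm r (r * t)]
    rw [H.derV_adW, hx, H.derV_topW hq, mul_add, H.genW_mul_self_mul, mul_smul_comm, zero_add,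
      smul_mul_assoc, add_mul, smul_mul_assoc, mul_assoc (derV D E bV _), H.genW_mul_self,
      mul_zero, smul_zero, add_zero, mul_assoc, smul_smul, pow_two, sub_self]
  obtain ⟨c, hc, p, -, hp, hpk⟩ := H.act_orbit_adWW i
  have h1 := congrArg ((D.prod E).nichols.act (orbit x i)) h0
  rw [hpk, map_zero, hp, smul_eq_zero, or_iff_right hc] at h1
  have hact : ∃ c : K, c ≠ 0 ∧ (D.prod E).nichols.act (orbit x i) (topW D E bV bW) =
      c • topW D E bV bW := by
    fin_cases i
    · exact ⟨1, one_ne_zero, by simp [orbit]⟩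
    · exact ⟨_, hq0, H.act_x_topW hq 3⟩
    · exact ⟨_, hq0, H.act_x_topW hq 1⟩
    · exact ⟨_, hq0, H.act_x_topW hq 2⟩
  obtain ⟨d, hd, hact⟩ := hact
  rw [hact, map_smul, smul_eq_zero, or_iff_right hd] at h1
  exact h1

theorem adRight_four (H : IsTetraPair D E z x bV bW r rz t 1)
    (hq : (r * t) ^ 2 - r * t + 1 = 0) : adRight D E 4 = ⊥ := by
  rw [adRight_succ bW (H.adRight_three hq), Submodule.span_eq_bot]
  rintro _ ⟨i, _, rfl, rfl⟩
  exact H.adW_topW_eq_zero hq i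

theorem adRight_add_four (H : IsTetraPair D E z x bV bW r rz t 1)
    (hq : (r * t) ^ 2 - r * t + 1 = 0) (m : ℕ) : adRight D E (m + 4) = ⊥ := by
  induction m with
  | zero => exact H.adRight_four hq
  | succ m ih =>
    have h : adRight D E (m + 4 + 1) =
      Submodule.map₂ (D.prod E).ad (LinearMap.range (LinearMap.inr K V W)) (adRight D E (m + 4)) :=
      rfl
    rw [show m + 1 + 4 = m + 4 + 1 by ring, h, ih, Submodule.map₂_bot_right]

/-- The assertions on `(ad V)^m(W)` and `(ad W)^m(V)`. -/
theorem adLeft_adRight {K : Type u} {G V W : Type*} [Field K] [Group G]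
    [AddCommGroup V] [Module K V] [AddCommGroup W] [Module K W] {D : YDModule K G V}
    {E : YDModule K G W} {z : G} {x : Fin 4 → G} {bV : Module.Basis Unit K V}
    {bW : Module.Basis (Fin 4) K W} {r rz t s : K}
    (H : IsTetraPair D E z x bV bW r rz t s) (hq1 : r * t ≠ 1) (h : r * rz * t = 1) :
    ((adLeftYD D E 1).IsAbsolutelySimple ∧ adLeft D E 2 = ⊥) ∧
    ((∀ m : ℕ, (adRightYD D E m).IsAbsolutelySimple ∨ adRight D E m = ⊥) ↔
      (r * t) ^ 2 - r * t + 1 = 0 ∧ s = 1) ∧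
    ((r * t) ^ 2 - r * t + 1 = 0 ∧ s = 1 → adRight D E 3 ≠ ⊥ ∧ adRight D E 4 = ⊥) := by
  refine ⟨⟨H.isAbsolutelySimple_adLeft_one hq1, H.adLeft_two h⟩, ⟨fun hX => ?_, ?_⟩, ?_⟩
  · refine H.eq_of_isAbsolutelySimple hq1 h ((hX 2).resolve_right fun h2 => H.adWW_ne_zero hq1 ?_)
    rw [← Submodule.mem_bot K, ← h2, adRight_two D E bV bW]
    exact Submodule.subset_span ⟨1, 2, rfl⟩
  · rintro ⟨hq, rfl⟩ m
    match m with
    | 0 => exact Or.inl H.isAbsolutelySimple_adRight_zero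
    | 1 => exact Or.inl (H.isAbsolutelySimple_adRight_one hq1)
    | 2 => exact Or.inl (H.isAbsolutelySimple_adRight_two hq1 hq)
    | 3 => exact Or.inl (H.isAbsolutelySimple_adRight_three hq1 hq)
    | m + 4 => exact Or.inr (H.adRight_add_four hq m)
  · rintro ⟨hq, rfl⟩
    refine ⟨fun h3 => H.topW_ne_zero hq1 hq ?_, H.adRight_four hq⟩
    rw [← Submodule.mem_bot K, ← h3, H.adRight_three hq]
    exact Submodule.mem_span_singleton_self _

end IsTetraPair

end TetraPair
end YDModule

namespace YDModule

/-! ### The induced modules M(x, c) for characters c -/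

section Induced

variable {K G : Type*} [Field K] [Group G]

/-- The generator `1 ⊗ 1` of `M(x, c)`. -/
noncomputable def inducedGen (x : G) (c : Subgroup.centralizer ({x} : Set G) →* Kˣ) :
    Representation.IndV (Subgroup.centralizer ({x} : Set G)).subtype (charRep c) :=
  Representation.IndV.mk _ (charRep c) 1 1

theorem inducedGen_isHomogeneous (x : G) (c : Subgroup.centralizer ({x} : Set G) →* Kˣ) :
    (inducedChar x c).IsHomogeneous x (inducedGen x c) := by
  have h := inducedCoact_mk x (charRep c) 1 1
  rw [inv_one, one_mul, mul_one] at h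
  exact h

/-- Acting by h produces `IndV.mk` at h⁻¹, and the coinvariance relation moves h⁻¹ into the second
factor, where it acts through c. -/
theorem act_inducedGen (x : G) (c : Subgroup.centralizer ({x} : Set G) →* Kˣ)
    (h : Subgroup.centralizer ({x} : Set G)) :
    (inducedChar x c).act h (inducedGen x c) = (c h : K) • inducedGen x c := by
  have h1 := Representation.Coinvariants.mk_self_apply (Representation.tprod
    ((Representation.leftRegular K G).comp (Subgroup.centralizer ({x} : Set G)).subtype)
    (charRep c)) h⁻¹ (MonoidAlgebra.single 1 1 ⊗ₜ[K] (1 : K))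
  have h2 : (inducedChar x c).act h (inducedGen x c) =
      Representation.IndV.mk _ (charRep c) (1 * (h : G)⁻¹) 1 :=
    Representation.ind_mk _ (charRep c) (h : G) 1 1
  have h3 : Representation.IndV.mk _ (charRep c) (h : G)⁻¹ ((c h : K)⁻¹) = inducedGen x c := by
    refine Eq.trans ?_ h1
    change Representation.Coinvariants.mk _ (MonoidAlgebra.single (h : G)⁻¹ (1 : K) ⊗ₜ[K]
      ((c h : K)⁻¹)) = _
    congr 1
    simp [charRep]
  rw [h2, ← h3, ← map_smul, smul_eq_mul, mul_inv_cancel₀ (c h).ne_zero, one_mul]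

/-- A linear form φ that takes the value 1 on the generator is constructed: it pairs g with c(g)⁻¹
on the centralizer and with 0 outside. The identity F(h g) c(h) = F(g) makes it factor through the
coinvariants. -/
theorem inducedGen_ne_zero (x : G) (c : Subgroup.centralizer ({x} : Set G) →* Kˣ) :
    inducedGen x c ≠ 0 := by
  classical
  let F : G → K := fun g => if hg : g ∈ Subgroup.centralizer ({x} : Set G) then
    ((c ⟨g, hg⟩)⁻¹ : Kˣ) else 0
  let φ : Representation.IndV (Subgroup.centralizer ({x} : Set G)).subtype (charRep c) →ₗ[K] K :=
    Representation.Coinvariants.lift _ (TensorProduct.lift (Finsupp.lsum K (fun g : G =>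
        LinearMap.toSpanSingleton K (K →ₗ[K] K) (F g • LinearMap.id)) ∘ₗ
      (MonoidAlgebra.coeffLinearEquiv K).toLinearMap)) (fun h => by
        refine TensorProduct.ext (MonoidAlgebra.lhom_ext' fun g => LinearMap.ext_ring ?_)
        ext
        suffices F (h * g) * c h = F g by simpa [charRep]
        by_cases hg : g ∈ Subgroup.centralizer ({x} : Set G)
        · simp only [F]
          rw [dif_pos hg, dif_pos (mul_mem h.2 hg),
            show c ⟨h * g, mul_mem h.2 hg⟩ = c h * c ⟨g, hg⟩ from map_mul c h ⟨g, hg⟩,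
            ← Units.val_mul]
          congr 1
          group
        · simp only [F]
          rw [dif_neg hg, dif_neg (fun h' => hg ((Subgroup.mul_mem_cancel_left _ h.2).1 h')),
            zero_mul])
  intro h0
  have h1 : φ (inducedGen x c) = F 1 := by
    simp [φ, inducedGen]
  rw [h0, map_zero] at h1
  have h2 : F 1 = 1 := by
    simp only [F]
    rw [dif_pos (one_mem _), show c ⟨1, one_mem _⟩ = 1 from map_one c]
    simp
  exact zero_ne_one (h1.trans h2)

theorem eq_top_of_inducedGen_mem (x : G) (c : Subgroup.centralizer ({x} : Set G) →* Kˣ)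
    {S : Submodule K (Representation.IndV (Subgroup.centralizer ({x} : Set G)).subtype (charRep c))}
    (h0 : inducedGen x c ∈ S) (h : ∀ g, ∀ v ∈ S, (inducedChar x c).act g v ∈ S) : S = ⊤ := by
  rw [eq_top_iff]
  intro v _
  rw [← Submodule.Quotient.mk_eq_zero]
  change S.mkQ v = (0 : _ →ₗ[K] _) v
  congr 1
  refine Representation.IndV.hom_ext _ _ fun g => LinearMap.ext_ring ?_
  change S.mkQ (Representation.IndV.mk _ (charRep c) g 1) = 0
  rw [Submodule.mkQ_apply, Submodule.Quotient.mk_eq_zero]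
  have h2 : (inducedChar x c).act g⁻¹ (inducedGen x c) =
      Representation.IndV.mk _ (charRep c) (1 * g⁻¹⁻¹) 1 :=
    Representation.ind_mk _ (charRep c) g⁻¹ 1 1
  rw [one_mul, inv_inv] at h2
  rw [← h2]
  exact h _ _ h0

theorem linearIndependent_of_isHomogeneous {X J : Type*} [AddCommGroup X] [Module K X]
    {D : YDModule K G X} {b : J → X} {d : J → G} (hd : Function.Injective d)
    (hb : ∀ j, D.IsHomogeneous (d j) (b j)) (h0 : ∀ j, b j ≠ 0) : LinearIndependent K b := by
  classical
  rw [linearIndependent_iff']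
  intro s c hc j hj
  have h1 := congrArg (fun v => D.coact v (d j)) hc
  simp only [map_sum, map_smul, map_zero, Finsupp.finsetSum_apply, Finsupp.smul_apply,
    Finsupp.zero_apply] at h1
  rw [Finset.sum_eq_single j] at h1
  · have := hb j
    unfold IsHomogeneous at this
    rw [this, Finsupp.single_eq_same, smul_eq_zero] at h1
    exact h1.resolve_right (h0 j)
  · intro i _ hij
    have := hb i
    unfold IsHomogeneous at this
    rw [this, Finsupp.single_eq_of_ne' (fun h => hij (hd h)), smul_zero]
  · exact fun h => absurd hj h

end Induced

end YDModule

/-! ### Non-abelian quotients of the group T -/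

namespace TetraGroup

variable {G : Type*} [Group G] {f : TetraGroup →* G}

theorem eq_zpow_mul (a : TetraGroup) : a = ζ ^ (Multiplicative.toAdd a.1) * (1, a.2) := by
  refine Prod.ext ?_ ?_
  · simp [ζ, ← ofAdd_zsmul]
  · simp [ζ]

theorem subgroup_eq_top (hf : Function.Surjective f) {H : Subgroup G} (hζ : f ζ ∈ H)
    (hχ : ∀ i, f (χ i) ∈ H) (g : G) : g ∈ H := by
  obtain ⟨a, rfl⟩ := hf g
  rw [eq_zpow_mul a, map_mul, map_zpow]
  refine mul_mem (zpow_mem hζ _) ?_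
  exact PresentedGroup.generated_by tetraRels
    (H.comap (f.comp (MonoidHom.inr (Multiplicative ℤ) (PresentedGroup tetraRels)))) hχ a.2

theorem rel (f : TetraGroup →* G) (i j : Fin 4) :
    f (χ i) * f (χ j) = f (χ (tetraOp i j)) * f (χ i) := by
  rw [← map_mul, χ_mul_χ, map_mul]

theorem comm_ζ (hf : Function.Surjective f) (g : G) : f ζ * g = g * f ζ := by
  obtain ⟨a, rfl⟩ := hf g
  rw [← map_mul, ← map_mul]
  congr 1
  exact Prod.ext (mul_comm _ _) (by simp [ζ])

/-- If two of the x_i coincide, then all do, because two distinct vertices generate the tetrahedron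
quandle. Then G is generated by z and one x_i, which commute, so G is abelian. -/
theorem injective_χ (hf : Function.Surjective f) (hG : ∃ a b : G, a * b ≠ b * a) :
    Function.Injective fun i => f (χ i) := by
  intro i j hij
  by_contra hne
  simp only at hij
  refine hG.elim fun a ⟨b, hab⟩ => hab ?_
  have h1 : f (χ (tetraOp i j)) = f (χ i) := by
    have := rel f i j
    rw [← hij] at this
    exact (mul_right_cancel this).symm
  have all : ∀ k, f (χ k) = f (χ i) := by
    intro k
    have key : ∀ i j k : Fin 4, i ≠ j → k = i ∨ k = j ∨ k = tetraOp i j ∨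
        tetraOp i k = j ∨ tetraOp i k = tetraOp i j := by decide
    have back : f (χ (tetraOp i k)) = f (χ i) → f (χ k) = f (χ i) := by
      intro h
      have := rel f i k
      rw [h] at this
      exact mul_left_cancel this
    rcases key i j k hne with rfl | rfl | rfl | h | h
    · rfl
    · exact hij.symm
    · exact h1
    · exact back (by rw [h, hij])
    · exact back (by rw [h, h1])
  have hcomm : ∀ g : G, g ∈ Subgroup.centralizer ({f (χ i)} : Set G) :=
    subgroup_eq_top hf (Subgroup.mem_centralizer_singleton_iff.2 (comm_ζ hf _))
      (fun k => Subgroup.mem_centralizer_singleton_iff.2 (by rw [all k]))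
  have hcomm' : ∀ g : G, g ∈ Subgroup.centralizer ({a} : Set G) :=
    subgroup_eq_top hf (Subgroup.mem_centralizer_singleton_iff.2 (comm_ζ hf _))
      (fun k => Subgroup.mem_centralizer_singleton_iff.2 (by
        rw [all k]; exact (Subgroup.mem_centralizer_singleton_iff.1 (hcomm a)).symm))
  exact (Subgroup.mem_centralizer_singleton_iff.1 (hcomm' b)).symm

/-- The x_i are conjugate, and a map to a commutative group is constant on conjugacy classes. -/
theorem char_χ {M : Type*} [CommGroup M] (ρ : G →* M) (f : TetraGroup →* G) (i : Fin 4) :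
    ρ (f (χ i)) = ρ (f (χ 0)) := by
  have h : ∀ i j, ρ (f (χ j)) = ρ (f (χ (tetraOp i j))) := by
    intro i j
    have := congrArg ρ (rel f i j)
    rw [map_mul, map_mul, mul_comm (ρ (f (χ (tetraOp i j))))] at this
    exact mul_left_cancel this
  fin_cases i
  · rfl
  · exact (h 3 0).symm
  · exact (h 1 0).symm
  · exact (h 2 0).symm

end TetraGroup

namespace YDModule

/-! ### A monomial basis for M(x_1, σ) -/

section TetraBasis

variable {K G X : Type*} [Field K] [Group G] [AddCommGroup X] [Module K X]

/-- The vectors `w₁ = e` and `w_{i ▷ 1} = - xᵢ e`. -/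
def tetraVec (D : YDModule K G X) (x : Fin 4 → G) (e : X) : Fin 4 → X :=
  ![e, -D.act (x 3) e, -D.act (x 1) e, -D.act (x 2) e]

/-- All sixteen cases follow from the quandle relations and the two eigenvalue equations for e. The
three products of the cycle x_1 x_2 = x_3 x_1 = x_2 x_3 act on e by s, which is the source of the
signs in `tetraSign`. -/
theorem act_tetraVec (D : YDModule K G X) {x : Fin 4 → G} {e : X} {s : K}
    (hrel : ∀ i j, x i * x j = x (tetraOp i j) * x i) (h0 : D.act (x 0) e = -e)
    (h12 : D.act (x 1 * x 2) e = s • e) (i j : Fin 4) :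
    D.act (x i) (D.tetraVec x e j) = -(tetraSign s i j • D.tetraVec x e (tetraOp i j)) := by
  have hA : ∀ i j k, tetraOp i j = k → ∀ y,
      D.act (x i) (D.act (x j) y) = D.act (x k) (D.act (x i) y) := by
    rintro i j _ rfl y
    rw [← Module.End.mul_apply, ← Module.End.mul_apply, ← map_mul, ← map_mul, hrel]
  have a12 : D.act (x 1) (D.act (x 2) e) = s • e := by
    rw [← Module.End.mul_apply, ← map_mul, h12]
  have a31 : D.act (x 3) (D.act (x 1) e) = s • e := by rw [← hA 1 2 3 (by decide), a12]
  have a23 : D.act (x 2) (D.act (x 3) e) = s • e := by rw [← hA 3 1 2 (by decide), a31]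
  have b1 : D.act (x 0) (D.act (x 3) e) = -D.act (x 2) e := by
    rw [hA 0 3 2 (by decide), h0, map_neg]
  have b2 : D.act (x 0) (D.act (x 1) e) = -D.act (x 3) e := by
    rw [hA 0 1 3 (by decide), h0, map_neg]
  have b3 : D.act (x 0) (D.act (x 2) e) = -D.act (x 1) e := by
    rw [hA 0 2 1 (by decide), h0, map_neg]
  have c1 : D.act (x 1) (D.act (x 3) e) = -D.act (x 3) e := by
    rw [hA 1 3 0 (by decide), b2]
  have c2 : D.act (x 1) (D.act (x 1) e) = -(s • D.act (x 2) e) := by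
    rw [← neg_neg (D.act (x 1) e), ← b3, map_neg, hA 1 0 2 (by decide), a12, map_smul]
  have d1 : D.act (x 2) (D.act (x 2) e) = -(s • D.act (x 3) e) := by
    rw [← neg_neg (D.act (x 2) e), ← b1, map_neg, hA 2 0 3 (by decide), a23, map_smul]
  have d2 : D.act (x 2) (D.act (x 1) e) = -D.act (x 1) e := by
    rw [hA 2 1 0 (by decide), b3]
  have e1 : D.act (x 3) (D.act (x 3) e) = -(s • D.act (x 1) e) := by
    rw [← neg_neg (D.act (x 3) e), ← b2, map_neg, hA 3 0 1 (by decide), a31, map_smul]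
  have e3 : D.act (x 3) (D.act (x 2) e) = -D.act (x 2) e := by
    rw [hA 3 2 0 (by decide), b1]
  fin_cases i <;> fin_cases j <;>
    simp [tetraVec, tetraSign, tetraOp, h0, a12, a31, a23, b1, b2, b3, c1, c2, d1, d2, e1, e3]

theorem tetraVec_isHomogeneous {D : YDModule K G X} {x : Fin 4 → G} {e : X}
    (hrel : ∀ i j, x i * x j = x (tetraOp i j) * x i) (he : D.IsHomogeneous (x 0) e)
    (j : Fin 4) : D.IsHomogeneous (x j) (D.tetraVec x e j) := by
  have key : ∀ k, D.IsHomogeneous (x (tetraOp k 0)) (-D.act (x k) e) := by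
    intro k
    have h := (he.act (x k)).smul (-1 : K)
    rwa [hrel, mul_inv_cancel_right, neg_smul, one_smul] at h
  fin_cases j
  · exact he
  · exact key 3
  · exact key 1
  · exact key 2

theorem tetraVec_ne_zero (D : YDModule K G X) (x : Fin 4 → G) {e : X} (he : e ≠ 0) (j : Fin 4) :
    D.tetraVec x e j ≠ 0 := by
  have key : ∀ k, -D.act (x k) e ≠ 0 := by
    intro k h
    have h2 := congrArg (D.act (x k)⁻¹) (neg_eq_zero.1 h)
    rw [← Module.End.mul_apply, ← map_mul, inv_mul_cancel, map_one, map_zero] at h2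
    exact he h2
  fin_cases j
  · exact he
  · exact key 3
  · exact key 1
  · exact key 2

theorem act_z_tetraVec (D : YDModule K G X) {x : Fin 4 → G} {z : G} {e : X} {t : K}
    (hz : ∀ i, z * x i = x i * z) (h : D.act z e = t • e) (j : Fin 4) :
    D.act z (D.tetraVec x e j) = t • D.tetraVec x e j := by
  have key : ∀ k, D.act z (-D.act (x k) e) = t • -D.act (x k) e := by
    intro k
    rw [map_neg, ← Module.End.mul_apply, ← map_mul, hz, map_mul, Module.End.mul_apply, h, map_smul,
      smul_neg]
  fin_cases j
  · exact h
  · exact key 3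
  · exact key 1
  · exact key 2

end TetraBasis

end YDModule

/-! ### Realisation of V and W as a tetrahedron pair -/

namespace TetraGroup

open YDModule

variable {K G : Type*} [Field K] [Group G] {f : TetraGroup →* G}

theorem exists_basis_moduleV (hf : Function.Surjective f) (ρ : G →* Kˣ) :
    ∃ b : Module.Basis Unit K _, (moduleV f ρ).IsHomogeneous (f ζ) (b ()) ∧
      ∀ g, (moduleV f ρ).act g (b ()) = (ρ g : K) • b () := by
  set c := ρ.comp (Subgroup.centralizer ({f ζ} : Set G)).subtype with hc
  have hact : ∀ g, (moduleV f ρ).act g (inducedGen (f ζ) c) = (ρ g : K) • inducedGen (f ζ) c :=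
    fun g => act_inducedGen (f ζ) c
      ⟨g, Subgroup.mem_centralizer_singleton_iff.2 (comm_ζ hf g).symm⟩
  have htop : Submodule.span K {inducedGen (f ζ) c} = ⊤ := by
    refine eq_top_of_inducedGen_mem _ _ (Submodule.mem_span_singleton_self _) fun g v hv => ?_
    obtain ⟨a, rfl⟩ := Submodule.mem_span_singleton.1 hv
    rw [map_smul, show (inducedChar (f ζ) c).act g _ = _ from hact g]
    exact Submodule.smul_mem _ _ (Submodule.smul_mem _ _ (Submodule.mem_span_singleton_self _))
  let b := Module.Basis.mk (v := fun _ : Unit => inducedGen (f ζ) c)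
    (LinearIndependent.of_subsingleton () (inducedGen_ne_zero _ _)) (by rw [Set.range_const, htop])
  have hb : b () = inducedGen (f ζ) c := Module.Basis.mk_apply _ _ _
  refine ⟨b, ?_, ?_⟩
  · rw [hb]
    exact inducedGen_isHomogeneous (f ζ) c
  · rw [hb]
    exact hact

/-- The vectors `tetraVec` are independent because their degrees x_j are distinct, and they span
because their span contains the generator and is stable under generators of G. -/
theorem exists_basis_moduleW (hf : Function.Surjective f)
    (hinj : Function.Injective fun i => f (χ i))
    (σ : Subgroup.centralizer ({f (χ 0)} : Set G) →* Kˣ) (hσ : (σ (centX₁ f) : K) = -1) :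
    ∃ b : Module.Basis (Fin 4) K _, (∀ i, (moduleW f σ).IsHomogeneous (f (χ i)) (b i)) ∧
      (∀ i, (moduleW f σ).act (f ζ) (b i) = (σ (centZ f) : K) • b i) ∧
      ∀ i j, (moduleW f σ).act (f (χ i)) (b j) =
        -(tetraSign (σ (centX₂X₃ f) : K) i j • b (tetraOp i j)) := by
  set e := inducedGen (f (χ 0)) σ with he
  have e0 : (moduleW f σ).act (f (χ 0)) e = -e := by
    have := act_inducedGen (f (χ 0)) σ (centX₁ f)
    rwa [hσ, neg_smul, one_smul] at this
  have e12 : (moduleW f σ).act (f (χ 1) * f (χ 2)) e = (σ (centX₂X₃ f) : K) • e :=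
    act_inducedGen (f (χ 0)) σ (centX₂X₃ f)
  have ez : (moduleW f σ).act (f ζ) e = (σ (centZ f) : K) • e :=
    act_inducedGen (f (χ 0)) σ (centZ f)
  let w := (moduleW f σ).tetraVec (fun i => f (χ i)) e
  have hx : ∀ i j, (moduleW f σ).act (f (χ i)) (w j) =
      -(tetraSign (σ (centX₂X₃ f) : K) i j • w (tetraOp i j)) :=
    (moduleW f σ).act_tetraVec (rel f) e0 e12
  have hz : ∀ j, (moduleW f σ).act (f ζ) (w j) = (σ (centZ f) : K) • w j :=
    (moduleW f σ).act_z_tetraVec (fun i => comm_ζ hf _) ez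
  have hw : ∀ j, (moduleW f σ).IsHomogeneous (f (χ j)) (w j) :=
    tetraVec_isHomogeneous (rel f) (inducedGen_isHomogeneous _ _)
  have htop : Submodule.span K (Set.range w) = ⊤ := by
    -- Requiring that the image of the span be equal to it, and not merely contained in it, makes H
    -- closed under inverses.
    let H : Subgroup G :=
      { carrier := {g | (Submodule.span K (Set.range w)).map ((moduleW f σ).act g) =
          Submodule.span K (Set.range w)}
        one_mem' := by
          simp only [Set.mem_ofPred_eq, map_one]
          exact Submodule.map_id _
        mul_mem' := by
          intro a b ha hb
          simp only [Set.mem_ofPred_eq, map_mul] at *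
          rw [Module.End.mul_eq_comp, Submodule.map_comp, hb, ha]
        inv_mem' := by
          intro a ha
          simp only [Set.mem_ofPred_eq] at *
          conv_lhs => rw [← ha]
          rw [← Submodule.map_comp, ← Module.End.mul_eq_comp, ← map_mul, inv_mul_cancel, map_one]
          exact Submodule.map_id _ }
    have hH : ∀ g, g ∈ H := by
      refine subgroup_eq_top hf ?_ fun i => ?_
      · change (Submodule.span K (Set.range w)).map _ = _
        rw [Submodule.map_span, ← Set.range_comp]
        exact span_range_smul fun j => ⟨_, (σ (centZ f)).ne_zero, hz j⟩
      · change (Submodule.span K (Set.range w)).map _ = _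
        rw [Submodule.map_span, ← Set.range_comp,
          ← (show Function.Surjective (tetraOp i) from tetraOp_surjective i).range_comp w]
        refine span_range_smul fun j => ⟨-tetraSign (σ (centX₂X₃ f) : K) i j, ?_, ?_⟩
        · unfold tetraSign
          split_ifs <;> simp
        · rw [neg_smul]
          exact hx i j
    refine eq_top_of_inducedGen_mem _ _ (Submodule.subset_span ⟨0, rfl⟩) fun g v hv => ?_
    rw [← show _ = Submodule.span K (Set.range w) from hH g]
    exact Submodule.mem_map_of_mem hv
  let b := Module.Basis.mk (linearIndependent_of_isHomogeneous hinj hw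
    (tetraVec_ne_zero _ _ (inducedGen_ne_zero _ _))) htop.ge
  have hb : ∀ j, b j = w j := Module.Basis.mk_apply _ _
  refine ⟨b, ?_, ?_, ?_⟩
  · simpa only [hb] using hw
  · simpa only [hb] using hz
  · simpa only [hb] using hx

theorem exists_isTetraPair (hf : Function.Surjective f) (hG : ∃ a b : G, a * b ≠ b * a)
    (ρ : G →* Kˣ) (σ : Subgroup.centralizer ({f (χ 0)} : Set G) →* Kˣ)
    (hσ : (σ (centX₁ f) : K) = -1) :
    ∃ bV bW, IsTetraPair (moduleV f ρ) (moduleW f σ) (f ζ) (fun i => f (χ i)) bV bW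
      (ρ (f (χ 0)) : K) (ρ (f ζ) : K) (σ (centZ f) : K) (σ (centX₂X₃ f) : K) := by
  have hinj := injective_χ hf hG
  obtain ⟨bV, hV, hVact⟩ := exists_basis_moduleV hf ρ
  obtain ⟨bW, hW, hWz, hWx⟩ := exists_basis_moduleW hf hinj σ hσ
  refine ⟨bV, bW, hV, hW, fun i => ?_, hVact _, hWz, hWx, hinj, rel f, fun i => comm_ζ hf _, ?_⟩
  · rw [hVact, char_χ ρ f i]
  -- The relation s² = 1 holds automatically: of the two sides of x_1 x_0 = x_2 x_1, the first maps
  -- w_2 to w_1 and the second maps it to s² w_1.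
  · have h := congrArg (fun g => (moduleW f σ).act g (bW 2)) (rel f 1 0)
    simp only [map_mul, Module.End.mul_apply, hWx, map_neg, map_smul] at h
    simp [tetraOp, tetraSign, smul_smul] at h
    refine sub_eq_zero.1 ((smul_eq_zero.1 ?_).resolve_right (bW.ne_zero 1))
    rw [sub_smul, one_smul, ← h, sub_self]

end TetraGroup

theorem proposition3p11 {K G : Type*} [Field K] [Group G]
    (f : TetraGroup →* G) (hf : Function.Surjective f) (hG : ∃ a b : G, a * b ≠ b * a)
    (ρ : G →* Kˣ)
    (σ : Subgroup.centralizer ({f (TetraGroup.χ 0)} : Set G) →* Kˣ)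
    (h₁ : (ρ (f (TetraGroup.χ 0)) : K) * σ (TetraGroup.centZ f) ≠ 1)
    (h₂ : (σ (TetraGroup.centX₁ f) : K) = -1)
    (h₃ : (ρ (f (TetraGroup.χ 0) * f TetraGroup.ζ) : K) * σ (TetraGroup.centZ f) = 1) :
    ((YDModule.adLeftYD (TetraGroup.moduleV f ρ) (TetraGroup.moduleW f σ) 1).IsAbsolutelySimple ∧
      YDModule.adLeft (TetraGroup.moduleV f ρ) (TetraGroup.moduleW f σ) 2 = ⊥) ∧
    ((∀ m : ℕ,
        (YDModule.adRightYD (TetraGroup.moduleV f ρ) (TetraGroup.moduleW f σ) m).IsAbsolutelySimple ∨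
          YDModule.adRight (TetraGroup.moduleV f ρ) (TetraGroup.moduleW f σ) m = ⊥) ↔
      ((ρ (f (TetraGroup.χ 0)) : K) * σ (TetraGroup.centZ f)) ^ 2
          - (ρ (f (TetraGroup.χ 0)) : K) * σ (TetraGroup.centZ f) + 1 = 0 ∧
        (σ (TetraGroup.centX₂X₃ f) : K) = 1) ∧
    (((ρ (f (TetraGroup.χ 0)) : K) * σ (TetraGroup.centZ f)) ^ 2
          - (ρ (f (TetraGroup.χ 0)) : K) * σ (TetraGroup.centZ f) + 1 = 0 ∧
        (σ (TetraGroup.centX₂X₃ f) : K) = 1 →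
      YDModule.adRight (TetraGroup.moduleV f ρ) (TetraGroup.moduleW f σ) 3 ≠ ⊥ ∧
      YDModule.adRight (TetraGroup.moduleV f ρ) (TetraGroup.moduleW f σ) 4 = ⊥) := by
  obtain ⟨bV, bW, H⟩ := TetraGroup.exists_isTetraPair hf hG ρ σ h₂
  refine H.adLeft_adRight h₁ ?_
  rw [← h₃, map_mul, Units.val_mul]
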